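/- Let $\mathfrak{g}=\{X\in M_5(\mathbb{C}) : X^{\tau}\gamma=-\gamma X\}$, $\gamma=\mathrm{diag}(1,1,1,1,-1)$, be the complexification of the Lie algebra $\mathfrak{so}(4,1)$ of $SO_e(4,1)$, and let $\mathfrak{g}=\mathfrak{k}\oplus\mathfrak{p}$ be the Cartan decomposition for $\theta(X)=-X^{\tau}$, so $\mathfrak{p}=\{X\in\mathfrak{g} : \theta(X)=-X\}$. Let $U(\mathfrak{g})$ be the universal enveloping algebra of $\mathfrak{g}$, and let $C(\mathfrak{p})$ be the complex Clifford algebra of $\mathfrak{p}$ with respect to the trace form $B(X,Y)=\mathrm{tr}(XY)$, i.e. with relations $X^2=B(X,X)\cdot 1$ for $X\in\mathfrak{p}$. Let $K=\{\mathrm{diag}(k,1) : k\in SO(4)\}$ be the maximal compact subgroup $S(O(4)\times O(1))_e\cong SO(4)$ of $SO_e(4,1)$. It acts on $\mathfrak{g}$ by conjugation, hence by algebra automorphisms on $U(\mathfrak{g})$, on $C(\mathfrak{p})$, and diagonally on $U(\mathfrak{g})\otimes_{\mathbb{C}} C(\mathfrak{p})$; a superscript $K$ denotes the subalgebra of $K$-invariants.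 Then $(U(\mathfrak{g})\otimes C(\mathfrak{p}))^{K}$ is a free module of rank $16$ over $U(\mathfrak{g})^{K}$, where $u\in U(\mathfrak{g})^K$ acts by left multiplication by $u\otimes 1$: it has a basis with $16$ elements over $U(\mathfrak{g})^K$. -/

import Mathlib

open scoped TensorProduct

namespace SO41

attribute [local instance 100] LieRing.ofAssociativeRing

/-- `𝔤 = 𝔰𝔬(4,1)_ℂ`: the complex `5 × 5` matrices `X` with `Xᵀ γ = -γ X`, `γ = diag(1,1,1,1,-1)`.
This is the complexification of `𝔤₀ = 𝔰𝔬(4,1)`, the real matrices with the same property. -/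
abbrev g : LieSubalgebra ℂ (Matrix (Fin 4 ⊕ Fin 1) (Fin 4 ⊕ Fin 1) ℂ) :=
  LieAlgebra.Orthogonal.so' (Fin 4) (Fin 1) ℂ

theorem mem_g_iff (X : Matrix (Fin 4 ⊕ Fin 1) (Fin 4 ⊕ Fin 1) ℂ) :
    X ∈ g ↔ X.transpose * LieAlgebra.Orthogonal.indefiniteDiagonal (Fin 4) (Fin 1) ℂ =
      LieAlgebra.Orthogonal.indefiniteDiagonal (Fin 4) (Fin 1) ℂ * (-X) := by
  unfold g LieAlgebra.Orthogonal.so'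
  rw [mem_skewAdjointMatricesLieSubalgebra, mem_skewAdjointMatricesSubmodule]
  rfl

/-- The Cartan involution `θ(X) = -Xᵀ` of `𝔤`. -/
def theta : g →ₗ[ℂ] g where
  toFun X := ⟨-(X : Matrix (Fin 4 ⊕ Fin 1) (Fin 4 ⊕ Fin 1) ℂ).transpose, by
    have hX := (mem_g_iff _).1 X.2
    set J := LieAlgebra.Orthogonal.indefiniteDiagonal (Fin 4) (Fin 1) ℂ with hJ
    have hJJ : J * J = 1 := by
      rw [hJ, LieAlgebra.Orthogonal.indefiniteDiagonal, Matrix.diagonal_mul_diagonal,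
        ← Matrix.diagonal_one]
      congr 1
      funext i
      rcases i with i | i <;> simp
    rw [mem_g_iff, ← hJ]
    have h2 : J * (X.1.transpose * J) * J = J * (J * (-X.1)) * J := by rw [hX]
    have h3 : J * X.1.transpose = -(X.1 * J) := by
      calc J * X.1.transpose = J * (X.1.transpose * J) * J := by
            rw [Matrix.mul_assoc, Matrix.mul_assoc, hJJ, Matrix.mul_one]
        _ = J * (J * (-X.1)) * J := h2
        _ = (J * J) * (-X.1) * J := by rw [← Matrix.mul_assoc J J]
        _ = -(X.1 * J) := by rw [hJJ, Matrix.one_mul, Matrix.neg_mul]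
    simp [h3]⟩
  map_add' X Y := by
    apply Subtype.ext
    change -((X : Matrix (Fin 4 ⊕ Fin 1) (Fin 4 ⊕ Fin 1) ℂ) + Y).transpose =
      -(X : Matrix (Fin 4 ⊕ Fin 1) (Fin 4 ⊕ Fin 1) ℂ).transpose +
        -(Y : Matrix (Fin 4 ⊕ Fin 1) (Fin 4 ⊕ Fin 1) ℂ).transpose
    rw [Matrix.transpose_add, neg_add]
  map_smul' c X := by
    apply Subtype.ext
    change -(c • (X : Matrix (Fin 4 ⊕ Fin 1) (Fin 4 ⊕ Fin 1) ℂ)).transpose =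
      c • -(X : Matrix (Fin 4 ⊕ Fin 1) (Fin 4 ⊕ Fin 1) ℂ).transpose
    rw [Matrix.transpose_smul, smul_neg]

/-- `𝔭`, the `(-1)`-eigenspace of the Cartan involution, so that `𝔤 = 𝔨 ⊕ 𝔭`. -/
abbrev p : Submodule ℂ g := Module.End.eigenspace theta (-1)

theorem mem_p_iff (X : g) :
    X ∈ p ↔ (X : Matrix (Fin 4 ⊕ Fin 1) (Fin 4 ⊕ Fin 1) ℂ).transpose = X := by
  rw [Module.End.mem_eigenspace_iff, Subtype.ext_iff]
  simp [theta]

/-- The trace form `B(X, Y) = tr(X Y)` on `𝔭`. -/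
def B : LinearMap.BilinForm ℂ p :=
  LinearMap.mk₂ ℂ
    (fun X Y => (((X : g) : Matrix (Fin 4 ⊕ Fin 1) (Fin 4 ⊕ Fin 1) ℂ) *
      ((Y : g) : Matrix (Fin 4 ⊕ Fin 1) (Fin 4 ⊕ Fin 1) ℂ)).trace)
    (fun X X' Y => by simp [Matrix.add_mul])
    (fun c X Y => by simp)
    (fun X Y Y' => by simp [Matrix.mul_add])
    (fun c X Y => by simp)

/-- The quadratic form `X ↦ B(X, X) = tr(X X)` on `𝔭`. -/
def Q : QuadraticForm ℂ p := LinearMap.BilinMap.toQuadraticMap B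

theorem Q_apply (X : p) : Q X = (((X : g) : Matrix (Fin 4 ⊕ Fin 1) (Fin 4 ⊕ Fin 1) ℂ) *
    ((X : g) : Matrix (Fin 4 ⊕ Fin 1) (Fin 4 ⊕ Fin 1) ℂ)).trace := rfl

/-- The Clifford algebra `C(𝔭)` of `𝔭` with respect to the trace form. -/
abbrev C : Type := CliffordAlgebra Q

/-- The universal enveloping algebra `U(𝔤)`. -/
abbrev U : Type := UniversalEnvelopingAlgebra ℂ g

/-- The maximal compact subgroup `K = S(O(4) × O(1))ₑ ≅ SO(4)` of `SOₑ(4,1)`, as the group of the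
upper left blocks `k` of its elements `diag(k, 1)`. -/
abbrev K : Type := Matrix.specialOrthogonalGroup (Fin 4) ℝ

/-- The embedding `k ↦ diag(k, 1)` of `K` into the complex `5 × 5` matrices. -/
def toMat : K →* Matrix (Fin 4 ⊕ Fin 1) (Fin 4 ⊕ Fin 1) ℂ where
  toFun k := Matrix.fromBlocks ((k : Matrix (Fin 4) (Fin 4) ℝ).map Complex.ofReal) 0 0 1
  map_one' := by
    simp [Matrix.map_one, Matrix.fromBlocks_one]
  map_mul' k l := by
    simp [Matrix.fromBlocks_multiply]
    ext i j
    simp [Matrix.mul_apply]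

theorem toMat_inv_mul (k : K) : toMat k⁻¹ * toMat k = 1 := by
  rw [← map_mul, inv_mul_cancel, map_one]

theorem toMat_mul_inv (k : K) : toMat k * toMat k⁻¹ = 1 := by
  rw [← map_mul, mul_inv_cancel, map_one]

theorem toMat_transpose (k : K) : (toMat k).transpose = toMat k⁻¹ := by
  have h : ((k⁻¹ : K) : Matrix (Fin 4) (Fin 4) ℝ) = (k : Matrix (Fin 4) (Fin 4) ℝ).transpose := rfl
  simp only [toMat, MonoidHom.coe_mk, OneHom.coe_mk, Matrix.fromBlocks_transpose, h]
  simp [Matrix.transpose_map]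

theorem toMat_commute (k : K) :
    toMat k * LieAlgebra.Orthogonal.indefiniteDiagonal (Fin 4) (Fin 1) ℂ =
      LieAlgebra.Orthogonal.indefiniteDiagonal (Fin 4) (Fin 1) ℂ * toMat k := by
  have h : LieAlgebra.Orthogonal.indefiniteDiagonal (Fin 4) (Fin 1) ℂ =
      Matrix.fromBlocks 1 0 0 (-1) := by
    ext i j
    rcases i with i | i <;> rcases j with j | j <;>
      simp only [LieAlgebra.Orthogonal.indefiniteDiagonal, Matrix.diagonal_apply,
        Matrix.fromBlocks_apply₁₁, Matrix.fromBlocks_apply₁₂, Matrix.fromBlocks_apply₂₁,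
        Matrix.fromBlocks_apply₂₂, Matrix.one_apply, Matrix.neg_apply, Matrix.zero_apply,
        Sum.inl.injEq, Sum.inr.injEq, reduceCtorEq, Sum.elim_inl, Sum.elim_inr, if_false]
    split_ifs <;> simp
  rw [h]
  simp [toMat, Matrix.fromBlocks_multiply]

/-- The adjoint action `Ad(k) X = k X k⁻¹` of `K` on `𝔤`. -/
def Ad (k : K) : g →ₗ⁅ℂ⁆ g where
  toFun X := ⟨toMat k * (X : Matrix (Fin 4 ⊕ Fin 1) (Fin 4 ⊕ Fin 1) ℂ) * toMat k⁻¹, by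
    have hX := (mem_g_iff _).1 X.2
    have h1 := toMat_commute k
    have h2 := toMat_commute k⁻¹
    have h3 := toMat_transpose k⁻¹
    rw [inv_inv] at h3
    rw [mem_g_iff, Matrix.transpose_mul, Matrix.transpose_mul, h3, toMat_transpose]
    set J := LieAlgebra.Orthogonal.indefiniteDiagonal (Fin 4) (Fin 1) ℂ
    calc toMat k * (X.1.transpose * toMat k⁻¹) * J
        = toMat k * (X.1.transpose * J) * toMat k⁻¹ := by
          simp only [Matrix.mul_assoc]; rw [h2]
      _ = (toMat k * J) * -X.1 * toMat k⁻¹ := by rw [hX]; simp only [Matrix.mul_assoc]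
      _ = J * -(toMat k * X.1 * toMat k⁻¹) := by
          rw [h1]; simp only [Matrix.mul_assoc, Matrix.mul_neg, Matrix.neg_mul]⟩
  map_add' X Y := by
    apply Subtype.ext
    simp [Matrix.mul_add, Matrix.add_mul]
  map_smul' c X := by
    apply Subtype.ext
    simp
  map_lie' {X Y} := by
    apply Subtype.ext
    have h : ∀ A B : Matrix (Fin 4 ⊕ Fin 1) (Fin 4 ⊕ Fin 1) ℂ,
        (toMat k * A * toMat k⁻¹) * (toMat k * B * toMat k⁻¹) = toMat k * (A * B) * toMat k⁻¹ := by
      intro A B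
      calc (toMat k * A * toMat k⁻¹) * (toMat k * B * toMat k⁻¹)
          = toMat k * A * (toMat k⁻¹ * toMat k) * B * toMat k⁻¹ := by
            simp only [Matrix.mul_assoc]
        _ = _ := by rw [toMat_inv_mul, Matrix.mul_one]; simp only [Matrix.mul_assoc]
    simp only [LieSubalgebra.coe_bracket, Ring.lie_def, h, Matrix.mul_sub, Matrix.sub_mul]

theorem coe_Ad (k : K) (X : g) : (Ad k X : Matrix (Fin 4 ⊕ Fin 1) (Fin 4 ⊕ Fin 1) ℂ) =
    toMat k * (X : Matrix (Fin 4 ⊕ Fin 1) (Fin 4 ⊕ Fin 1) ℂ) * toMat k⁻¹ := rfl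

theorem Ad_mem_p (k : K) {X : g} (hX : X ∈ p) : Ad k X ∈ p := by
  rw [mem_p_iff] at hX ⊢
  have h3 := toMat_transpose k⁻¹
  rw [inv_inv] at h3
  rw [coe_Ad, Matrix.transpose_mul, Matrix.transpose_mul, h3, toMat_transpose, hX,
    Matrix.mul_assoc]

/-- The action of `K` on `𝔭` by restriction of `Ad`; it preserves the trace form. -/
def AdP (k : K) : Q →qᵢ Q where
  toLinearMap := (Ad k : g →ₗ[ℂ] g).restrict (fun _ hX => Ad_mem_p k hX)
  map_app' X := by
    change (((Ad k X : g) : Matrix (Fin 4 ⊕ Fin 1) (Fin 4 ⊕ Fin 1) ℂ) *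
      ((Ad k X : g) : Matrix (Fin 4 ⊕ Fin 1) (Fin 4 ⊕ Fin 1) ℂ)).trace = _
    rw [Q_apply, coe_Ad]
    generalize ((X : g) : Matrix (Fin 4 ⊕ Fin 1) (Fin 4 ⊕ Fin 1) ℂ) = A
    calc (toMat k * A * toMat k⁻¹ * (toMat k * A * toMat k⁻¹)).trace
        = (toMat k * (A * (toMat k⁻¹ * toMat k) * A * toMat k⁻¹)).trace := by
          simp only [Matrix.mul_assoc]
      _ = (A * A * (toMat k⁻¹ * toMat k)).trace := by
          rw [toMat_inv_mul, Matrix.trace_mul_comm, Matrix.mul_assoc, toMat_inv_mul,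
            Matrix.mul_one, Matrix.mul_one, Matrix.mul_one]
      _ = (A * A).trace := by rw [toMat_inv_mul, Matrix.mul_one]

/-- The action of `k ∈ K` on `U(𝔤)` by the algebra map that extends `Ad(k)`. -/
noncomputable def actU (k : K) : U →ₐ[ℂ] U :=
  UniversalEnvelopingAlgebra.lift ℂ ((UniversalEnvelopingAlgebra.ι ℂ).comp (Ad k))

/-- The action of `k ∈ K` on `C(𝔭)` by the algebra map that extends `Ad(k)`. -/
noncomputable def actC (k : K) : C →ₐ[ℂ] C :=
  CliffordAlgebra.map (AdP k)

theorem actU_ι (k : K) (X : g) :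
    actU k (UniversalEnvelopingAlgebra.ι ℂ X) = UniversalEnvelopingAlgebra.ι ℂ (Ad k X) := by
  simp [actU]

theorem actC_ι (k : K) (X : p) :
    actC k (CliffordAlgebra.ι Q X) = CliffordAlgebra.ι Q (AdP k X) := by
  simp [actC]

/-- The diagonal action of `k ∈ K` on `U(𝔤) ⊗ C(𝔭)`. -/
noncomputable def actUC (k : K) : U ⊗[ℂ] C →ₐ[ℂ] U ⊗[ℂ] C :=
  Algebra.TensorProduct.map (actU k) (actC k)

/-- The algebra `U(𝔤)^K` of `K`-invariants. -/
noncomputable def UK : Subalgebra ℂ U := ⨅ k : K, AlgHom.equalizer (actU k) (AlgHom.id ℂ U)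

/-- The algebra `(U(𝔤) ⊗ C(𝔭))^K` of `K`-invariants. -/
noncomputable def UCK : Subalgebra ℂ (U ⊗[ℂ] C) :=
  ⨅ k : K, AlgHom.equalizer (actUC k) (AlgHom.id ℂ (U ⊗[ℂ] C))

theorem mem_UK (u : U) : u ∈ UK ↔ ∀ k : K, actU k u = u := by
  simp [UK, Algebra.mem_iInf, AlgHom.mem_equalizer]

theorem mem_UCK (z : U ⊗[ℂ] C) : z ∈ UCK ↔ ∀ k : K, actUC k z = z := by
  simp [UCK, Algebra.mem_iInf, AlgHom.mem_equalizer]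

/-- The algebra map `u ↦ u ⊗ 1` from `U(𝔤)^K` to `(U(𝔤) ⊗ C(𝔭))^K`. -/
noncomputable def inclUK : UK →ₐ[ℂ] UCK :=
  ((Algebra.TensorProduct.includeLeft : U →ₐ[ℂ] U ⊗[ℂ] C).comp UK.val).codRestrict UCK (by
    intro u
    rw [mem_UCK]
    intro k
    have hu := (mem_UK _).1 u.2 k
    simp [actUC, hu])

/-- `(U(𝔤) ⊗ C(𝔭))^K` as a module over `U(𝔤)^K`: `u` acts by left multiplication by `u ⊗ 1`. -/
noncomputable instance : Module UK UCK := Module.compHom UCK inclUK.toRingHom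

theorem coe_smul (u : UK) (z : UCK) :
    ((u • z : UCK) : U ⊗[ℂ] C) = ((u : U) ⊗ₜ[ℂ] (1 : C)) * (z : U ⊗[ℂ] C) := rfl

end SO41

/-! Filter `U(𝔤)` by the number of factors. By PBW, the top symbol of an element of `U(𝔤) ⊗ C(𝔭)` is
a homogeneous polynomial map from the dual of `𝔤` to `C(𝔭)`, and the symbol of a `K`-invariant is a
covariant, that is, a `K`-equivariant map. The problem is to describe the covariants; induction on
the filtration then transfers the result to the filtered algebra.

A linear form is a pair `(A, v)` of a skew `4 × 4` matrix and a vector. Four invariants are used: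
`y₀`, the sum of the `A i j ^ 2` over `i < j`, `y₁ = Pf A`, `y₂ = v · v` and `y₃ = Av · Av`. All are
symbols of elements of `U(𝔤)^K`. The covariants are built from the volume element `ω`, the Clifford
vector `b` of `v` (the symbol of the Dirac operator) and the Clifford bivector `a` of `A` (the
symbol of the spin element). The relations in `Rel` reduce words in `a`, `b`, `ω` to `ω ^ δ` times
one of `1, a, b, ab, ba, aba, bab, abab`, which makes 16 candidates.

Independence holds pointwise: `Rel.linearIndependent` shows that the 16 values at `l` are
independent in `C(𝔭)` whenever `disc (inv l) ≠ 0`. The reason is that on each eigenspace `ω = ±4`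
the elements `a` and `bab` generate a quaternion algebra, whose discriminant is a factor of `disc`.

Generation is shown on a slice. Gram-Schmidt applied to `v, Av, A²v` moves a real form with `y₂ y₃ ≠
0` to one with `v` along the first axis and `A` tridiagonal (`exists_coad_eq_slice`). A covariant
restricted to the slice commutes with the diagonal sign matrices in `K`; this parity condition
leaves only combinations of the 16 candidates with coefficients in `ℂ[y₀, y₁, y₂, y₃]` localized at
`y₂ y₃` (`IsCov.inM`). Zariski density of the real forms extends this to all forms.

To remove the denominators `y₂` and `y₃` (`exists_of_inv_smul`), suppose `y_t F` is a combination
with coefficients `P_s`. Every point with `y_t = 0` is a value of `inv`, and where `disc ≠ 0`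
independence forces `P_s` to vanish there. Since `X_t` is prime and does not divide `disc`, it
divides `P_s`.

Since independence is pointwise, it tests coefficients in `U(𝔤)^K` through their symbols alone, and
the structure of `U(𝔤)^K` itself is never needed. -/

namespace PBW

-- Symbols and PBW for a Lie algebra of matrices, by differential operators.

attribute [local instance 100] LieRing.ofAssociativeRing

set_option linter.unusedSectionVars false

variable {k : Type*} [Field k] {n : Type*} [Fintype n] [DecidableEq n]

/-- The derivation `f ↦ d/dt f(A exp(tX))` of the algebra of polynomial functions of a matrix `A`.
-/
noncomputable def fieldD (X : Matrix n n k) :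
    Derivation k (MvPolynomial (n × n) k) (MvPolynomial (n × n) k) :=
  MvPolynomial.mkDerivation k fun ij =>
    ∑ m, MvPolynomial.X (ij.1, m) * MvPolynomial.C (X m ij.2)

theorem fieldD_X (X : Matrix n n k) (i j : n) :
    fieldD X (MvPolynomial.X (i, j)) =
      ∑ m, MvPolynomial.X (i, m) * MvPolynomial.C (X m j) := by
  simp [fieldD, MvPolynomial.mkDerivation_X]

/-- The polynomial function `A ↦ l(AX)`. -/
noncomputable def linF (l : Matrix n n k →ₗ[k] k) (X : Matrix n n k) : MvPolynomial (n × n) k :=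
  ∑ ij : n × n, MvPolynomial.C (l (Matrix.single ij.1 ij.2 1 * X)) * MvPolynomial.X ij

theorem single_mul_eq_sum (i m : n) (Y : Matrix n n k) :
    Matrix.single i m (1 : k) * Y = ∑ j, Y m j • Matrix.single i j (1 : k) := by
  ext a b
  simp [Matrix.sum_apply, Matrix.single_apply, Matrix.mul_apply, ite_and]

/-- `linF l X` is the derivative of `A ↦ l A` along `X`, so this is a second derivative.
Antisymmetrized in `X` and `Y`, it is the flatness that makes `nabla` respect brackets. -/
theorem fieldD_linF (l : Matrix n n k →ₗ[k] k) (X Y : Matrix n n k) :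
    fieldD Y (linF l X) = linF l (Y * X) := by
  unfold linF
  rw [map_sum, Fintype.sum_prod_type, Fintype.sum_prod_type]
  refine Finset.sum_congr rfl fun i _ => ?_
  simp only [Derivation.leibniz, fieldD_X, smul_eq_mul, MvPolynomial.derivation_C, mul_zero,
    add_zero, Finset.mul_sum]
  rw [Finset.sum_comm]
  refine Finset.sum_congr rfl fun m _ => ?_
  rw [← Matrix.mul_assoc, single_mul_eq_sum, Finset.sum_mul, map_sum, map_sum, Finset.sum_mul]
  refine Finset.sum_congr rfl fun j _ => ?_
  rw [Matrix.smul_mul, map_smul, smul_eq_mul, MvPolynomial.C_mul]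
  ring

theorem linF_add (l : Matrix n n k →ₗ[k] k) (X Y : Matrix n n k) :
    linF l (X + Y) = linF l X + linF l Y := by
  simp [linF, Matrix.mul_add, add_mul, Finset.sum_add_distrib]

theorem linF_smul (l : Matrix n n k →ₗ[k] k) (c : k) (X : Matrix n n k) :
    linF l (c • X) = c • linF l X := by
  simp [linF, Finset.smul_sum, MvPolynomial.smul_eq_C_mul, mul_assoc]

theorem fieldD_add (X Y : Matrix n n k) : fieldD (X + Y) = fieldD X + fieldD Y := by
  apply MvPolynomial.derivation_ext
  rintro ⟨i, j⟩
  simp [fieldD_X, mul_add, Finset.sum_add_distrib]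

theorem fieldD_smul (c : k) (X : Matrix n n k) : fieldD (c • X) = c • fieldD X := by
  apply MvPolynomial.derivation_ext
  rintro ⟨i, j⟩
  simp only [fieldD_X, Derivation.smul_apply, Finset.smul_sum, MvPolynomial.smul_eq_C_mul,
    Matrix.smul_apply, smul_eq_mul, map_mul]
  exact Finset.sum_congr rfl fun m _ => by ring

theorem fieldD_lie (X Y : Matrix n n k) : fieldD (X * Y - Y * X) = ⁅fieldD X, fieldD Y⁆ := by
  apply MvPolynomial.derivation_ext
  rintro ⟨i, j⟩
  -- The fields are invariant under left translation, and on the coordinates, which are linear,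
  -- their composition is the matrix product in the same order.
  have key : ∀ X Y : Matrix n n k, fieldD X (fieldD Y (MvPolynomial.X (i, j))) =
      fieldD (X * Y) (MvPolynomial.X (i, j)) := by
    intro X Y
    rw [fieldD_X, fieldD_X, map_sum]
    simp only [Derivation.leibniz, fieldD_X, smul_eq_mul, MvPolynomial.derivation_C, mul_zero,
      zero_add, Finset.mul_sum]
    rw [Finset.sum_comm]
    refine Finset.sum_congr rfl fun m _ => ?_
    rw [Matrix.mul_apply, map_sum, Finset.mul_sum]
    refine Finset.sum_congr rfl fun j _ => ?_
    rw [map_mul]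
    ring
  rw [Derivation.commutator_apply, key, key, sub_eq_add_neg, fieldD_add,
    ← neg_one_smul k (Y * X), fieldD_smul]
  simp [sub_eq_add_neg]

/-- The predecessor in a sequence, `0` at the start. -/
def shift {R : Type*} [Zero R] (f : ℕ → R) : ℕ → R
  | 0 => 0
  | m + 1 => f m

/-- The action of a matrix on sequences of polynomial functions: the coefficient sequences with
respect to `t` of the functions `f exp(t l)`, differentiated along `X`. -/
noncomputable def nabla (l : Matrix n n k →ₗ[k] k) (X : Matrix n n k) :
    Module.End k (ℕ → MvPolynomial (n × n) k) where
  toFun f m := fieldD X (f m) + linF l X * shift f m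
  map_add' f g := by
    funext m
    cases m <;> (simp [shift]; try ring)
  map_smul' c f := by
    funext m
    cases m <;> simp [shift]

theorem nabla_apply (l : Matrix n n k →ₗ[k] k) (X : Matrix n n k)
    (f : ℕ → MvPolynomial (n × n) k) (m : ℕ) :
    nabla l X f m = fieldD X (f m) + linF l X * shift f m := rfl

/-- The action `nabla` as a map of Lie algebras. -/
noncomputable def nablaLie (l : Matrix n n k →ₗ[k] k) :
    Matrix n n k →ₗ⁅k⁆ Module.End k (ℕ → MvPolynomial (n × n) k) where
  toFun X := nabla l X
  map_add' X Y := by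
    ext1 f; funext m
    simp only [nabla_apply, LinearMap.add_apply, Pi.add_apply, fieldD_add, linF_add,
      Derivation.add_apply]
    ring
  map_smul' c X := by
    ext1 f; funext m
    simp only [nabla_apply, LinearMap.smul_apply, Pi.smul_apply, fieldD_smul, linF_smul,
      Derivation.smul_apply, RingHom.id_apply, smul_add, smul_mul_assoc]
  map_lie' {X Y} := by
    have h1 : linF l (X * Y - Y * X) = fieldD X (linF l Y) - fieldD Y (linF l X) := by
      rw [fieldD_linF, fieldD_linF, sub_eq_add_neg, linF_add, ← neg_one_smul k (Y * X), linF_smul]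
      simp [sub_eq_add_neg]
    ext1 f; funext m
    rw [Ring.lie_def, Ring.lie_def, LinearMap.sub_apply, Pi.sub_apply, Module.End.mul_apply,
      Module.End.mul_apply]
    cases m with
    | zero =>
      simp only [nabla_apply, shift, fieldD_lie, Derivation.commutator_apply, mul_zero, add_zero]
    | succ m =>
      simp only [nabla_apply, shift, fieldD_lie, Derivation.commutator_apply, h1, map_add,
        Derivation.leibniz, smul_eq_mul]
      ring

variable {L : Type*} [LieRing L] [LieAlgebra k L]

/-- The filtration of the enveloping algebra by the number of factors. -/
noncomputable def filt (k L : Type*) [Field k] [LieRing L] [LieAlgebra k L] (m : ℕ) :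
    Submodule k (UniversalEnvelopingAlgebra k L) :=
  (1 ⊔ LinearMap.range (UniversalEnvelopingAlgebra.ι k : L →ₗ⁅k⁆ _).toLinearMap) ^ m

/-- The preceding step of the filtration. -/
noncomputable def filtLT (k L : Type*) [Field k] [LieRing L] [LieAlgebra k L] :
    ℕ → Submodule k (UniversalEnvelopingAlgebra k L)
  | 0 => ⊥
  | m + 1 => filt k L m

theorem mul_mem_filt {a b : ℕ} {u v : UniversalEnvelopingAlgebra k L} (hu : u ∈ filt k L a)
    (hv : v ∈ filt k L b) : u * v ∈ filt k L (a + b) := by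
  rw [filt, pow_add]
  exact Submodule.mul_mem_mul hu hv

theorem one_mem_filt (a : ℕ) : (1 : UniversalEnvelopingAlgebra k L) ∈ filt k L a := by
  have h : (1 : Submodule k (UniversalEnvelopingAlgebra k L)) ≤
      1 ⊔ LinearMap.range (UniversalEnvelopingAlgebra.ι k : L →ₗ⁅k⁆ _).toLinearMap := le_sup_left
  have := pow_le_pow_left' h a
  rw [one_pow] at this
  exact this (Submodule.one_le.1 le_rfl)

theorem filt_mono {a b : ℕ} (h : a ≤ b) : filt k L a ≤ filt k L b := by
  obtain ⟨c, rfl⟩ := Nat.exists_eq_add_of_le h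
  intro u hu
  simpa using mul_mem_filt hu (one_mem_filt c)

theorem ι_mem_filt (X : L) : UniversalEnvelopingAlgebra.ι k X ∈ filt k L 1 := by
  rw [filt, pow_one]
  exact Submodule.mem_sup_right ⟨X, rfl⟩

theorem mul_mem_filtLT {a b : ℕ} {u v : UniversalEnvelopingAlgebra k L} (hu : u ∈ filt k L a)
    (hv : v ∈ filtLT k L b) : u * v ∈ filtLT k L (a + b) := by
  cases b with
  | zero => rw [(Submodule.mem_bot k).1 hv, mul_zero]; exact zero_mem _
  | succ b => exact mul_mem_filt hu hv

theorem mem_filt_one {u : UniversalEnvelopingAlgebra k L} (hu : u ∈ filt k L 1) :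
    ∃ (c : k) (X : L), u = algebraMap k _ c + UniversalEnvelopingAlgebra.ι k X := by
  rw [filt, pow_one] at hu
  obtain ⟨y, hy, z, ⟨X, rfl⟩, rfl⟩ := Submodule.mem_sup.1 hu
  obtain ⟨c, rfl⟩ := Submodule.mem_one.1 hy
  exact ⟨c, X, rfl⟩

/-- Induction on the filtration: constants, sums, and left multiplication by an element of `L`. -/
theorem filt_induction {P : ℕ → UniversalEnvelopingAlgebra k L → Prop}
    (h0 : ∀ c : k, P 0 (algebraMap k _ c))
    (hadd : ∀ m u v, P m u → P m v → P m (u + v))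
    (hc : ∀ m u (c : k), u ∈ filt k L m → P m u → P (m + 1) (algebraMap k _ c * u))
    (hι : ∀ m u (X : L), u ∈ filt k L m → P m u → P (m + 1) (UniversalEnvelopingAlgebra.ι k X * u))
    {m : ℕ} {u : UniversalEnvelopingAlgebra k L} (hu : u ∈ filt k L m) : P m u := by
  refine Submodule.pow_induction_on_left' _ (C := fun m u _ => P m u) h0
    (fun u v i _ _ hu hv => hadd i u v hu hv) (fun v hv i u hu ih => ?_) hu
  obtain ⟨c, X, rfl⟩ := mem_filt_one (u := v) (by rw [filt, pow_one]; exact hv)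
  rw [add_mul]
  exact hadd _ _ _ (hc i u c hu ih) (hι i u X hu ih)

theorem exists_mem_filt (u : UniversalEnvelopingAlgebra k L) : ∃ m, u ∈ filt k L m := by
  have h : ∀ z : TensorAlgebra k L, ∃ m, UniversalEnvelopingAlgebra.mkAlgHom k L z ∈ filt k L m :=
      by
    intro z
    induction z using TensorAlgebra.induction with
    | algebraMap r =>
      exact ⟨0, by
        rw [AlgHom.commutes, Algebra.algebraMap_eq_smul_one]
        exact Submodule.smul_mem _ _ (one_mem_filt 0)⟩
    | ι x => exact ⟨1, ι_mem_filt x⟩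
    | mul a b ha hb =>
      obtain ⟨i, hi⟩ := ha
      obtain ⟨j, hj⟩ := hb
      exact ⟨i + j, by rw [map_mul]; exact mul_mem_filt hi hj⟩
    | add a b ha hb =>
      obtain ⟨i, hi⟩ := ha
      obtain ⟨j, hj⟩ := hb
      exact ⟨max i j, by
        rw [map_add]
        exact add_mem (filt_mono (le_max_left i j) hi) (filt_mono (le_max_right i j) hj)⟩
  obtain ⟨z, rfl⟩ := RingCon.mk'_surjective (c := UniversalEnvelopingAlgebra.ringCon k L) u
  exact h z

variable (ρ : L →ₗ⁅k⁆ Matrix n n k) (l : Matrix n n k →ₗ[k] k)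

/-- The action of the enveloping algebra by differential operators that extends `nabla`. -/
noncomputable def act : UniversalEnvelopingAlgebra k L →ₐ[k]
    Module.End k (ℕ → MvPolynomial (n × n) k) :=
  UniversalEnvelopingAlgebra.lift k ((nablaLie l).comp ρ)

theorem act_ι (X : L) : act ρ l (UniversalEnvelopingAlgebra.ι k X) = nabla l (ρ X) := by
  simp [act, nablaLie]

/-- In `nabla` the derivation keeps the index and the multiplication by `linF` raises it by one.
With `m` factors, the index can rise by `m` only if every factor multiplies, so the top coefficient
is multiplied by a fixed polynomial. -/
theorem act_top {m : ℕ} {u : UniversalEnvelopingAlgebra k L} (hu : u ∈ filt k L m) :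
    ∃ s : MvPolynomial (n × n) k, ∀ (j : ℕ) (f : ℕ → MvPolynomial (n × n) k), (∀ i > j, f i = 0) →
      (∀ i > m + j, act ρ l u f i = 0) ∧ act ρ l u f (m + j) = s * f j := by
  refine filt_induction (P := fun m u => ∃ s : MvPolynomial (n × n) k,
    ∀ (j : ℕ) (f : ℕ → MvPolynomial (n × n) k), (∀ i > j, f i = 0) →
      (∀ i > m + j, act ρ l u f i = 0) ∧ act ρ l u f (m + j) = s * f j) ?_ ?_ ?_ ?_ hu
  · intro c
    refine ⟨MvPolynomial.C c, fun j f hf => ⟨fun i hi => ?_, ?_⟩⟩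
    · have := hf i (by omega)
      simp [Module.algebraMap_end_apply, this]
    · simp [Module.algebraMap_end_apply, MvPolynomial.smul_eq_C_mul]
  · rintro m u v ⟨s, hs⟩ ⟨t, ht⟩
    refine ⟨s + t, fun j f hf => ⟨fun i hi => ?_, ?_⟩⟩
    · simp [(hs j f hf).1 i hi, (ht j f hf).1 i hi]
    · simp [(hs j f hf).2, (ht j f hf).2, add_mul]
  · rintro m u c - ⟨s, hs⟩
    -- A scalar factor does not use the additional degree, so nothing reaches the index `m + 1 + j`.
    refine ⟨0, fun j f hf => ⟨fun i hi => ?_, ?_⟩⟩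
    · have := (hs j f hf).1 i (by omega)
      simp [Module.algebraMap_end_apply, this]
    · have := (hs j f hf).1 (m + 1 + j) (by omega)
      simp [Module.algebraMap_end_apply, this]
  · rintro m u X - ⟨s, hs⟩
    refine ⟨linF l (ρ X) * s, fun j f hf => ?_⟩
    rw [map_mul, act_ι, Module.End.mul_apply]
    refine ⟨fun i hi => ?_, ?_⟩
    · obtain ⟨i, rfl⟩ : ∃ i', i = i' + 1 := ⟨i - 1, by omega⟩
      rw [nabla_apply, (hs j f hf).1 _ (by omega), shift, (hs j f hf).1 i (by omega)]
      simp
    · rw [show m + 1 + j = m + j + 1 by ring, nabla_apply, (hs j f hf).1 _ (by omega), shift,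
        (hs j f hf).2]
      simp [mul_assoc]

/-- The degree `m` part of the full symbol of an element of the enveloping algebra, evaluated at the
linear form `l`. -/
noncomputable def symb (m : ℕ) : UniversalEnvelopingAlgebra k L →ₗ[k] k where
  toFun u := MvPolynomial.eval (fun ij : n × n => (1 : Matrix n n k) ij.1 ij.2)
    (act ρ l u (Pi.single 0 1) m)
  map_add' u v := by simp
  map_smul' c u := by simp [MvPolynomial.smul_eval]

theorem single_zero_gt {R : Type*} [Zero R] [One R] :
    ∀ i > 0, (Pi.single 0 1 : ℕ → R) i = 0 := by
  intro i hi
  rw [Pi.single_eq_of_ne (by omega)]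

theorem symb_of_lt {m i : ℕ} {u : UniversalEnvelopingAlgebra k L} (hu : u ∈ filt k L m)
    (h : m < i) : symb ρ l i u = 0 := by
  obtain ⟨s, hs⟩ := act_top ρ l hu
  have := (hs 0 _ single_zero_gt).1 i (by omega)
  simp [symb, this]

/-- The top coefficient of the composite is the product of the two multipliers in `act_top`;
evaluation at the identity matrix comes only afterwards. -/
theorem symb_mul {a b : ℕ} {u v : UniversalEnvelopingAlgebra k L} (hu : u ∈ filt k L a)
    (hv : v ∈ filt k L b) : symb ρ l (a + b) (u * v) = symb ρ l a u * symb ρ l b v := by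
  obtain ⟨s, hs⟩ := act_top ρ l hu
  obtain ⟨t, ht⟩ := act_top ρ l hv
  have h1 := (hs 0 _ single_zero_gt).2
  have h2 := ht 0 _ single_zero_gt
  have h3 := hs b (act ρ l v (Pi.single 0 1)) (by simpa using h2.1)
  simp only [add_zero] at h1
  simp only [symb, LinearMap.coe_mk, AddHom.coe_mk, map_mul, Module.End.mul_apply, h3.2, h1]
  simp

theorem symb_algebraMap (c : k) : symb ρ l 0 (algebraMap k _ c) = c := by
  simp [symb, Module.algebraMap_end_apply, MvPolynomial.smul_eval]

theorem symb_one : symb ρ l 0 (1 : UniversalEnvelopingAlgebra k L) = 1 := by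
  simpa using symb_algebraMap ρ l (1 : k)

theorem symb_ι (X : L) : symb ρ l 1 (UniversalEnvelopingAlgebra.ι k X) = l (ρ X) := by
  have h : (1 : Matrix n n k) = ∑ i, ∑ j, (1 : Matrix n n k) i j • Matrix.single i j (1 : k) := by
    conv_lhs => rw [Matrix.matrix_eq_sum_single (1 : Matrix n n k)]
    simp [Matrix.smul_single]
  have h2 : l (ρ X) = l ((∑ i, ∑ j, (1 : Matrix n n k) i j • Matrix.single i j (1 : k)) * ρ X) := by
    rw [← h, one_mul]
  rw [h2]
  simp only [symb, LinearMap.coe_mk, AddHom.coe_mk, act_ι, nabla_apply, shift, linF, map_add,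
    map_mul, map_sum, MvPolynomial.eval_C, MvPolynomial.eval_X, Finset.sum_mul,
    Fintype.sum_prod_type, Matrix.smul_mul, map_smul, smul_eq_mul]
  rw [Pi.single_eq_of_ne (by omega)]
  simp [mul_comm]

theorem symb_list (X : List L) :
    symb ρ l X.length (X.map (UniversalEnvelopingAlgebra.ι k)).prod =
      (X.map fun x => l (ρ x)).prod ∧
    (X.map (UniversalEnvelopingAlgebra.ι k)).prod ∈ filt k L X.length := by
  induction X with
  | nil => exact ⟨by simpa using symb_one ρ l, one_mem_filt 0⟩
  | cons x X ih =>
    rw [List.map_cons, List.prod_cons, List.length_cons, add_comm X.length 1]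
    refine ⟨?_, mul_mem_filt (ι_mem_filt x) ih.2⟩
    rw [symb_mul ρ l (ι_mem_filt x) ih.2, ih.1, symb_ι]
    simp

/-- Exchanging two neighbours costs a bracket, which is a single factor. -/
theorem perm_sub_mem {X Y : List L} (h : X.Perm Y) :
    (X.map (UniversalEnvelopingAlgebra.ι k)).prod - (Y.map (UniversalEnvelopingAlgebra.ι k)).prod ∈
      filtLT k L X.length := by
  have hmem : ∀ X : List L, (X.map (UniversalEnvelopingAlgebra.ι k)).prod ∈ filt k L X.length := by
    intro X
    induction X with
    | nil => exact one_mem_filt 0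
    | cons x X ih =>
      rw [List.map_cons, List.prod_cons, List.length_cons, add_comm X.length 1]
      exact mul_mem_filt (ι_mem_filt x) ih
  induction h with
  | nil => simp
  | cons x h ih =>
    rw [List.map_cons, List.prod_cons, List.map_cons, List.prod_cons, ← mul_sub, List.length_cons,
      add_comm _ 1]
    exact mul_mem_filtLT (ι_mem_filt x) ih
  | swap x y X =>
    have : ∀ x y z : UniversalEnvelopingAlgebra k L, y * (x * z) - x * (y * z) = ⁅y, x⁆ * z := by
      intro x y z
      rw [Ring.lie_def, sub_mul, mul_assoc, mul_assoc]
    simp only [List.map_cons, List.prod_cons, List.length_cons, this]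
    rw [← LieHom.map_lie, add_comm X.length 1]
    exact mul_mem_filt (ι_mem_filt _) (hmem X)
  | trans h1 h2 ih1 ih2 =>
    rw [← h1.length_eq] at ih2
    simpa using add_mem ih1 ih2

variable {τ : Type*} (b : Module.Basis τ k L)

/-- The linear map from polynomials to the enveloping algebra that sends each monomial to a product
of its factors in some order. -/
noncomputable def ordered : MvPolynomial τ k →ₗ[k] UniversalEnvelopingAlgebra k L :=
  (MvPolynomial.basisMonomials τ k).constr k fun m =>
    ((Finsupp.toMultiset m).toList.map fun t => UniversalEnvelopingAlgebra.ι k (b t)).prod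

theorem ordered_monomial (m : τ →₀ ℕ) (c : k) : ordered b (MvPolynomial.monomial m c) =
    c • ((Finsupp.toMultiset m).toList.map fun t => UniversalEnvelopingAlgebra.ι k (b t)).prod := by
  have := (MvPolynomial.basisMonomials τ k).constr_basis k (fun m =>
    ((Finsupp.toMultiset m).toList.map fun t => UniversalEnvelopingAlgebra.ι k (b t)).prod) m
  rw [MvPolynomial.coe_basisMonomials] at this
  rw [← mul_one c, ← smul_eq_mul, ← MvPolynomial.smul_monomial, map_smul, ordered, this,
      smul_eq_mul,
    mul_one]

theorem length_toList_toMultiset (m : τ →₀ ℕ) :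
    (Finsupp.toMultiset m).toList.length = m.degree := by
  rw [Multiset.length_toList, Finsupp.card_toMultiset]
  rfl

theorem degree_of_mem_support {m : ℕ} {q : MvPolynomial τ k} (hq : q.IsHomogeneous m) {s : τ →₀ ℕ}
    (hs : s ∈ q.support) : s.degree = m := by
  rw [Finsupp.degree_eq_weight_one]
  exact hq (MvPolynomial.mem_support_iff.1 hs)

theorem X_mul_ordered_sub_mem (t : τ) (m : τ →₀ ℕ) (c : k) :
    UniversalEnvelopingAlgebra.ι k (b t) * ordered b (MvPolynomial.monomial m c) -
      ordered b (MvPolynomial.X t * MvPolynomial.monomial m c) ∈ filtLT k L (m.degree + 1) := by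
  have h : (t :: (Finsupp.toMultiset m).toList).Perm
      (Finsupp.toMultiset (Finsupp.single t 1 + m)).toList := by
    rw [← Multiset.coe_eq_coe, Multiset.coe_toList, ← Multiset.cons_coe, Multiset.coe_toList,
      map_add, Finsupp.toMultiset_single]
    simp
  have h2 := perm_sub_mem (k := k) (h.map b)
  rw [List.length_map, List.length_cons, length_toList_toMultiset] at h2
  rw [MvPolynomial.X, MvPolynomial.monomial_mul, one_mul, ordered_monomial, ordered_monomial,
    mul_smul_comm, ← smul_sub]
  refine Submodule.smul_mem _ c ?_
  simpa [Function.comp_def] using h2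

/-- The injectivity half of PBW: the polynomial can be read off from the symbols of its ordered
product, as far as the forms `l` separate polynomials on `L`. -/
theorem symb_ordered {m : ℕ} {q : MvPolynomial τ k} (hq : q.IsHomogeneous m) :
    symb ρ l m (ordered b q) = MvPolynomial.eval (fun t => l (ρ (b t))) q := by
  conv_lhs => rw [q.as_sum]
  rw [map_sum, map_sum, MvPolynomial.eval_eq]
  refine Finset.sum_congr rfl fun s hs => ?_
  have hd : s.degree = m := degree_of_mem_support hq hs
  have := (symb_list ρ l ((Finsupp.toMultiset s).toList.map b)).1
  rw [List.length_map, length_toList_toMultiset, hd, List.map_map, List.map_map] at this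
  rw [ordered_monomial, map_smul, smul_eq_mul]
  congr 1
  refine this.trans ?_
  rw [← Multiset.prod_coe, ← Multiset.map_coe, Multiset.coe_toList, Finsupp.toMultiset_map,
    Finsupp.prod_toMultiset, Finsupp.prod_mapDomain_index (by simp) (by simp [pow_add])]
  rfl

/-- The spanning half of PBW: left multiplication by a basis vector is multiplication by a variable,
up to lower filtration. -/
theorem exists_ordered {m : ℕ} {u : UniversalEnvelopingAlgebra k L} (hu : u ∈ filt k L m) :
    ∃ q : MvPolynomial τ k, q.IsHomogeneous m ∧ u - ordered b q ∈ filtLT k L m := by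
  refine filt_induction (P := fun m u => ∃ q : MvPolynomial τ k, q.IsHomogeneous m ∧
    u - ordered b q ∈ filtLT k L m) ?_ ?_ ?_ ?_ hu
  · intro c
    refine ⟨MvPolynomial.C c, MvPolynomial.isHomogeneous_C _ c, ?_⟩
    rw [← MvPolynomial.monomial_zero', ordered_monomial]
    simp [Algebra.algebraMap_eq_smul_one]
  · rintro m u v ⟨q, hq, hq'⟩ ⟨r, hr, hr'⟩
    refine ⟨q + r, hq.add hr, ?_⟩
    rw [map_add, add_sub_add_comm]
    exact add_mem hq' hr'
  · rintro m u c hu -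
    refine ⟨0, MvPolynomial.isHomogeneous_zero _ _ _, ?_⟩
    rw [map_zero, sub_zero, Algebra.algebraMap_eq_smul_one, smul_one_mul]
    exact Submodule.smul_mem _ _ hu
  · rintro m u X hu ⟨q, hq, hq'⟩
    have hX : ∀ t, ∃ r : MvPolynomial τ k, r.IsHomogeneous (m + 1) ∧
        UniversalEnvelopingAlgebra.ι k (b t) * u - ordered b r ∈ filtLT k L (m + 1) := by
      intro t
      refine ⟨MvPolynomial.X t * q, by
        rw [add_comm m 1]; exact (MvPolynomial.isHomogeneous_X k t).mul hq, ?_⟩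
      have h1 : UniversalEnvelopingAlgebra.ι k (b t) * (u - ordered b q) ∈ filtLT k L (m + 1) := by
        rw [add_comm m 1]
        exact mul_mem_filtLT (ι_mem_filt _) hq'
      have h2 : UniversalEnvelopingAlgebra.ι k (b t) * ordered b q -
          ordered b (MvPolynomial.X t * q) ∈ filtLT k L (m + 1) := by
        have : UniversalEnvelopingAlgebra.ι k (b t) * ordered b q -
          ordered b (MvPolynomial.X t * q) = ∑ s ∈ q.support,
            (UniversalEnvelopingAlgebra.ι k (b t) * ordered b (MvPolynomial.monomial s (q.coeff s))
                -
            ordered b (MvPolynomial.X t * MvPolynomial.monomial s (q.coeff s))) := by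
          rw [Finset.sum_sub_distrib, ← Finset.mul_sum, ← map_sum, ← map_sum, ← Finset.mul_sum,
            ← q.as_sum]
        rw [this]
        refine Submodule.sum_mem _ fun s hs => ?_
        have hd : s.degree = m := degree_of_mem_support hq hs
        rw [← hd]
        exact X_mul_ordered_sub_mem b t s _
      have := add_mem h1 h2
      rwa [mul_sub, sub_add_sub_cancel] at this
    choose r hr hr' using hX
    refine ⟨∑ t ∈ (b.repr X).support, b.repr X t • r t, ?_, ?_⟩
    · exact MvPolynomial.IsHomogeneous.sum _ _ _ fun t _ => by
        rw [MvPolynomial.smul_eq_C_mul]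
        simpa using (MvPolynomial.isHomogeneous_C τ (b.repr X t)).mul (hr t)
    · have h3 : UniversalEnvelopingAlgebra.ι k X * u =
          ∑ t ∈ (b.repr X).support, b.repr X t • (UniversalEnvelopingAlgebra.ι k (b t) * u) := by
        conv_lhs => rw [← b.linearCombination_repr X, Finsupp.linearCombination_apply, Finsupp.sum]
        rw [← LieHom.coe_toLinearMap, map_sum, Finset.sum_mul]
        simp
      rw [h3, map_sum, ← Finset.sum_sub_distrib]
      refine Submodule.sum_mem _ fun t _ => ?_
      rw [map_smul, ← smul_sub]
      exact Submodule.smul_mem _ _ (hr' t)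

end PBW

/-! ### Coordinates on `𝔤` and the action of `K` in them. -/

namespace SO41

open scoped Matrix

attribute [local instance 100] LieRing.ofAssociativeRing

theorem mem_g_iff_apply (X : Matrix (Fin 4 ⊕ Fin 1) (Fin 4 ⊕ Fin 1) ℂ) :
    X ∈ g ↔ (∀ i j, X (.inl j) (.inl i) = -X (.inl i) (.inl j)) ∧
      (∀ i, X (.inr 0) (.inl i) = X (.inl i) (.inr 0)) ∧ X (.inr 0) (.inr 0) = 0 := by
  rw [mem_g_iff, LieAlgebra.Orthogonal.indefiniteDiagonal, ← Matrix.ext_iff]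
  simp only [Matrix.mul_diagonal, Matrix.diagonal_mul, Matrix.transpose_apply, Sum.forall,
    Sum.elim_inl, Sum.elim_inr, Matrix.neg_apply, Fin.forall_fin_one]
  constructor
  · rintro ⟨h1, h2⟩
    refine ⟨fun i j => by simpa using (h1 i).1 j, fun i => by simpa using (h1 i).2, ?_⟩
    have := h2.2
    linear_combination (-1 / 2 : ℂ) * this
  · rintro ⟨h1, h2, h3⟩
    refine ⟨fun i => ⟨fun j => by simpa using h1 i j, by simpa using h2 i⟩, fun i => ?_, ?_⟩
    · simpa using (h2 i).symm
    · simp [h3]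

/-- The identification of `ℂ⁴` with `𝔭`. -/
noncomputable def pvec : (Fin 4 → ℂ) →ₗ[ℂ] p where
  toFun w := ⟨⟨Matrix.fromBlocks 0 (Matrix.of fun i _ => w i) (Matrix.of fun _ i => w i) 0, by
    rw [mem_g_iff_apply]; simp⟩, by
      rw [mem_p_iff]; ext (i | i) (j | j) <;> simp⟩
  map_add' w w' := by
    apply Subtype.ext; apply Subtype.ext
    ext (i | i) (j | j) <;> simp
  map_smul' c w := by
    apply Subtype.ext; apply Subtype.ext
    ext (i | i) (j | j) <;> simp

theorem coe_pvec (w : Fin 4 → ℂ) : ((pvec w : g) : Matrix (Fin 4 ⊕ Fin 1) (Fin 4 ⊕ Fin 1) ℂ) =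
    Matrix.fromBlocks 0 (Matrix.of fun i _ => w i) (Matrix.of fun _ i => w i) 0 := rfl

theorem pvec_surjective : Function.Surjective pvec := by
  intro X
  have h1 := (mem_g_iff_apply _).1 X.1.2
  have h2 := (mem_p_iff X.1).1 X.2
  refine ⟨fun i => X.1.1 (.inl i) (.inr 0), ?_⟩
  apply Subtype.ext; apply Subtype.ext
  rw [coe_pvec]
  ext (i | i) (j | j)
  · have h3 := congrFun (congrFun h2 (.inl i)) (.inl j)
    rw [Matrix.transpose_apply, h1.1 i j] at h3
    simp only [Matrix.fromBlocks_apply₁₁, Matrix.zero_apply]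
    linear_combination (1 / 2 : ℂ) * h3
  · simp [Subsingleton.elim j 0]
  · simp [Subsingleton.elim i 0, h1.2.1 j]
  · simp [Subsingleton.elim i 0, Subsingleton.elim j 0, h1.2.2]

theorem Q_pvec (w : Fin 4 → ℂ) : Q (pvec w) = 2 * ∑ i, w i * w i := by
  rw [Q_apply, coe_pvec, Matrix.fromBlocks_multiply]
  simp [Matrix.trace, Matrix.mul_apply, Fintype.sum_sum_type]
  ring

/-- The complex matrix of an element of `K`. -/
noncomputable def kmat (k : K) : Matrix (Fin 4) (Fin 4) ℂ :=
  (k : Matrix (Fin 4) (Fin 4) ℝ).map Complex.ofReal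

theorem kmat_mul_transpose (k : K) : kmat k * (kmat k).transpose = 1 := by
  have h : (k : Matrix (Fin 4) (Fin 4) ℝ) * (k : Matrix (Fin 4) (Fin 4) ℝ).transpose = 1 :=
    (Matrix.mem_orthogonalGroup_iff (Fin 4) ℝ).1 k.2.1
  have h2 := congrArg (fun M : Matrix (Fin 4) (Fin 4) ℝ => M.map Complex.ofRealHom) h
  simpa [Matrix.map_mul, Matrix.transpose_map] using! h2

theorem kmat_det (k : K) : (kmat k).det = 1 := by
  have h : (k : Matrix (Fin 4) (Fin 4) ℝ).det = 1 := (Matrix.mem_specialOrthogonalGroup_iff.1 k.2).2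
  have h2 := Complex.ofRealHom.map_det (k : Matrix (Fin 4) (Fin 4) ℝ)
  rw [h] at h2
  simpa using! h2.symm

theorem toMat_eq (k : K) : toMat k = Matrix.fromBlocks (kmat k) 0 0 1 := rfl

theorem toMat_inv (k : K) : toMat k⁻¹ = Matrix.fromBlocks (kmat k).transpose 0 0 1 := by
  rw [← toMat_transpose, toMat_eq, Matrix.fromBlocks_transpose]
  simp

theorem Ad_pvec (k : K) (w : Fin 4 → ℂ) : Ad k (pvec w : g) = pvec (kmat k *ᵥ w) := by
  apply Subtype.ext
  rw [coe_Ad, coe_pvec, coe_pvec, toMat_eq, toMat_inv, Matrix.fromBlocks_multiply,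
    Matrix.fromBlocks_multiply]
  simp only [Matrix.mul_zero, Matrix.zero_mul, Matrix.one_mul, Matrix.mul_one, add_zero, zero_add]
  congr 1
  ext i j
  simp [Matrix.mul_apply, Matrix.mulVec, dotProduct, mul_comm]

theorem AdP_pvec (k : K) (w : Fin 4 → ℂ) : AdP k (pvec w) = pvec (kmat k *ᵥ w) :=
  Subtype.ext (Ad_pvec k w)

/-- The standard basis vectors of `𝔭`. -/
noncomputable def e (i : Fin 4) : p := pvec (Pi.single i 1)

theorem pvec_eq_sum (w : Fin 4 → ℂ) : pvec w = ∑ i, w i • e i := by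
  conv_lhs => rw [pi_eq_sum_univ' w]
  simp [e]

theorem Ad_e (k : K) (i : Fin 4) : Ad k (e i : g) = ∑ a, kmat k a i • (e a : g) := by
  rw [e, Ad_pvec, pvec_eq_sum]
  simp

theorem AdP_e (k : K) (i : Fin 4) : AdP k (e i) = ∑ a, kmat k a i • e a := by
  rw [e, AdP_pvec, pvec_eq_sum]
  simp

theorem coe_lie_e (i j : Fin 4) : ((⁅(e i : g), (e j : g)⁆ : g) :
    Matrix (Fin 4 ⊕ Fin 1) (Fin 4 ⊕ Fin 1) ℂ) =
    Matrix.fromBlocks (Matrix.single i j 1 - Matrix.single j i 1) 0 0 0 := by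
  rw [LieSubalgebra.coe_bracket, Ring.lie_def, e, e, coe_pvec, coe_pvec]
  simp only [Matrix.fromBlocks_multiply]
  ext (a | a) (b | b)
  · simp only [Matrix.mul_apply, Matrix.single_apply, Pi.single_apply, Matrix.sub_apply,
      Matrix.add_apply, Matrix.fromBlocks_apply₁₁, Matrix.of_apply, Fin.sum_univ_one]
    simp [eq_comm, ite_and]
    split_ifs <;> rfl
  · simp
  · simp
  · simp [Matrix.mul_apply, Pi.single_apply, eq_comm]

/-- The coordinates of an element of `𝔤`. -/
noncomputable def coords : g →ₗ[ℂ] (Fin 10 → ℂ) where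
  toFun X := ![X.1 (.inl 0) (.inr 0), X.1 (.inl 1) (.inr 0), X.1 (.inl 2) (.inr 0),
    X.1 (.inl 3) (.inr 0), X.1 (.inl 0) (.inl 1), X.1 (.inl 0) (.inl 2), X.1 (.inl 0) (.inl 3),
    X.1 (.inl 1) (.inl 2), X.1 (.inl 1) (.inl 3), X.1 (.inl 2) (.inl 3)]
  map_add' X Y := by simp
  map_smul' c X := by simp

theorem coords_apply (X : g) : coords X = ![X.1 (.inl 0) (.inr 0), X.1 (.inl 1) (.inr 0),
    X.1 (.inl 2) (.inr 0), X.1 (.inl 3) (.inr 0), X.1 (.inl 0) (.inl 1), X.1 (.inl 0) (.inl 2),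
    X.1 (.inl 0) (.inl 3), X.1 (.inl 1) (.inl 2), X.1 (.inl 1) (.inl 3), X.1 (.inl 2) (.inl 3)] :=
  rfl

/-- The basis vectors of `𝔤`. -/
noncomputable def gvec : Fin 10 → g :=
  ![e 0, e 1, e 2, e 3, ⁅(e 0 : g), (e 1 : g)⁆, ⁅(e 0 : g), (e 2 : g)⁆, ⁅(e 0 : g), (e 3 : g)⁆,
    ⁅(e 1 : g), (e 2 : g)⁆, ⁅(e 1 : g), (e 3 : g)⁆, ⁅(e 2 : g), (e 3 : g)⁆]

theorem coords_injective : Function.Injective coords := by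
  rw [← LinearMap.ker_eq_bot, LinearMap.ker_eq_bot']
  intro X hX
  have h1 := (mem_g_iff_apply _).1 X.2
  have hX' : ∀ t, coords X t = 0 := fun t => by rw [hX]; rfl
  simp only [coords_apply] at hX'
  have hd : ∀ i, X.1 (.inl i) (.inl i) = 0 := fun i => by
    have := h1.1 i i
    linear_combination (1 / 2 : ℂ) * this
  have a0 := hX' 0
  have a1 := hX' 1
  have a2 := hX' 2
  have a3 := hX' 3
  have b01 := hX' 4
  have b02 := hX' 5
  have b03 := hX' 6
  have b12 := hX' 7
  have b13 := hX' 8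
  have b23 := hX' 9
  simp only [Matrix.cons_val] at a0 a1 a2 a3 b01 b02 b03 b12 b13 b23
  have hu : ∀ i, X.1 (.inl i) (.inr 0) = 0 := by
    simp [Fin.forall_fin_succ, a0, a1, a2, a3]
  have hk : ∀ i j, X.1 (.inl i) (.inl j) = 0 := by
    have h10 := h1.1 0 1
    have h20 := h1.1 0 2
    have h30 := h1.1 0 3
    have h21 := h1.1 1 2
    have h31 := h1.1 1 3
    have h32 := h1.1 2 3
    rw [b01, neg_zero] at h10
    rw [b02, neg_zero] at h20
    rw [b03, neg_zero] at h30
    rw [b12, neg_zero] at h21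
    rw [b13, neg_zero] at h31
    rw [b23, neg_zero] at h32
    intro i j
    fin_cases i <;> fin_cases j <;> first | exact hd _ | assumption
  apply Subtype.ext
  ext (i | i) (j | j)
  · exact hk i j
  · rw [Subsingleton.elim j 0]; exact hu i
  · rw [Subsingleton.elim i 0]; exact (h1.2.1 j).trans (hu j)
  · rw [Subsingleton.elim i 0, Subsingleton.elim j 0]; exact h1.2.2

theorem coords_e (i : Fin 4) : coords (e i : g) =
    ![(Pi.single i 1 : Fin 4 → ℂ) 0, (Pi.single i 1 : Fin 4 → ℂ) 1, (Pi.single i 1 : Fin 4 → ℂ) 2,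
      (Pi.single i 1 : Fin 4 → ℂ) 3, 0, 0, 0, 0, 0, 0] := rfl

theorem coords_lie_e (i j : Fin 4) : coords ⁅(e i : g), (e j : g)⁆ =
    ![0, 0, 0, 0, (Matrix.single i j 1 - Matrix.single j i 1 : Matrix (Fin 4) (Fin 4) ℂ) 0 1,
      (Matrix.single i j 1 - Matrix.single j i 1 : Matrix (Fin 4) (Fin 4) ℂ) 0 2,
      (Matrix.single i j 1 - Matrix.single j i 1 : Matrix (Fin 4) (Fin 4) ℂ) 0 3,
      (Matrix.single i j 1 - Matrix.single j i 1 : Matrix (Fin 4) (Fin 4) ℂ) 1 2,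
      (Matrix.single i j 1 - Matrix.single j i 1 : Matrix (Fin 4) (Fin 4) ℂ) 1 3,
      (Matrix.single i j 1 - Matrix.single j i 1 : Matrix (Fin 4) (Fin 4) ℂ) 2 3] := by
  rw [coords_apply, coe_lie_e]
  rfl

theorem coords_gvec (t : Fin 10) : coords (gvec t) = Pi.single t 1 := by
  have h : ∀ i j : Fin 10, (if i = j then (1 : ℂ) else 0) = (Pi.single j 1 : Fin 10 → ℂ) i :=
    fun i j => by simp [Pi.single_apply]
  fin_cases t
  iterate 4
    refine (coords_e _).trans ?_
    funext s
    rw [← h]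
    fin_cases s <;> simp
  all_goals
    refine (coords_lie_e _ _).trans ?_
    funext s
    rw [← h]
    fin_cases s <;> simp

/-- The basis of `𝔤` given by an orthogonal basis of `𝔭` and its brackets. -/
noncomputable def gbasis : Module.Basis (Fin 10) ℂ g :=
  Module.Basis.ofEquivFun (LinearEquiv.ofBijective coords ⟨coords_injective, by
    intro x
    refine ⟨∑ t, x t • gvec t, ?_⟩
    rw [map_sum]
    simp only [map_smul, coords_gvec]
    funext s
    simp [Finset.sum_apply, Pi.single_apply]⟩)

theorem gbasis_apply (t : Fin 10) : gbasis t = gvec t := by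
  rw [gbasis, Module.Basis.coe_ofEquivFun, LinearEquiv.symm_apply_eq]
  exact (coords_gvec t).symm

end SO41

/-! ### Symbols on `U(𝔤)` and on `U(𝔤) ⊗ C(𝔭)`. -/

namespace SO41

attribute [local instance 100] LieRing.ofAssociativeRing

open PBW

/-- The symbols above are indexed by linear forms on all matrices; a projection onto `𝔤` extends the
forms on `𝔤` to such forms. -/
theorem exists_proj : ∃ f : Matrix (Fin 4 ⊕ Fin 1) (Fin 4 ⊕ Fin 1) ℂ →ₗ[ℂ] g,
    f ∘ₗ g.toSubmodule.subtype = LinearMap.id :=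
  g.toSubmodule.subtype.exists_leftInverse_of_injective (Submodule.ker_subtype _)

/-- The degree `n` symbol of an element of `U(𝔤)` at a linear form on `𝔤`. -/
noncomputable def sym (n : ℕ) (l : Module.Dual ℂ g) : U →ₗ[ℂ] ℂ :=
  symb g.incl (l ∘ₗ exists_proj.choose) n

theorem sym_mul {a b : ℕ} (l : Module.Dual ℂ g) {u v : U} (hu : u ∈ filt ℂ g a)
    (hv : v ∈ filt ℂ g b) : sym (a + b) l (u * v) = sym a l u * sym b l v :=
  symb_mul _ _ hu hv

theorem sym_algebraMap (l : Module.Dual ℂ g) (c : ℂ) : sym 0 l (algebraMap ℂ U c) = c :=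
  symb_algebraMap _ _ c

theorem sym_one (l : Module.Dual ℂ g) : sym 0 l 1 = 1 :=
  symb_one _ _

theorem proj_coe (X : g) : exists_proj.choose (X : Matrix (Fin 4 ⊕ Fin 1) (Fin 4 ⊕ Fin 1) ℂ) = X :=
  LinearMap.congr_fun exists_proj.choose_spec X

theorem sym_ι (l : Module.Dual ℂ g) (X : g) :
    sym 1 l (UniversalEnvelopingAlgebra.ι ℂ X) = l X := by
  rw [sym, symb_ι]
  exact congrArg l (proj_coe X)

theorem sym_of_lt {m i : ℕ} (l : Module.Dual ℂ g) {u : U} (hu : u ∈ filt ℂ g m) (h : m < i) :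
    sym i l u = 0 :=
  symb_of_lt _ _ hu h

theorem sym_algebraMap_mul {m : ℕ} (l : Module.Dual ℂ g) {u : U} (c : ℂ) (hu : u ∈ filt ℂ g m) :
    sym (m + 1) l (algebraMap ℂ U c * u) = 0 := by
  rw [← Algebra.smul_def, map_smul, sym_of_lt l hu m.lt_succ_self, smul_zero]

theorem sym_ι_mul {m : ℕ} (l : Module.Dual ℂ g) {u : U} (X : g) (hu : u ∈ filt ℂ g m) :
    sym (m + 1) l (UniversalEnvelopingAlgebra.ι ℂ X * u) = l X * sym m l u := by
  rw [add_comm m 1, sym_mul l (ι_mem_filt X) hu, sym_ι]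

theorem actU_mem {m : ℕ} {u : U} (k : K) (hu : u ∈ filt ℂ g m) : actU k u ∈ filt ℂ g m := by
  refine filt_induction (P := fun m u => actU k u ∈ filt ℂ g m) ?_ ?_ ?_ ?_ hu
  · intro c
    rw [AlgHom.commutes, Algebra.algebraMap_eq_smul_one]
    exact Submodule.smul_mem _ _ (one_mem_filt 0)
  · intro m u v hu hv
    rw [map_add]
    exact add_mem hu hv
  · intro m u c _ h
    rw [← Algebra.smul_def, map_smul]
    exact Submodule.smul_mem _ _ (filt_mono m.le_succ h)
  · intro m u X _ h
    rw [map_mul, actU_ι, add_comm m 1]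
    exact mul_mem_filt (ι_mem_filt _) h

/-- The action of `K` on linear forms. -/
noncomputable def coad (k : K) (l : Module.Dual ℂ g) : Module.Dual ℂ g := l ∘ₗ (Ad k : g →ₗ[ℂ] g)

theorem coad_apply (k : K) (l : Module.Dual ℂ g) (X : g) : coad k l X = l (Ad k X) := rfl

theorem sym_actU {m : ℕ} {u : U} (k : K) (l : Module.Dual ℂ g) (hu : u ∈ filt ℂ g m) :
    sym m l (actU k u) = sym m (coad k l) u := by
  refine filt_induction (P := fun m u => sym m l (actU k u) = sym m (coad k l) u) ?_ ?_ ?_ ?_ hu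
  · intro c
    rw [AlgHom.commutes, sym_algebraMap, sym_algebraMap]
  · intro m u v hu hv
    rw [map_add, map_add, map_add, hu, hv]
  · intro m u c hu h
    rw [map_mul, AlgHom.commutes, sym_algebraMap_mul _ _ (actU_mem k hu), sym_algebraMap_mul _ _ hu]
  · intro m u X hu h
    rw [map_mul, actU_ι, sym_ι_mul _ _ (actU_mem k hu), sym_ι_mul _ _ hu, h, coad_apply]

theorem sym_smul {m : ℕ} {u : U} (t : ℂ) (l : Module.Dual ℂ g) (hu : u ∈ filt ℂ g m) :
    sym m (t • l) u = t ^ m * sym m l u := by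
  refine filt_induction (P := fun m u => sym m (t • l) u = t ^ m * sym m l u) ?_ ?_ ?_ ?_ hu
  · intro c
    simp [sym_algebraMap]
  · intro m u v hu hv
    rw [map_add, map_add, hu, hv, mul_add]
  · intro m u c hu h
    rw [sym_algebraMap_mul _ _ hu, sym_algebraMap_mul _ _ hu, mul_zero]
  · intro m u X hu h
    rw [sym_ι_mul _ _ hu, sym_ι_mul _ _ hu, h, LinearMap.smul_apply, smul_eq_mul]
    ring

/-- The algebra of polynomial functions on the dual of `𝔤`. -/
noncomputable def Pol : Subalgebra ℂ (Module.Dual ℂ g → ℂ) :=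
  (MvPolynomial.aeval (R := ℂ) fun (t : Fin 10) (l : Module.Dual ℂ g) => l (gbasis t)).range

theorem mem_Pol {f : Module.Dual ℂ g → ℂ} : f ∈ Pol ↔ ∃ q : MvPolynomial (Fin 10) ℂ,
    ∀ l, f l = MvPolynomial.eval (fun t => l (gbasis t)) q := by
  have h : ∀ (q : MvPolynomial (Fin 10) ℂ) (l : Module.Dual ℂ g),
      (MvPolynomial.aeval (R := ℂ) fun (t : Fin 10) (l : Module.Dual ℂ g) => l (gbasis t)) q l =
        MvPolynomial.eval (fun t => l (gbasis t)) q := by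
    intro q l
    have := MvPolynomial.comp_aeval_apply (R := ℂ) (fun (t : Fin 10) (l :
        Module.Dual ℂ g) => l (gbasis t))
      (Pi.evalAlgHom ℂ (fun _ : Module.Dual ℂ g => ℂ) l) q
    simpa [MvPolynomial.aeval_eq_eval] using! this
  constructor
  · rintro ⟨q, rfl⟩
    exact ⟨q, h q⟩
  · rintro ⟨q, hq⟩
    exact ⟨q, funext fun l => (h q l).trans (hq l).symm⟩

theorem eval_mem_Pol (X : g) : (fun l : Module.Dual ℂ g => l X) ∈ Pol := by
  rw [mem_Pol]
  refine ⟨∑ t, MvPolynomial.C (gbasis.repr X t) * MvPolynomial.X t, fun l => ?_⟩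
  conv_lhs => rw [← gbasis.sum_repr X]
  simp only [map_sum, map_smul, smul_eq_mul, map_mul, MvPolynomial.eval_C, MvPolynomial.eval_X]

/-- The linear form with given values on the basis. -/
noncomputable def ofCoords (x : Fin 10 → ℂ) : Module.Dual ℂ g := gbasis.constr ℂ x

theorem ofCoords_gbasis (x : Fin 10 → ℂ) (t : Fin 10) : ofCoords x (gbasis t) = x t := by
  simp [ofCoords]

/-- Linear forms with real values on the basis. -/
def IsRealForm (l : Module.Dual ℂ g) : Prop := ∃ x : Fin 10 → ℝ, ∀ t, l (gbasis t) = x t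

/-- The product `f h` vanishes at all real points, hence identically, and polynomials over `ℂ` form
a domain. Real forms are the right test set because the compact group `K` moves only these into the
slice. -/
theorem eq_zero_of_mul_eq_zero {f h : Module.Dual ℂ g → ℂ} (hf : f ∈ Pol) (hh : h ∈ Pol)
    (h0 : ∃ l, h l ≠ 0) (hfh : ∀ l, IsRealForm l → h l ≠ 0 → f l = 0) : ∀ l, f l = 0 := by
  obtain ⟨q, hq⟩ := mem_Pol.1 hf
  obtain ⟨r, hr⟩ := mem_Pol.1 hh
  have hqr : q * r = 0 := by
    refine MvPolynomial.funext_set (fun _ => Set.range Complex.ofReal)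
      (fun _ => Set.infinite_range_of_injective Complex.ofReal_injective) fun x hx => ?_
    choose y hy using fun t => hx t (Set.mem_univ t)
    rw [map_mul, map_zero]
    by_cases h : MvPolynomial.eval x r = 0
    · rw [h, mul_zero]
    · have := hfh (ofCoords x) ⟨y, fun t => by rw [ofCoords_gbasis, hy]⟩
        (by rw [hr]; simpa [ofCoords_gbasis] using h)
      rw [hq] at this
      simp only [ofCoords_gbasis] at this
      rw [this, zero_mul]
  rcases mul_eq_zero.1 hqr with h | h
  · intro l; rw [hq, h, map_zero]
  · obtain ⟨l, hl⟩ := h0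
    exact absurd (by rw [hr, h, map_zero]) hl

theorem sym_mem_Pol {m : ℕ} {u : U} (hu : u ∈ filt ℂ g m) : (fun l => sym m l u) ∈ Pol := by
  refine filt_induction (P := fun m u => (fun l => sym m l u) ∈ Pol) ?_ ?_ ?_ ?_ hu
  · intro c
    simp only [sym_algebraMap]
    exact Pol.algebraMap_mem c
  · intro m u v hu hv
    simp only [map_add]
    exact add_mem hu hv
  · intro m u c hu h
    simp only [sym_algebraMap_mul _ _ hu]
    exact zero_mem _
  · intro m u X hu h
    simp only [sym_ι_mul _ _ hu]
    exact mul_mem (eval_mem_Pol X) h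

/-- Modulo lower filtration `u` is an ordered polynomial, and its symbols are the values of that
polynomial at all points. -/
theorem mem_filtLT_of_sym {m : ℕ} {u : U} (hu : u ∈ filt ℂ g m) (h : ∀ l, sym m l u = 0) :
    u ∈ filtLT ℂ g m := by
  obtain ⟨q, hq, hq'⟩ := exists_ordered gbasis hu
  have hz : q = 0 := by
    refine MvPolynomial.funext fun x => ?_
    rw [map_zero]
    have h1 : sym m (ofCoords x) (u - ordered gbasis q) = 0 := by
      cases m with
      | zero => rw [(Submodule.mem_bot ℂ).1 hq', map_zero]
      | succ m => exact sym_of_lt _ hq' m.lt_succ_self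
    rw [map_sub, h, zero_sub, neg_eq_zero, sym, symb_ordered _ _ _ hq] at h1
    rw [← h1]
    refine congrArg (fun y => MvPolynomial.eval y q) (funext fun t => ?_)
    exact ((congrArg (ofCoords x) (proj_coe (gbasis t))).trans (ofCoords_gbasis x t)).symm
  rwa [hz, map_zero, sub_zero] at hq'

/-- The subspace `N ⊗ C(𝔭)` of `U(𝔤) ⊗ C(𝔭)`. -/
noncomputable def tens (N : Submodule ℂ U) : Submodule ℂ (U ⊗[ℂ] C) :=
  Submodule.span ℂ {z | ∃ u ∈ N, ∃ c : C, u ⊗ₜ[ℂ] c = z}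

theorem tmul_mem_tens {N : Submodule ℂ U} {u : U} (hu : u ∈ N) (c : C) : u ⊗ₜ[ℂ] c ∈ tens N :=
  Submodule.subset_span ⟨u, hu, c, rfl⟩

theorem tens_mono {N N' : Submodule ℂ U} (h : N ≤ N') : tens N ≤ tens N' :=
  Submodule.span_mono fun _ ⟨u, hu, c, hc⟩ => ⟨u, h hu, c, hc⟩

theorem exists_mem_tens (z : U ⊗[ℂ] C) : ∃ m, z ∈ tens (filt ℂ g m) := by
  induction z with
  | zero => exact ⟨0, zero_mem _⟩
  | tmul u c =>
    obtain ⟨m, hm⟩ := exists_mem_filt u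
    exact ⟨m, tmul_mem_tens hm c⟩
  | add x y hx hy =>
    obtain ⟨i, hi⟩ := hx
    obtain ⟨j, hj⟩ := hy
    exact ⟨max i j, add_mem (tens_mono (filt_mono (le_max_left i j)) hi)
      (tens_mono (filt_mono (le_max_right i j)) hj)⟩

theorem tens_induction {N : Submodule ℂ U} {P : U ⊗[ℂ] C → Prop} (h0 : P 0)
    (ht : ∀ u ∈ N, ∀ c : C, P (u ⊗ₜ[ℂ] c)) (ha : ∀ x y, P x → P y → P (x + y))
    {z : U ⊗[ℂ] C} (hz : z ∈ tens N) : P z := by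
  have h : ∀ r : ℂ, P (r • z) := by
    refine Submodule.span_induction (p := fun z _ => ∀ r : ℂ, P (r • z)) ?_ ?_ ?_ ?_ hz
    · rintro _ ⟨u, hu, c, rfl⟩ r
      rw [← TensorProduct.tmul_smul]
      exact ht u hu _
    · intro r; rw [smul_zero]; exact h0
    · intro x y _ _ hx hy r; rw [smul_add]; exact ha _ _ (hx r) (hy r)
    · intro s x _ hx r; rw [smul_smul]; exact hx _
  simpa using h 1

theorem tens_induction₂ {N N' : Submodule ℂ U} {P : U ⊗[ℂ] C → U ⊗[ℂ] C → Prop}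
    (hl : ∀ w, P 0 w) (hr : ∀ z, P z 0)
    (ht : ∀ u ∈ N, ∀ c : C, ∀ v ∈ N', ∀ d : C, P (u ⊗ₜ[ℂ] c) (v ⊗ₜ[ℂ] d))
    (hal : ∀ x y w, P x w → P y w → P (x + y) w) (har : ∀ z x y, P z x → P z y → P z (x + y))
    {z w : U ⊗[ℂ] C} (hz : z ∈ tens N) (hw : w ∈ tens N') : P z w :=
  tens_induction (P := fun z => P z w) (hl w)
    (fun u hu c => tens_induction (P := fun w => P (u ⊗ₜ[ℂ] c) w) (hr _) (ht u hu c) (har _) hw)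
    (fun x y => hal x y w) hz

theorem mul_mem_tens {a b : ℕ} {z w : U ⊗[ℂ] C} (hz : z ∈ tens (filt ℂ g a))
    (hw : w ∈ tens (filt ℂ g b)) : z * w ∈ tens (filt ℂ g (a + b)) := by
  refine tens_induction₂ (P := fun z w => z * w ∈ tens (filt ℂ g (a + b))) ?_ ?_ ?_ ?_ ?_ hz hw
  · intro y; rw [zero_mul]; exact zero_mem _
  · intro y; rw [mul_zero]; exact zero_mem _
  · intro u hu c v hv d
    rw [Algebra.TensorProduct.tmul_mul_tmul]
    exact tmul_mem_tens (mul_mem_filt hu hv) _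
  · intro x y z h1 h2; rw [add_mul]; exact add_mem h1 h2
  · intro x y z h1 h2; rw [mul_add]; exact add_mem h1 h2

/-- The degree `n` symbol of an element of `U(𝔤) ⊗ C(𝔭)`. -/
noncomputable def symC (n : ℕ) (l : Module.Dual ℂ g) : U ⊗[ℂ] C →ₗ[ℂ] C :=
  (TensorProduct.lid ℂ C).toLinearMap ∘ₗ (sym n l).rTensor C

theorem symC_tmul (n : ℕ) (l : Module.Dual ℂ g) (u : U) (c : C) :
    symC n l (u ⊗ₜ[ℂ] c) = sym n l u • c := by
  simp [symC]

theorem mul_smul_mul {A : Type*} [Ring A] [Algebra ℂ A] (a b : ℂ) (c d : A) :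
    (a * b) • (c * d) = (a • c) * (b • d) := by
  rw [smul_mul_assoc, mul_smul_comm, smul_smul]

theorem symC_mul {a b : ℕ} (l : Module.Dual ℂ g) {z w : U ⊗[ℂ] C} (hz : z ∈ tens (filt ℂ g a))
    (hw : w ∈ tens (filt ℂ g b)) : symC (a + b) l (z * w) = symC a l z * symC b l w := by
  refine tens_induction₂ (P := fun z w => symC (a + b) l (z * w) = symC a l z * symC b l w)
    ?_ ?_ ?_ ?_ ?_ hz hw
  · intro y; rw [zero_mul, map_zero, map_zero, zero_mul]
  · intro y; rw [mul_zero, map_zero, map_zero, mul_zero]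
  · intro u hu c v hv d
    rw [Algebra.TensorProduct.tmul_mul_tmul, symC_tmul, symC_tmul, symC_tmul, sym_mul l hu hv]
    exact mul_smul_mul _ _ _ _
  · intro x y w h1 h2
    exact (congrArg (symC (a + b) l) (add_mul x y w)).trans <|
      ((symC (a + b) l).map_add _ _).trans <| (congrArg₂ (· + ·) h1 h2).trans <|
      (add_mul (symC a l x) (symC a l y) (symC b l w)).symm.trans <|
      congrArg (· * symC b l w) ((symC a l).map_add x y).symm
  · intro w x y h1 h2
    exact (congrArg (symC (a + b) l) (mul_add w x y)).trans <|
      ((symC (a + b) l).map_add _ _).trans <| (congrArg₂ (· + ·) h1 h2).trans <|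
      (mul_add (symC a l w) (symC b l x) (symC b l y)).symm.trans <|
      congrArg (symC a l w * ·) ((symC b l).map_add x y).symm

theorem symC_actUC {m : ℕ} {z : U ⊗[ℂ] C} (k : K) (l : Module.Dual ℂ g)
    (hz : z ∈ tens (filt ℂ g m)) : symC m l (actUC k z) = actC k (symC m (coad k l) z) := by
  refine tens_induction (P := fun z => symC m l (actUC k z) = actC k (symC m (coad k l) z))
    ?_ ?_ ?_ hz
  · simp
  · intro u hu c
    rw [actUC, Algebra.TensorProduct.map_tmul, symC_tmul, symC_tmul, sym_actU k l hu, map_smul]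
  · intro x y hx hy
    simp only [map_add, hx, hy]

theorem symC_smul {m : ℕ} {z : U ⊗[ℂ] C} (t : ℂ) (l : Module.Dual ℂ g)
    (hz : z ∈ tens (filt ℂ g m)) : symC m (t • l) z = t ^ m • symC m l z := by
  refine tens_induction (P := fun z => symC m (t • l) z = t ^ m • symC m l z) ?_ ?_ ?_ hz
  · simp
  · intro u hu c
    rw [symC_tmul, symC_tmul, sym_smul t l hu, mul_smul]
  · intro x y hx hy
    simp only [map_add, hx, hy, smul_add]

theorem symC_mem_Pol {m : ℕ} {z : U ⊗[ℂ] C} (hz : z ∈ tens (filt ℂ g m)) (φ : C →ₗ[ℂ] ℂ) :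
    (fun l => φ (symC m l z)) ∈ Pol := by
  refine tens_induction (P := fun z => (fun l => φ (symC m l z)) ∈ Pol) ?_ ?_ ?_ hz
  · simp only [map_zero]
    exact zero_mem _
  · intro u hu c
    simp only [symC_tmul, map_smul, smul_eq_mul]
    exact mul_mem (sym_mem_Pol hu) (Pol.algebraMap_mem (φ c))
  · intro x y hx hy
    simp only [map_add]
    exact add_mem hx hy

/-- Expansion in a basis of `C(𝔭)` reduces this to `mem_filtLT_of_sym` for each coefficient. -/
theorem mem_tens_filtLT_of_symC {m : ℕ} {z : U ⊗[ℂ] C} (hz : z ∈ tens (filt ℂ g m))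
    (h : ∀ l, symC m l z = 0) : z ∈ tens (filtLT ℂ g m) := by
  classical
  set b := Module.Basis.ofVectorSpace ℂ C
  set E := TensorProduct.equivFinsuppOfBasisRight (M := U) b
  have h1 : ∀ i, E z i ∈ filt ℂ g m := by
    intro i
    refine tens_induction (P := fun z => E z i ∈ filt ℂ g m) ?_ ?_ ?_ hz
    · simp
    · intro u hu c
      rw [TensorProduct.equivFinsuppOfBasisRight_apply_tmul_apply]
      exact Submodule.smul_mem _ _ hu
    · intro x y hx hy
      rw [map_add, Finsupp.add_apply]
      exact add_mem hx hy
  have hsum : z = (E z).sum fun i u => u ⊗ₜ[ℂ] b i := by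
    conv_lhs => rw [← E.symm_apply_apply z]
    exact TensorProduct.equivFinsuppOfBasisRight_symm_apply b (E z)
  rw [hsum]
  refine Submodule.sum_mem _ fun i hi => tmul_mem_tens (mem_filtLT_of_sym (h1 i) fun l => ?_) _
  have h2 := h l
  rw [hsum, Finsupp.sum, map_sum] at h2
  simp only [symC_tmul] at h2
  exact (linearIndependent_iff'.1 b.linearIndependent) _ _ h2 i hi

end SO41

/-! ### The basis of ordered products in the Clifford algebra. -/

namespace SO41

attribute [local instance 100] LieRing.ofAssociativeRing

section Words

set_option linter.unusedSectionVars false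

variable {R : Type*} [Ring R] [Algebra ℂ R]

/-- Four anticommuting elements with square `2`. -/
structure IsCliff (c : Fin 4 → R) : Prop where
  sq : ∀ i, c i * c i = 2
  anti : ∀ i j, i ≠ j → c i * c j = -(c j * c i)

/-- The index set of the ordered products of four generators. -/
abbrev Ix : Type := Fin 2 × Fin 2 × Fin 2 × Fin 2

/-- The ordered product of the generators selected by `I`. -/
def word (c : Fin 4 → R) (I : Ix) : R :=
  c 0 ^ (I.1 : ℕ) * (c 1 ^ (I.2.1 : ℕ) * (c 2 ^ (I.2.2.1 : ℕ) * c 3 ^ (I.2.2.2 : ℕ)))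

namespace IsCliff

variable {c : Fin 4 → R} (hc : IsCliff c)

include hc

theorem sq_assoc (i : Fin 4) (x : R) : c i * (c i * x) = 2 * x := by
  rw [← mul_assoc, hc.sq]

theorem anti_assoc (i j : Fin 4) (h : i ≠ j) (x : R) : c i * (c j * x) = -(c j * (c i * x)) := by
  rw [← mul_assoc, hc.anti i j h, neg_mul, mul_assoc]

theorem isUnit (i : Fin 4) : IsUnit (c i) := by
  have h : c i * ((1 / 2 : ℂ) • c i) = 1 := by
    rw [mul_smul_comm, hc.sq, ← map_ofNat (algebraMap ℂ R) 2, Algebra.algebraMap_eq_smul_one,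
      smul_smul]
    norm_num
  have h' : ((1 / 2 : ℂ) • c i) * c i = 1 := by
    rw [smul_mul_assoc, ← mul_smul_comm, h]
  exact ⟨⟨c i, _, h, h'⟩, rfl⟩

theorem isUnit_word (I : Ix) : IsUnit (word c I) :=
  ((hc.isUnit 0).pow _).mul (((hc.isUnit 1).pow _).mul (((hc.isUnit 2).pow _).mul
    ((hc.isUnit 3).pow _)))

theorem mul_pow (i j : Fin 4) (h : i ≠ j) (a : Fin 2) (x : R) :
    c i * (c j ^ (a : ℕ) * x) = (if a = 0 then (1 : ℂ) else -1) • (c j ^ (a : ℕ) * (c i * x)) := by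
  fin_cases a
  · simp
  · simp [hc.anti_assoc i j h]

theorem mul_pow_self (i : Fin 4) (a : Fin 2) (x : R) :
    c i * (c i ^ (a : ℕ) * x) = (if a = 0 then (1 : ℂ) else 2) • (c i ^ ((1 - a : Fin 2) :
        ℕ) * x) := by
  fin_cases a
  · simp
  · simp [hc.sq_assoc i, two_smul, two_mul]

theorem exists_mul_word (i : Fin 4) (I : Ix) : ∃ (s : ℂ) (J : Ix), c i * word c I = s • word c J :=
    by
  obtain ⟨a, b, d, f⟩ := I
  have h3 := hc.mul_pow_self 3 f 1
  rw [mul_one, mul_one] at h3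
  fin_cases i
  · exact ⟨_, (1 - a, b, d, f), hc.mul_pow_self 0 a _⟩
  · refine ⟨(if a = 0 then 1 else -1) * (if b = 0 then 1 else 2), (a, 1 - b, d, f),
      Eq.trans (hc.mul_pow 1 0 (by decide) a _) ?_⟩
    dsimp only
    rw [hc.mul_pow_self 1 b, mul_smul_comm, smul_smul]
    rfl
  · refine ⟨(if a = 0 then 1 else -1) * ((if b = 0 then 1 else -1) * (if d = 0 then 1 else 2)),
      (a, b, 1 - d, f), Eq.trans (hc.mul_pow 2 0 (by decide) a _) ?_⟩
    dsimp only
    rw [hc.mul_pow 2 1 (by decide) b, hc.mul_pow_self 2 d, mul_smul_comm, mul_smul_comm,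
      mul_smul_comm, smul_smul, smul_smul, mul_assoc]
    rfl
  · refine ⟨(if a = 0 then 1 else -1) * ((if b = 0 then 1 else -1) * ((if d = 0 then 1 else -1) *
      (if f = 0 then 1 else 2))), (a, b, d, 1 - f), Eq.trans (hc.mul_pow 3 0 (by decide) a _) ?_⟩
    dsimp only
    rw [hc.mul_pow 3 1 (by decide) b, hc.mul_pow 3 2 (by decide) d, h3, mul_smul_comm,
      mul_smul_comm, mul_smul_comm, mul_smul_comm, mul_smul_comm, mul_smul_comm, smul_smul,
      smul_smul, smul_smul, mul_assoc, mul_assoc]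
    rfl

end IsCliff

/-- The sign of the ordered product indexed by `I` when the generators change signs `s`. -/
def sgn (s : Fin 4 → ℂ) (I : Ix) : ℂ :=
  s 0 ^ (I.1 : ℕ) * (s 1 ^ (I.2.1 : ℕ) * (s 2 ^ (I.2.2.1 : ℕ) * s 3 ^ (I.2.2.2 : ℕ)))

theorem map_word {R' : Type*} [Ring R'] [Algebra ℂ R'] (f : R →ₐ[ℂ] R') (c : Fin 4 → R)
    (c' : Fin 4 → R') (s : Fin 4 → ℂ) (hf : ∀ i, f (c i) = s i • c' i) (I : Ix) :
    f (word c I) = sgn s I • word c' I := by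
  simp only [word, sgn, map_mul, map_pow, hf, smul_pow, smul_mul_assoc, mul_smul_comm, smul_smul]
  congr 1
  ring

end Words

/-- The generators of `C(𝔭)`. -/
noncomputable def cl (i : Fin 4) : C := CliffordAlgebra.ι Q (e i)

theorem isCliff_cl : IsCliff cl where
  sq i := by
    rw [cl, CliffordAlgebra.ι_sq_scalar, e, Q_pvec]
    simpa [Pi.single_apply] using map_ofNat (algebraMap ℂ C) 2
  anti i j h := by
    have := CliffordAlgebra.ι_mul_ι_add_swap (Q := Q) (e i) (e j)
    have h0 : QuadraticMap.polar Q (e i) (e j) = 0 := by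
      rw [QuadraticMap.polar, e, e, ← map_add, Q_pvec, Q_pvec, Q_pvec]
      simp [Pi.single_apply, mul_add, Finset.sum_add_distrib, h, h.symm]
    rw [h0, map_zero] at this
    exact eq_neg_of_add_eq_zero_left this

/-- The change of sign of coordinates of `𝔭`. -/
noncomputable def flipP (s : Fin 4 → ℂ) (hs : ∀ i, s i * s i = 1) : Q →qᵢ Q where
  toLinearMap := pvec ∘ₗ LinearMap.pi (fun i => s i • LinearMap.proj i) ∘ₗ
    (LinearEquiv.ofBijective pvec ⟨by
      intro w w' h
      have h1 := congrArg (fun X : p => (X : g).1) h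
      simp only [coe_pvec] at h1
      funext i
      exact congrFun (congrFun h1 (.inl i)) (.inr 0), pvec_surjective⟩).symm.toLinearMap
  map_app' X := by
    obtain ⟨w, rfl⟩ := pvec_surjective X
    have h : ∀ f : (Fin 4 → ℂ) ≃ₗ[ℂ] p, (∀ w, f w = pvec w) → f.symm (pvec w) = w := by
      intro f hf
      rw [← hf, LinearEquiv.symm_apply_apply]
    simp only [LinearMap.comp_apply, LinearEquiv.coe_coe, AddHom.toFun_eq_coe,
      LinearMap.coe_toAddHom]
    rw [h _ fun w => rfl, Q_pvec, Q_pvec]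
    congr 1
    refine Finset.sum_congr rfl fun i _ => ?_
    simp only [LinearMap.pi_apply, LinearMap.smul_apply, LinearMap.proj_apply, smul_eq_mul]
    linear_combination w i * w i * hs i

theorem flipP_e (s : Fin 4 → ℂ) (hs : ∀ i, s i * s i = 1) (i : Fin 4) :
    flipP s hs (e i) = s i • e i := by
  have h : ∀ (f : (Fin 4 → ℂ) ≃ₗ[ℂ] p) (w), (∀ w, f w = pvec w) → f.symm (pvec w) = w := by
    intro f w hf
    rw [← hf, LinearEquiv.symm_apply_apply]
  change (pvec ∘ₗ LinearMap.pi (fun i => s i • LinearMap.proj i) ∘ₗ _) (pvec _) = _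
  simp only [LinearMap.comp_apply, LinearEquiv.coe_coe]
  rw [h _ _ fun w => rfl, e, ← map_smul]
  congr 1
  funext j
  simp only [LinearMap.pi_apply, LinearMap.smul_apply, LinearMap.proj_apply, smul_eq_mul,
    Pi.smul_apply, Pi.single_apply]
  split_ifs with hij
  · rw [hij]
  · simp

/-- The automorphism of `C(𝔭)` that changes the sign of one generator. -/
noncomputable def refl (i : Fin 4) : C →ₐ[ℂ] C :=
  CliffordAlgebra.map (flipP (Function.update 1 i (-1)) (by
    intro j
    rcases eq_or_ne j i with rfl | h
    · simp
    · simp [h]))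

theorem refl_word (i : Fin 4) (I : Ix) :
    refl i (word cl I) = sgn (Function.update 1 i (-1)) I • word cl I := by
  refine map_word _ _ _ _ (fun j => ?_) I
  rw [refl, cl, CliffordAlgebra.map_apply_ι, flipP_e, map_smul]

/-- The ordered products are simultaneous eigenvectors of the four sign changes, and they are
nonzero because they are units. The weights `2 ^ i` combine the sign changes into one operator with
distinct eigenvalues. -/
theorem linearIndependent_word : LinearIndependent ℂ (word cl) := by
  refine Module.End.eigenvectors_linearIndependent'
    (∑ i : Fin 4, (2 : ℂ) ^ (i : ℕ) • (refl i).toLinearMap)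
    (fun I => ∑ i : Fin 4, (2 : ℂ) ^ (i : ℕ) * sgn (Function.update 1 i (-1)) I) ?_ _ fun I => ?_
  -- The eigenvalue is `15` minus twice the number whose binary digits are `I`, so it determines
  -- `I`.
  · have h1 : ∀ I : Ix, ∑ i : Fin 4, (2 : ℂ) ^ (i : ℕ) * sgn (Function.update 1 i (-1)) I =
        ((15 - 2 * ((I.1 : ℕ) + 2 * (I.2.1 : ℕ) + 4 * (I.2.2.1 : ℕ) + 8 * (I.2.2.2 : ℕ) : ℤ) : ℤ) :
          ℂ) := by
      rintro ⟨a, b, d, f⟩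
      have h2 : ∀ a : Fin 2, (-1 : ℂ) ^ (a : ℕ) = 1 - 2 * ((a : ℕ) : ℂ) := by
        intro a
        fin_cases a <;> norm_num
      simp [Fin.sum_univ_four, sgn, h2]
      ring
    intro I J h
    simp only [h1] at h
    have h3 := Int.cast_injective h
    obtain ⟨a, b, d, f⟩ := I
    obtain ⟨a', b', d', f'⟩ := J
    dsimp only at h3
    simp only [Prod.mk.injEq, Fin.ext_iff]
    omega
  · refine ⟨?_, (isCliff_cl.isUnit_word I).ne_zero⟩
    rw [Module.End.mem_eigenspace_iff, LinearMap.sum_apply, Finset.sum_smul]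
    refine Finset.sum_congr rfl fun i _ => ?_
    rw [LinearMap.smul_apply, AlgHom.toLinearMap_apply, refl_word, smul_smul]

theorem span_word : ⊤ ≤ Submodule.span ℂ (Set.range (word cl)) := by
  rintro x -
  refine CliffordAlgebra.left_induction Q (P := fun x => x ∈ Submodule.span ℂ (Set.range (word cl)))
    ?_ ?_ ?_ x
  · intro r
    rw [Algebra.algebraMap_eq_smul_one]
    refine Submodule.smul_mem _ _ (Submodule.subset_span ⟨(0, 0, 0, 0), ?_⟩)
    simp [word]
  · intro x y hx hy
    exact add_mem hx hy
  · intro x m hx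
    obtain ⟨w, rfl⟩ := pvec_surjective m
    rw [pvec_eq_sum, map_sum, Finset.sum_mul]
    refine Submodule.sum_mem _ fun i _ => ?_
    rw [map_smul, smul_mul_assoc]
    refine Submodule.smul_mem _ _ ?_
    refine Submodule.span_induction (p :=
        fun x _ => CliffordAlgebra.ι Q (e i) * x ∈ _) ?_ ?_ ?_ ?_ hx
    · rintro _ ⟨I, rfl⟩
      obtain ⟨s, J, h⟩ := isCliff_cl.exists_mul_word i I
      change cl i * word cl I ∈ _
      rw [h]
      exact Submodule.smul_mem _ _ (Submodule.subset_span ⟨J, rfl⟩)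
    · rw [mul_zero]; exact zero_mem _
    · intro x y _ _ hx hy; rw [mul_add]; exact add_mem hx hy
    · intro r x _ hx; rw [mul_smul_comm]; exact Submodule.smul_mem _ _ hx

/-- The basis of `C(𝔭)` of ordered products of generators. -/
noncomputable def cbasis : Module.Basis Ix ℂ C := Module.Basis.mk linearIndependent_word span_word

theorem cbasis_apply (I : Ix) : cbasis I = word cl I := by
  simp [cbasis]

end SO41

/-! ### Invariance under orthogonal matrices and alternating sums. -/

namespace SO41

attribute [local instance 100] LieRing.ofAssociativeRing

open PBW

theorem sum_perm4 {N : Type*} [AddCommGroup N] (t : Fin 4 → Fin 4 → Fin 4 → Fin 4 → N) :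
    ∑ σ : Equiv.Perm (Fin 4), Equiv.Perm.sign σ • t (σ 0) (σ 1) (σ 2) (σ 3) = 0 + t 0 1 2 3 -
        t 0 1 3 2 - t 0 2 1 3 + t 0 2 3 1 - t 0 3 2 1 + t 0 3 1 2 - t 1 0 2 3 + t 1 0 3 2 +
        t 1 2 0 3 - t 1 2 3 0 + t 1 3 2 0 - t 1 3 0 2 - t 2 1 0 3 + t 2 1 3 0 + t 2 0 1 3 -
        t 2 0 3 1 + t 2 3 0 1 - t 2 3 1 0 - t 3 1 2 0 + t 3 1 0 2 + t 3 2 1 0 - t 3 2 0 1 +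
        t 3 0 2 1 - t 3 0 1 2 := by
  simp only [Finset.univ_perm_fin_succ, Finset.sum_map, ← Finset.univ_product_univ,
      Finset.sum_product, Fin.sum_univ_succ]
  simp [Equiv.Perm.decomposeFin_symm_apply_zero, Equiv.Perm.decomposeFin.symm_sign,
    Equiv.toEmbedding_apply, Equiv.swap_apply_def, Fin.succ_ne_zero]
  change t 0 1 2 3 + -t 0 1 3 2 + (-t 0 2 1 3 + t 0 2 3 1 + (-t 0 3 2 1 + t 0 3 1 2)) +
    (-t 1 0 2 3 + t 1 0 3 2 + (t 1 2 0 3 + - t 1 2 3 0 + (t 1 3 2 0 + - t 1 3 0 2)) +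
    (-t 2 1 0 3 + t 2 1 3 0 + (t 2 0 1 3 + - t 2 0 3 1 + (t 2 3 0 1 + - t 2 3 1 0)) +
    (-t 3 1 2 0 + t 3 1 0 2 + (t 3 2 1 0 + - t 3 2 0 1 + (t 3 0 2 1 + - t 3 0 1 2))))) = _
  abel

section Equivariant

variable {A : Type*} [Ring A] [Algebra ℂ A]

/-- Orthonormality of the rows of `k`. This is the source of all invariants that do not need `det k
= 1`; the entries of `y` and `z` need not commute. -/
theorem orth_sum {k : Matrix (Fin 4) (Fin 4) ℂ} (hk : k * k.transpose = 1) (y z : Fin 4 → A) :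
    ∑ i, (∑ a, k a i • y a) * (∑ b, k b i • z b) = ∑ a, y a * z a := by
  have h : ∀ a b, ∑ i, k a i * k b i = if a = b then 1 else 0 := by
    intro a b
    rw [← Matrix.one_apply, ← hk, Matrix.mul_apply]
    rfl
  simp only [Finset.sum_mul_sum, smul_mul_assoc, mul_smul_comm, smul_smul]
  rw [Finset.sum_comm]
  refine Finset.sum_congr rfl fun a _ => ?_
  rw [Finset.sum_comm]
  simp only [← Finset.sum_smul, mul_comm (k _ _) (k a _), h]
  simp

/-- A vector of elements that an algebra map transforms by the matrix `k`. -/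
def IsVec (f : A →ₐ[ℂ] A) (k : Matrix (Fin 4) (Fin 4) ℂ) (y : Fin 4 → A) : Prop :=
  ∀ i, f (y i) = ∑ a, k a i • y a

/-- A tensor of elements that an algebra map transforms by the matrix `k`. -/
def IsTen (f : A →ₐ[ℂ] A) (k : Matrix (Fin 4) (Fin 4) ℂ) (E : Fin 4 → Fin 4 → A) : Prop :=
  ∀ i j, f (E i j) = ∑ a, k a i • ∑ b, k b j • E a b

variable {f : A →ₐ[ℂ] A} {k : Matrix (Fin 4) (Fin 4) ℂ}

theorem IsVec.dot (hk : k * k.transpose = 1) {y z : Fin 4 → A} (hy : IsVec f k y)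
    (hz : IsVec f k z) : f (∑ i, y i * z i) = ∑ i, y i * z i := by
  rw [map_sum, ← orth_sum hk y z]
  exact Finset.sum_congr rfl fun i _ => by rw [map_mul, hy, hz]

theorem IsTen.mulVec (hk : k * k.transpose = 1) {E : Fin 4 → Fin 4 → A} {y : Fin 4 → A}
    (hE : IsTen f k E) (hy : IsVec f k y) : IsVec f k fun i => ∑ j, E i j * y j := by
  intro i
  have h : ∀ a, ∑ j, E a j * y j = ∑ j, (∑ b, k b j • E a b) * (∑ b, k b j • y b) :=
    fun a => (orth_sum hk (E a) y).symm
  rw [map_sum]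
  simp only [h, map_mul, hE i, hy _, Finset.sum_mul, Finset.smul_sum, smul_mul_assoc]
  rw [Finset.sum_comm]

theorem IsTen.normSq (hk : k * k.transpose = 1) {E : Fin 4 → Fin 4 → A} (hE : IsTen f k E) :
    f (∑ i, ∑ j, E i j * E i j) = ∑ i, ∑ j, E i j * E i j := by
  calc f (∑ i, ∑ j, E i j * E i j)
      = ∑ i, ∑ j, (∑ a, k a i • ∑ b, k b j • E a b) * (∑ a, k a i • ∑ b, k b j • E a b) := by
        simp only [map_sum, map_mul, hE _ _]
    _ = ∑ j, ∑ i, (∑ a, k a i • ∑ b, k b j • E a b) * (∑ a, k a i • ∑ b, k b j • E a b) :=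
        Finset.sum_comm
    _ = ∑ j, ∑ a, (∑ b, k b j • E a b) * (∑ b, k b j • E a b) :=
        Finset.sum_congr rfl fun j _ => orth_sum hk _ _
    _ = ∑ a, ∑ j, (∑ b, k b j • E a b) * (∑ b, k b j • E a b) := Finset.sum_comm
    _ = ∑ i, ∑ j, E i j * E i j := Finset.sum_congr rfl fun a _ => orth_sum hk _ _

theorem det_single : (Pi.basisFun ℂ (Fin 4)).det (fun i => Pi.single i 1) = 1 := by
  have h : (fun i => Pi.single i 1 : Fin 4 → Fin 4 → ℂ) = Pi.basisFun ℂ (Fin 4) := by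
    funext i
    simp
  rw [h]
  exact (Pi.basisFun ℂ (Fin 4)).det_self

/-- An alternating map in four vectors of `ℂ⁴` is a constant vector times the determinant. -/
theorem alternating_apply_eq {N : Type*} [AddCommGroup N] [Module ℂ N]
    (F : (Fin 4 → ℂ) [⋀^Fin 4]→ₗ[ℂ] N) (hk : k.det = 1) :
    F (fun i => k.mulVec (Pi.single i 1)) = F (fun i => Pi.single i 1) := by
  have h : F = (LinearMap.toSpanSingleton ℂ N (F fun i => Pi.single i 1)).compAlternatingMap
      (Pi.basisFun ℂ (Fin 4)).det := by
    refine (Pi.basisFun ℂ (Fin 4)).ext_alternating fun v hv => ?_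
    have hp := F.map_perm (fun i => Pi.single i 1)
      (Equiv.ofBijective v (Finite.injective_iff_bijective.1 hv))
    have hd := (Pi.basisFun ℂ (Fin 4)).det.map_perm (Pi.basisFun ℂ (Fin 4))
      (Equiv.ofBijective v (Finite.injective_iff_bijective.1 hv))
    rw [LinearMap.compAlternatingMap_apply]
    simp only [Pi.basisFun_apply, Function.comp_def, Equiv.ofBijective_apply] at hp hd ⊢
    rw [hp, hd, Module.Basis.det_self, Units.smul_def, Units.smul_def, map_zsmul,
      LinearMap.toSpanSingleton_apply, one_smul]
  have h2 : (Pi.basisFun ℂ (Fin 4)).det (fun i => k.mulVec (Pi.single i 1)) = 1 := by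
    refine (Module.Basis.det_apply _ _).trans (Eq.trans (congrArg Matrix.det ?_) hk)
    ext i j
    simp [Module.Basis.toMatrix_apply]
  rw [h]
  simp only [LinearMap.compAlternatingMap_apply]
  rw [h2, det_single]

/-- The multilinear map with given values on the standard basis. -/
noncomputable def tenMul {N : Type*} [AddCommGroup N] [Module ℂ N]
    (t : Fin 4 → Fin 4 → Fin 4 → Fin 4 → N) : MultilinearMap ℂ (fun _ : Fin 4 => Fin 4 → ℂ) N :=
  ∑ a, ∑ b, ∑ c, ∑ d, ((MultilinearMap.mkPiAlgebra ℂ (Fin 4) ℂ).compLinearMap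
    fun i => LinearMap.proj (![a, b, c, d] i)).smulRight (t a b c d)

theorem tenMul_apply {N : Type*} [AddCommGroup N] [Module ℂ N]
    (t : Fin 4 → Fin 4 → Fin 4 → Fin 4 → N) (w : Fin 4 → Fin 4 → ℂ) : tenMul t w =
      ∑ a, ∑ b, ∑ c, ∑ d, (w 0 a * w 1 b * w 2 c * w 3 d) • t a b c d := by
  simp [tenMul, Fin.prod_univ_four]

/-- The alternating sum is the value on the standard basis of an alternating map, and `φ` replaces
that basis by the columns of `k`. This gives the invariance of the Pfaffian and of the volume
element, where the determinant matters. -/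
theorem map_alternating_sum {N : Type*} [AddCommGroup N] [Module ℂ N]
    (t : Fin 4 → Fin 4 → Fin 4 → Fin 4 → N) (hk : k.det = 1) (φ : N →ₗ[ℂ] N)
    (hφ : ∀ i j m n, φ (t i j m n) =
      ∑ a, ∑ b, ∑ c, ∑ d, (k a i * k b j * k c m * k d n) • t a b c d) :
    φ (∑ σ : Equiv.Perm (Fin 4), Equiv.Perm.sign σ • t (σ 0) (σ 1) (σ 2) (σ 3)) =
      ∑ σ : Equiv.Perm (Fin 4), Equiv.Perm.sign σ • t (σ 0) (σ 1) (σ 2) (σ 3) := by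
  have h := alternating_apply_eq (MultilinearMap.alternatization (tenMul t)) hk
  rw [MultilinearMap.alternatization_apply, MultilinearMap.alternatization_apply] at h
  simp only [MultilinearMap.domDomCongr_apply, tenMul_apply] at h
  have h1 : ∀ i j m n, ∑ a, ∑ b, ∑ c, ∑ d, ((Pi.single i 1 : Fin 4 → ℂ) a *
      (Pi.single j 1 : Fin 4 → ℂ) b * (Pi.single m 1 : Fin 4 → ℂ) c *
      (Pi.single n 1 : Fin 4 → ℂ) d) • t a b c d = t i j m n := by
    intro i j m n
    simp [Pi.single_apply, ite_smul]
  simp only [h1, Matrix.mulVec_single, MulOpposite.op_one, one_smul, Matrix.col_apply, ← hφ] at h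
  refine Eq.trans ?_ h
  rw [map_sum]
  exact Finset.sum_congr rfl fun σ _ => by rw [Units.smul_def, Units.smul_def, map_zsmul]

theorem sum_mul_four (k₁ k₂ k₃ k₄ : Fin 4 → ℂ) (y₁ y₂ y₃ y₄ : Fin 4 → A) :
    (∑ a, k₁ a • y₁ a) * ((∑ b, k₂ b • y₂ b) * ((∑ c, k₃ c • y₃ c) * (∑ d, k₄ d • y₄ d))) =
      ∑ a, ∑ b, ∑ c, ∑ d, (k₁ a * k₂ b * k₃ c * k₄ d) • (y₁ a * (y₂ b * (y₃ c * y₄ d))) := by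
  rw [Finset.sum_mul]
  refine Finset.sum_congr rfl fun a _ => ?_
  rw [Finset.sum_mul, Finset.mul_sum]
  refine Finset.sum_congr rfl fun b _ => ?_
  rw [Finset.sum_mul, Finset.mul_sum, Finset.mul_sum]
  refine Finset.sum_congr rfl fun c _ => ?_
  rw [Finset.mul_sum, Finset.mul_sum, Finset.mul_sum]
  refine Finset.sum_congr rfl fun d _ => ?_
  simp only [smul_mul_assoc, mul_smul_comm, smul_smul]
  congr 1
  ring

theorem sum_mul_two (k₁ k₂ k₃ k₄ : Fin 4 → ℂ) (E F : Fin 4 → Fin 4 → A) :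
    (∑ a, k₁ a • ∑ b, k₂ b • E a b) * (∑ c, k₃ c • ∑ d, k₄ d • F c d) =
      ∑ a, ∑ b, ∑ c, ∑ d, (k₁ a * k₂ b * k₃ c * k₄ d) • (E a b * F c d) := by
  rw [Finset.sum_mul]
  refine Finset.sum_congr rfl fun a _ => ?_
  rw [Finset.smul_sum, Finset.sum_mul]
  refine Finset.sum_congr rfl fun b _ => ?_
  rw [Finset.mul_sum]
  refine Finset.sum_congr rfl fun c _ => ?_
  rw [Finset.smul_sum, Finset.mul_sum]
  refine Finset.sum_congr rfl fun d _ => ?_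
  simp only [smul_mul_assoc, mul_smul_comm, smul_smul]
  congr 1
  ring

end Equivariant

end SO41

/-! ### The invariants in `U(𝔤)` and the generators of the module. -/

namespace SO41

attribute [local instance 100] LieRing.ofAssociativeRing

open PBW

/-- The elements of `U(𝔤)` given by the basis of `𝔭`. -/
noncomputable def PU (i : Fin 4) : U := UniversalEnvelopingAlgebra.ι ℂ (e i : g)

/-- The elements of `U(𝔤)` given by the brackets of the basis of `𝔭`. -/
noncomputable def EU (i j : Fin 4) : U := UniversalEnvelopingAlgebra.ι ℂ ⁅(e i : g), (e j : g)⁆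

theorem isVec_PU (k : K) : IsVec (actU k) (kmat k) PU := by
  intro i
  rw [PU, actU_ι, Ad_e, ← LieHom.coe_toLinearMap, map_sum]
  simp [PU]

theorem isTen_EU (k : K) : IsTen (actU k) (kmat k) EU := by
  intro i j
  rw [EU, actU_ι, LieHom.map_lie, Ad_e, Ad_e, sum_lie, ← LieHom.coe_toLinearMap, map_sum]
  refine Finset.sum_congr rfl fun a _ => ?_
  rw [smul_lie, map_smul, lie_sum, map_sum]
  congr 1
  refine Finset.sum_congr rfl fun b _ => ?_
  rw [lie_smul, map_smul]
  rfl

theorem isVec_cl (k : K) : IsVec (actC k) (kmat k) cl := by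
  intro i
  rw [cl, actC_ι, AdP_e, map_sum]
  simp [cl]

/-- The quadratic, Pfaffian and mixed invariants in `U(𝔤)`. -/
noncomputable def invU : Fin 4 → U :=
  ![(1 / 2 : ℂ) • ∑ i, ∑ j, EU i j * EU i j,
    (1 / 8 : ℂ) • ∑ σ : Equiv.Perm (Fin 4), Equiv.Perm.sign σ • (EU (σ 0) (σ 1) * EU (σ 2) (σ 3)),
    ∑ i, PU i * PU i,
    ∑ i, (∑ j, EU i j * PU j) * (∑ j, EU i j * PU j)]

theorem invU_mem (t : Fin 4) : invU t ∈ UK := by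
  rw [mem_UK]
  intro k
  have hk := kmat_mul_transpose k
  fin_cases t
  · exact (map_smul (actU k) _ _).trans (congrArg _ ((isTen_EU k).normSq hk))
  · refine (map_smul (actU k) _ _).trans (congrArg _ ?_)
    refine map_alternating_sum (fun i j m n => EU i j * EU m n) (kmat_det k)
      (actU k).toLinearMap fun i j m n => ?_
    rw [AlgHom.toLinearMap_apply, map_mul, isTen_EU k i j, isTen_EU k m n]
    exact sum_mul_two _ _ _ _ _ _
  · exact (isVec_PU k).dot hk (isVec_PU k)
  · exact ((isTen_EU k).mulVec hk (isVec_PU k)).dot hk ((isTen_EU k).mulVec hk (isVec_PU k))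

/-- The product of the four generators of `C(𝔭)`. -/
noncomputable def omega : C := cl 0 * (cl 1 * (cl 2 * cl 3))

theorem alternating_cliff {R : Type*} [Ring R] [Algebra ℂ R] {c : Fin 4 → R} (hc : IsCliff c) :
    ∑ σ : Equiv.Perm (Fin 4), Equiv.Perm.sign σ • (c (σ 0) * (c (σ 1) * (c (σ 2) * c (σ 3)))) =
      (24 : ℂ) • (c 0 * (c 1 * (c 2 * c 3))) := by
  rw [sum_perm4 fun i j m n => c i * (c j * (c m * c n))]
  simp only [hc.anti 1 0 (by decide), hc.anti 2 0 (by decide), hc.anti 3 0 (by decide),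
    hc.anti 2 1 (by decide), hc.anti 3 1 (by decide), hc.anti 3 2 (by decide),
    hc.anti_assoc 1 0 (by decide), hc.anti_assoc 2 0 (by decide), hc.anti_assoc 3 0 (by decide),
    hc.anti_assoc 2 1 (by decide), hc.anti_assoc 3 1 (by decide),
    mul_neg, neg_neg]
  module

/-- Since the generators anticommute, `omega` is `1 / 24` of the alternating sum of their products.
-/
theorem actC_omega (k : K) : actC k omega = omega := by
  have h := map_alternating_sum (fun i j m n => cl i * (cl j * (cl m * cl n))) (kmat_det k)
    (actC k).toLinearMap fun i j m n => by
      rw [AlgHom.toLinearMap_apply, map_mul, map_mul, map_mul, isVec_cl k i, isVec_cl k j,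
        isVec_cl k m, isVec_cl k n]
      exact sum_mul_four _ _ _ _ _ _ _ _
  rw [alternating_cliff isCliff_cl, map_smul] at h
  exact smul_right_injective C (by norm_num : (24 : ℂ) ≠ 0) h

theorem omega_cliff {R : Type*} [Ring R] [Algebra ℂ R] {c : Fin 4 → R} (hc : IsCliff c) :
    (c 0 * (c 1 * (c 2 * c 3))) * (c 0 * (c 1 * (c 2 * c 3))) = 16 ∧
    ∀ i, (c 0 * (c 1 * (c 2 * c 3))) * c i = -(c i * (c 0 * (c 1 * (c 2 * c 3)))) := by
  have h : ∀ i, (c 0 * (c 1 * (c 2 * c 3))) * c i = -(c i * (c 0 * (c 1 * (c 2 * c 3)))) := by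
    intro i
    fin_cases i <;>
    simp only [Fin.zero_eta, Fin.mk_one, Fin.reduceFinMk, mul_assoc,
      hc.anti 3 0 (by decide), hc.anti 3 1 (by decide), hc.anti 3 2 (by decide),
      hc.anti_assoc 1 0 (by decide), hc.anti_assoc 2 0 (by decide), hc.anti_assoc 3 0 (by decide),
      hc.anti_assoc 2 1 (by decide), hc.anti_assoc 3 1 (by decide), hc.anti_assoc 3 2 (by decide),
      mul_neg, neg_neg]
  refine ⟨?_, h⟩
  have h2 : ∀ i x, c i * (2 * x) = 2 * (c i * x) := by
    intro i x
    rw [two_mul, two_mul, mul_add]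
  simp only [mul_assoc, hc.sq, hc.sq_assoc, h2, hc.anti_assoc 1 0 (by decide),
    hc.anti_assoc 2 0 (by decide), hc.anti_assoc 3 0 (by decide),
    hc.anti_assoc 2 1 (by decide), hc.anti_assoc 3 1 (by decide), hc.anti_assoc 3 2 (by decide),
    mul_neg, neg_neg]
  norm_num

/-- The generators `1 ⊗ cl i`. -/
noncomputable def cUC (i : Fin 4) : U ⊗[ℂ] C := 1 ⊗ₜ[ℂ] cl i

theorem isVec_cUC (k : K) : IsVec (actUC k) (kmat k) cUC := by
  intro i
  rw [cUC, actUC, Algebra.TensorProduct.map_tmul, map_one, isVec_cl, TensorProduct.tmul_sum]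
  exact Finset.sum_congr rfl fun a _ => TensorProduct.tmul_smul _ _ _

theorem isVec_PUC (k : K) : IsVec (actUC k) (kmat k) fun i => PU i ⊗ₜ[ℂ] (1 : C) := by
  intro i
  rw [actUC, Algebra.TensorProduct.map_tmul, map_one, isVec_PU, TensorProduct.sum_tmul]
  exact Finset.sum_congr rfl fun a _ => TensorProduct.smul_tmul' _ _ _

theorem isTen_EUC (k : K) : IsTen (actUC k) (kmat k) fun i j => EU i j ⊗ₜ[ℂ] (1 : C) := by
  intro i j
  rw [actUC, Algebra.TensorProduct.map_tmul, map_one, isTen_EU, TensorProduct.sum_tmul]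
  refine Finset.sum_congr rfl fun a _ => ?_
  rw [← TensorProduct.smul_tmul', TensorProduct.sum_tmul]
  refine congrArg _ (Finset.sum_congr rfl fun b _ => ?_)
  rw [← TensorProduct.smul_tmul']

/-- The Dirac operator. -/
noncomputable def dirac : U ⊗[ℂ] C := ∑ i, PU i ⊗ₜ[ℂ] (1 : C) * cUC i

/-- The element of `U(𝔤) ⊗ C(𝔭)` given by the spin map of `𝔨`. -/
noncomputable def spin : U ⊗[ℂ] C :=
  (1 / 2 : ℂ) • ∑ i, cUC i * ∑ j, EU i j ⊗ₜ[ℂ] (1 : C) * cUC j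

theorem dirac_mem : dirac ∈ UCK :=
  (mem_UCK _).2 fun k => (isVec_PUC k).dot (kmat_mul_transpose k) (isVec_cUC k)

theorem spin_mem : spin ∈ UCK :=
  (mem_UCK _).2 fun k => (map_smul (actUC k) _ _).trans <| congrArg _ <|
    (isVec_cUC k).dot (kmat_mul_transpose k) ((isTen_EUC k).mulVec (kmat_mul_transpose k)
      (isVec_cUC k))

theorem omega_mem : (1 : U) ⊗ₜ[ℂ] omega ∈ UCK := by
  rw [mem_UCK]
  intro k
  rw [actUC, Algebra.TensorProduct.map_tmul, map_one, actC_omega]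

/-- The words in two elements that give the basis of the covariants. -/
def bwords {R : Type*} [Mul R] [One R] (a b : R) : Fin 8 → R :=
  ![1, b, a * b, b * a, a * b * a, a, b * a * b, a * b * a * b]

/-- The degrees of the words. -/
def bdeg : Fin 8 → ℕ := ![0, 1, 2, 2, 3, 1, 3, 4]

/-- The words in `a`, `b` and their multiples by `w`. -/
def bgens {R : Type*} [Monoid R] (w a b : R) (t : Fin 2 × Fin 8) : R :=
  w ^ (t.1 : ℕ) * bwords a b t.2

theorem bgens_mem (t : Fin 2 × Fin 8) : bgens ((1 : U) ⊗ₜ[ℂ] omega) spin dirac t ∈ UCK := by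
  refine mul_mem (pow_mem omega_mem _) ?_
  have ha := spin_mem
  have hb := dirac_mem
  have hab := mul_mem ha hb
  have hba := mul_mem hb ha
  obtain ⟨-, t⟩ := t
  fin_cases t
  exacts [one_mem _, hb, hab, hba, mul_mem hab ha, ha, mul_mem hba hb, mul_mem (mul_mem hab ha) hb]

end SO41

/-! ### Symbols of the invariants and of the generators. -/

namespace SO41

attribute [local instance 100] LieRing.ofAssociativeRing

open PBW

/-- The coordinates on `𝔭` of a linear form. -/
noncomputable def vv (l : Module.Dual ℂ g) (i : Fin 4) : ℂ := l (e i : g)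

/-- The coordinates on `𝔨` of a linear form. -/
noncomputable def AA (l : Module.Dual ℂ g) (i j : Fin 4) : ℂ := l ⁅(e i : g), (e j : g)⁆

theorem AA_skew (l : Module.Dual ℂ g) (i j : Fin 4) : AA l j i = -AA l i j := by
  rw [AA, ← lie_skew, map_neg, AA]

/-- An element of the filtration together with its symbol. -/
structure HasSymU (n : ℕ) (u : U) (f : Module.Dual ℂ g → ℂ) : Prop where
  mem : u ∈ filt ℂ g n
  eq : ∀ l, sym n l u = f l

namespace HasSymU

variable {m n : ℕ} {u v : U} {f h : Module.Dual ℂ g → ℂ}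

theorem mul (hu : HasSymU m u f) (hv : HasSymU n v h) :
    HasSymU (m + n) (u * v) fun l => f l * h l :=
  ⟨mul_mem_filt hu.mem hv.mem, fun l => by rw [sym_mul l hu.mem hv.mem, hu.eq, hv.eq]⟩

theorem smul (c : ℂ) (hu : HasSymU m u f) : HasSymU m (c • u) fun l => c * f l :=
  ⟨Submodule.smul_mem _ _ hu.mem, fun l => by rw [map_smul, hu.eq, smul_eq_mul]⟩

theorem sum {ι : Type*} (s : Finset ι) {u : ι → U} {f : ι → Module.Dual ℂ g → ℂ}
    (h : ∀ i ∈ s, HasSymU m (u i) (f i)) : HasSymU m (∑ i ∈ s, u i) fun l => ∑ i ∈ s, f i l :=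
  ⟨Submodule.sum_mem _ fun i hi => (h i hi).mem, fun l => by
    rw [map_sum]; exact Finset.sum_congr rfl fun i hi => (h i hi).eq l⟩

theorem one : HasSymU 0 1 fun _ => 1 := ⟨one_mem_filt 0, sym_one⟩

theorem pow (hu : HasSymU m u f) (a : ℕ) : HasSymU (a * m) (u ^ a) fun l => f l ^ a := by
  induction a with
  | zero => simpa using one
  | succ a ih => simpa [pow_succ, add_mul] using ih.mul hu

theorem pu (i : Fin 4) : HasSymU 1 (PU i) fun l => vv l i := ⟨ι_mem_filt _, fun l => sym_ι l _⟩

theorem eu (i j : Fin 4) : HasSymU 1 (EU i j) fun l => AA l i j :=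
  ⟨ι_mem_filt _, fun l => sym_ι l _⟩

end HasSymU

/-- The values of the four invariants at a linear form. -/
noncomputable def inv (l : Module.Dual ℂ g) : Fin 4 → ℂ :=
  ![1 / 2 * ∑ i, ∑ j, AA l i j * AA l i j,
    1 / 8 * ∑ σ : Equiv.Perm (Fin 4), ((Equiv.Perm.sign σ : ℤ) : ℂ) *
      (AA l (σ 0) (σ 1) * AA l (σ 2) (σ 3)),
    ∑ i, vv l i * vv l i,
    ∑ i, (∑ j, AA l i j * vv l j) * (∑ j, AA l i j * vv l j)]

/-- The degrees of the four invariants. -/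
def ideg : Fin 4 → ℕ := ![2, 2, 2, 4]

theorem hasSymU_invU (t : Fin 4) : HasSymU (ideg t) (invU t) fun l => inv l t := by
  have h1 : ∀ i, HasSymU 2 (∑ j, EU i j * PU j) fun l => ∑ j, AA l i j * vv l j := fun i =>
    HasSymU.sum Finset.univ fun j _ => (HasSymU.eu i j).mul (HasSymU.pu j)
  fin_cases t
  · exact HasSymU.smul _ <| HasSymU.sum Finset.univ fun i _ => HasSymU.sum Finset.univ fun j _ =>
      (HasSymU.eu i j).mul (HasSymU.eu i j)
  · refine HasSymU.smul _ <| HasSymU.sum Finset.univ fun σ _ => ?_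
    have h := ((HasSymU.eu (σ 0) (σ 1)).mul (HasSymU.eu (σ 2) (σ 3))).smul
      ((Equiv.Perm.sign σ : ℤ) : ℂ)
    rwa [Int.cast_smul_eq_zsmul, ← Units.smul_def] at h
  · exact HasSymU.sum Finset.univ fun i _ => (HasSymU.pu i).mul (HasSymU.pu i)
  · exact HasSymU.sum Finset.univ fun i _ => (h1 i).mul (h1 i)

/-- An element of the filtration of `U(𝔤) ⊗ C(𝔭)` together with its symbol. -/
structure HasSym (n : ℕ) (z : U ⊗[ℂ] C) (F : Module.Dual ℂ g → C) : Prop where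
  mem : z ∈ tens (filt ℂ g n)
  eq : ∀ l, symC n l z = F l

namespace HasSym

variable {m n : ℕ} {z w : U ⊗[ℂ] C} {F G : Module.Dual ℂ g → C}

theorem mul (hz : HasSym m z F) (hw : HasSym n w G) : HasSym (m + n) (z * w) fun l => F l * G l :=
  ⟨mul_mem_tens hz.mem hw.mem, fun l => by
    rw [← hz.eq, ← hw.eq]; exact symC_mul l hz.mem hw.mem⟩

theorem smul (c : ℂ) (hz : HasSym m z F) : HasSym m (c • z) fun l => c • F l :=
  ⟨Submodule.smul_mem _ _ hz.mem, fun l => by rw [← hz.eq]; exact map_smul _ _ _⟩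

theorem sum {ι : Type*} (s : Finset ι) {z : ι → U ⊗[ℂ] C} {F : ι → Module.Dual ℂ g → C}
    (h : ∀ i ∈ s, HasSym m (z i) (F i)) : HasSym m (∑ i ∈ s, z i) fun l => ∑ i ∈ s, F i l :=
  ⟨Submodule.sum_mem _ fun i hi => (h i hi).mem, fun l =>
    (map_sum (symC m l) z s).trans (Finset.sum_congr rfl fun i hi => (h i hi).eq l)⟩

theorem tmul {u : U} {f : Module.Dual ℂ g → ℂ} (hu : HasSymU n u f) (c : C) :
    HasSym n (u ⊗ₜ[ℂ] c) fun l => f l • c :=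
  ⟨tmul_mem_tens hu.mem c, fun l => by rw [symC_tmul, hu.eq]⟩

theorem one_tmul (c : C) : HasSym 0 ((1 : U) ⊗ₜ[ℂ] c) fun _ => c := by
  simpa using tmul HasSymU.one c

theorem one : HasSym 0 1 fun _ => 1 := one_tmul 1

theorem pow_zero (hz : HasSym 0 z F) (a : ℕ) : HasSym 0 (z ^ a) fun l => F l ^ a := by
  induction a with
  | zero => simpa using one
  | succ a ih => simpa [pow_succ] using! ih.mul hz

end HasSym

/-- The symbol of the Dirac operator. -/
noncomputable def bsym (l : Module.Dual ℂ g) : C := ∑ i, vv l i • cl i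

/-- The symbol of the spin element. -/
noncomputable def asym (l : Module.Dual ℂ g) : C :=
  (1 / 2 : ℂ) • ∑ i, ∑ j, AA l i j • (cl i * cl j)

theorem hasSym_dirac : HasSym 1 dirac bsym := by
  refine HasSym.sum _ fun i _ => ?_
  rw [cUC, Algebra.TensorProduct.tmul_mul_tmul, mul_one, one_mul]
  exact HasSym.tmul (HasSymU.pu i) (cl i)

theorem hasSym_spin : HasSym 1 spin asym := by
  refine HasSym.smul _ <| HasSym.sum _ fun i _ => ?_
  rw [Finset.mul_sum]
  refine HasSym.sum _ fun j _ => ?_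
  rw [cUC, cUC, Algebra.TensorProduct.tmul_mul_tmul, Algebra.TensorProduct.tmul_mul_tmul, mul_one,
    one_mul, one_mul]
  exact HasSym.tmul (HasSymU.eu i j) (cl i * cl j)

theorem hasSym_bgens (t : Fin 2 × Fin 8) :
    HasSym (bdeg t.2) (bgens ((1 : U) ⊗ₜ[ℂ] omega) spin dirac t)
      fun l => bgens omega (asym l) (bsym l) t := by
  obtain ⟨δ, t⟩ := t
  have ha := hasSym_spin
  have hb := hasSym_dirac
  have hab := ha.mul hb
  have hba := hb.mul ha
  have h : HasSym (bdeg t) (bwords spin dirac t) fun l => bwords (asym l) (bsym l) t := by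
    fin_cases t
    exacts [HasSym.one, hb, hab, hba, hab.mul ha, ha, hba.mul hb, (hab.mul ha).mul hb]
  simpa [bgens] using ((HasSym.one_tmul omega).pow_zero (δ : ℕ)).mul h

end SO41

/-! ### Relations between the symbols. -/

namespace SO41

attribute [local instance 100] LieRing.ofAssociativeRing

section Relations

variable {R : Type*} [Ring R] [Algebra ℂ R] {c : Fin 4 → R}

theorem IsCliff.sq_smul (hc : IsCliff c) (i : Fin 4) : c i * c i = (2 : ℂ) • (1 : R) := by
  rw [hc.sq, two_smul, one_add_one_eq_two]

theorem IsCliff.sq_assoc_smul (hc : IsCliff c) (i : Fin 4) (x : R) :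
    c i * (c i * x) = (2 : ℂ) • x := by
  rw [← mul_assoc, hc.sq_smul, smul_mul_assoc, one_mul]

/-- The combination of the generators given by a vector. -/
def clVec (c : Fin 4 → R) (v : Fin 4 → ℂ) : R := ∑ i, v i • c i

/-- The combination of the products of two generators given by the entries above the diagonal. -/
def clMat (c : Fin 4 → R) (A : Fin 4 → Fin 4 → ℂ) : R :=
  A 0 1 • (c 0 * c 1) + A 0 2 • (c 0 * c 2) + A 0 3 • (c 0 * c 3) + A 1 2 • (c 1 * c 2) +
    A 1 3 • (c 1 * c 3) + A 2 3 • (c 2 * c 3)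

/-- The product of the four generators. -/
def clVol (c : Fin 4 → R) : R := c 0 * (c 1 * (c 2 * c 3))

theorem clVec_mul_self (hc : IsCliff c) (v : Fin 4 → ℂ) :
    clVec c v * clVec c v = (2 * ∑ i, v i * v i) • (1 : R) := by
  simp only [clVec, Fin.sum_univ_four, mul_add, add_mul, smul_mul_assoc, mul_smul_comm, smul_smul,
    hc.sq_smul, hc.anti 1 0 (by decide), hc.anti 2 0 (by decide), hc.anti 3 0 (by decide),
    hc.anti 2 1 (by decide), hc.anti 3 1 (by decide), hc.anti 3 2 (by decide)]
  module

theorem clMat_mul_self (hc : IsCliff c) (A : Fin 4 → Fin 4 → ℂ) :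
    clMat c A * clMat c A = (-4 * (A 0 1 ^ 2 + A 0 2 ^ 2 + A 0 3 ^ 2 + A 1 2 ^ 2 + A 1 3 ^ 2 +
      A 2 3 ^ 2)) • (1 : R) + (2 * (A 0 1 * A 2 3 - A 0 2 * A 1 3 + A 0 3 * A 1 2)) • clVol c := by
  simp only [clMat, clVol, mul_add, add_mul, smul_mul_assoc, mul_smul_comm, smul_smul, mul_assoc,
    mul_neg, smul_neg, neg_neg,
    hc.sq_smul, hc.sq_assoc_smul,
    hc.anti 2 1 (by decide), hc.anti 3 1 (by decide), hc.anti 3 2 (by decide),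
    hc.anti_assoc 1 0 (by decide), hc.anti_assoc 2 0 (by decide), hc.anti_assoc 3 0 (by decide),
    hc.anti_assoc 2 1 (by decide), hc.anti_assoc 3 1 (by decide), hc.anti_assoc 3 2 (by decide)]
  module

/-- Bivectors act on Clifford vectors through the orthogonal Lie algebra. The square of this
commutator is how `Av · Av` enters the relations. -/
theorem clMat_commutator (hc : IsCliff c) (A : Fin 4 → Fin 4 → ℂ) (hA : ∀ i j, A j i = -A i j)
    (v : Fin 4 → ℂ) :
    clMat c A * clVec c v - clVec c v * clMat c A =
      (4 : ℂ) • clVec c fun i => ∑ j, A i j * v j := by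
  have h0 : ∀ i, A i i = 0 := fun i => self_eq_neg.1 (hA i i)
  simp only [clMat, clVec, Fin.sum_univ_four, mul_add, add_mul, smul_mul_assoc, mul_smul_comm,
    smul_smul, mul_assoc, h0, hA 0 1, hA 0 2, hA 0 3, hA 1 2, hA 1 3, hA 2 3,
    mul_neg, smul_neg, neg_neg, mul_one,
    hc.sq_smul, hc.sq_assoc_smul, hc.anti 1 0 (by decide), hc.anti 2 0 (by decide),
    hc.anti 3 0 (by decide),
    hc.anti 2 1 (by decide), hc.anti 3 1 (by decide), hc.anti 3 2 (by decide),
    hc.anti_assoc 1 0 (by decide), hc.anti_assoc 2 0 (by decide), hc.anti_assoc 3 0 (by decide),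
    hc.anti_assoc 2 1 (by decide), hc.anti_assoc 3 1 (by decide), hc.anti_assoc 3 2 (by decide)]
  module

/-- The relations between the symbols of the generators of the algebra of covariants. -/
structure Rel (a b w : R) (y : Fin 4 → ℂ) : Prop where
  ww : w * w = (16 : ℂ) • 1
  wa : w * a = a * w
  wb : w * b = -(b * w)
  bb : b * b = (2 * y 2) • 1
  aa : a * a = (-4 * y 0) • 1 + (2 * y 1) • w
  abab : a * b * a * b + b * a * b * a = (32 * y 3 - 16 * y 0 * y 2) • 1

theorem rel_cl (hc : IsCliff c) {A : Fin 4 → Fin 4 → ℂ} (hA : ∀ i j, A j i = -A i j)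
    (v : Fin 4 → ℂ) : Rel (clMat c A) (clVec c v) (clVol c)
      ![A 0 1 ^ 2 + A 0 2 ^ 2 + A 0 3 ^ 2 + A 1 2 ^ 2 + A 1 3 ^ 2 + A 2 3 ^ 2,
        A 0 1 * A 2 3 - A 0 2 * A 1 3 + A 0 3 * A 1 2,
        ∑ i, v i * v i,
        ∑ i, (∑ j, A i j * v j) * (∑ j, A i j * v j)] := by
  have hww : clVol c * clVol c = (16 : ℂ) • (1 : R) := by
    refine (omega_cliff hc).1.trans ?_
    rw [← Algebra.algebraMap_eq_smul_one, map_ofNat]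
  have hw : ∀ i, clVol c * c i = -(c i * clVol c) := (omega_cliff hc).2
  have hw' : ∀ i x, clVol c * (c i * x) = -(c i * (clVol c * x)) := by
    intro i x; rw [← mul_assoc, hw, neg_mul, mul_assoc]
  have hwb : clVol c * clVec c v = -(clVec c v * clVol c) := by
    simp only [clVec, Finset.mul_sum, Finset.sum_mul, ← Finset.sum_neg_distrib]
    exact Finset.sum_congr rfl fun i _ => by
      rw [mul_smul_comm, hw, smul_mul_assoc, smul_neg]
  have hbb := clVec_mul_self hc v
  have haa := clMat_mul_self hc A
  have hab := clMat_commutator hc A hA v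
  have huu := clVec_mul_self hc fun i => ∑ j, A i j * v j
  refine ⟨hww, ?_, hwb, hbb, haa, ?_⟩
  · simp only [clMat, mul_add, add_mul, mul_smul_comm, smul_mul_assoc, hw', hw, mul_neg, neg_neg,
      mul_assoc]
  · have h1 : (clMat c A * clVec c v - clVec c v * clMat c A) *
        (clMat c A * clVec c v - clVec c v * clMat c A) =
        (32 * ∑ i, (∑ j, A i j * v j) * (∑ j, A i j * v j)) • (1 : R) := by
      rw [hab, smul_mul_smul_comm, huu, smul_smul]
      congr 1
      ring
    generalize clMat c A = a at *
    generalize clVec c v = b at *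
    generalize clVol c = w at *
    simp only [Matrix.cons_val]
    have h2 : a * (b * b) * a = (2 * ∑ i, v i * v i) • (a * a) := by
      rw [hbb, mul_smul_comm, mul_one, smul_mul_assoc]
    have h3 : b * (a * a) * b = (2 * ∑ i, v i * v i) • (-4 * (A 0 1 ^ 2 + A 0 2 ^ 2 + A 0 3 ^ 2 +
        A 1 2 ^ 2 + A 1 3 ^ 2 + A 2 3 ^ 2)) • (1 : R) -
        (2 * ∑ i, v i * v i) • (2 * (A 0 1 * A 2 3 - A 0 2 * A 1 3 + A 0 3 * A 1 2)) • w := by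
      rw [haa, mul_add, add_mul, mul_smul_comm, mul_one, mul_smul_comm, smul_mul_assoc,
        smul_mul_assoc, mul_assoc, hwb, mul_neg, ← mul_assoc, hbb, smul_mul_assoc, one_mul]
      module
    -- The anticommutator of `a` and `bab` is split into `[a, b]²`, a scalar by `hab` and `huu`, and
    -- two terms with `b²` or `a²` in the middle. Their `w` parts cancel because `w` anticommutes
    -- with `b`.
    have h4 : a * b * a * b + b * a * b * a =
        (a * b - b * a) * (a * b - b * a) + a * (b * b) * a + b * (a * a) * b := by
      noncomm_ring
    rw [h4, h1, h2, h3, haa]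
    module

end Relations

end SO41

/-! ### Pointwise independence of the sixteen covariants. -/

namespace SO41

attribute [local instance 100] LieRing.ofAssociativeRing

section Independence

variable {R : Type*} [Ring R] [Algebra ℂ R]

/-- After multiplication by `u`, the elements `a` and `b` satisfy the relations of the Clifford
algebra of a binary form with values `A`, `B` and polarization `q`. Nondegeneracy, `q ^ 2 ≠ 4AB`,
makes it a quaternion algebra, so a dependency among `1, a, b, ab` would kill `u`. -/
theorem quaternion_independent {u a b : R} {A B q : ℂ} (hu : u ≠ 0) (ha : a * u = u * a)
    (hb : b * u = u * b) (haa : u * (a * a) = A • u) (hbb : u * (b * b) = B • u)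
    (hab : u * (a * b + b * a) = q • u) (hA : A ≠ 0) (hq : q ^ 2 - 4 * A * B ≠ 0)
    {n₀ n₁ n₂ n₃ : ℂ}
    (h : n₀ • u + n₁ • (u * a) + n₂ • (u * b) + n₃ • (u * a * b) = 0) :
    n₀ = 0 ∧ n₁ = 0 ∧ n₂ = 0 ∧ n₃ = 0 := by
  have e1 : u * a * a = A • u := by rw [mul_assoc, haa]
  have e2 : u * b * b = B • u := by rw [mul_assoc, hbb]
  have e3 : u * b * a = q • u - u * a * b := by rw [← hab]; noncomm_ring
  have e4 : u * a * b * a = q • (u * a) - A • (u * b) := by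
    rw [← ha, mul_assoc a, mul_assoc a, e3, mul_sub, mul_smul_comm, ← mul_assoc a, ← mul_assoc a,
      ha, e1, smul_mul_assoc]
  have e5 : u * a * b * b = B • (u * a) := by
    rw [← ha, mul_assoc a, mul_assoc a, e2, mul_smul_comm]
  have e6 : b * (u * a) = q • u - u * a * b := by rw [← mul_assoc, hb, e3]
  have e7 : a * (u * a) = A • u := by rw [← mul_assoc, ha, e1]
  have e8 : a * (u * b) = u * a * b := by rw [← mul_assoc, ha]
  have e9 : b * (u * b) = B • u := by rw [← mul_assoc, hb, e2]
  have e10 : a * (u * a * b) = A • (u * b) := by rw [← mul_assoc, e7, smul_mul_assoc]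
  have e11 : b * (u * a * b) = q • (u * b) - B • (u * a) := by
    rw [← mul_assoc, e6, sub_mul, smul_mul_assoc, e5]
  have z : ∀ r : ℂ, r • u = 0 → r = 0 := fun r hr => (smul_eq_zero.1 hr).resolve_right hu
  have h1 := congrArg (a * ·) h
  have h2 := congrArg (· * a) h
  have h3 := congrArg (b * ·) h
  have h4 := congrArg (· * b) h
  simp only [mul_add, add_mul, mul_smul_comm, smul_mul_assoc, e1, e2, e3, e4, e5, e6, e7, e8, e9,
    e10, e11, ha, hb, mul_zero, zero_mul] at h1 h2 h3 h4
  set s := 2 * n₀ + n₃ * q with hs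
  set p := 2 * n₁ * A + n₂ * q with hp
  set p' := n₁ * q + 2 * n₂ * B with hp'
  -- The anticommutator of the relation with `a`, in which the `b` and `ab` terms cancel; `k2` is
  -- the same with `b`.
  have k1 : p • u + s • (u * a) = 0 := by
    rw [← add_zero (0 : R)]
    nth_rewrite 1 [← h1]
    rw [← h2]
    module
  have k2 : p' • u + s • (u * b) = 0 := by
    rw [← add_zero (0 : R)]
    nth_rewrite 1 [← h3]
    rw [← h4]
    module
  have k3 := congrArg (· * a) k1
  have k4 := congrArg (· * b) k2
  have k5 := congrArg (· * b) k1
  have k6 := congrArg (b * ·) k1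
  simp only [mul_add, add_mul, mul_smul_comm, smul_mul_assoc, e1, e2, e6, hb, mul_zero,
    zero_mul] at k3 k4 k5 k6
  have t1 : s ^ 2 * A - p ^ 2 = 0 := z _ <| by
    have := congrArg₂ (fun x y => s • x - p • y) k3 k1
    simp only [smul_zero, sub_zero] at this
    rw [← this]
    module
  have t2 : s ^ 2 * B - p' ^ 2 = 0 := z _ <| by
    have := congrArg₂ (fun x y => s • x - p' • y) k4 k2
    simp only [smul_zero, sub_zero] at this
    rw [← this]
    module
  have t3 : s ^ 2 * q - 2 * p * p' = 0 := z _ <| by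
    have := congrArg₂ (fun x y => s • x - (2 * p) • y) (congrArg₂ (· + ·) k5 k6) k2
    simp only [smul_zero, sub_zero, add_zero] at this
    rw [← this]
    module
  have hs0 : s = 0 := by
    -- Eliminate `p` and `p'`: the product of `s² A = p²` and `s² B = p'²` is compared with the
    -- square of `s² q = 2 p p'`.
    have : s ^ 4 * (q ^ 2 - 4 * A * B) = 0 := by
      linear_combination (s ^ 2 * q + 2 * p * p') * t3 - 4 * p' ^ 2 * t1 - 4 * s ^ 2 * A * t2
    exact pow_eq_zero_iff (by norm_num) |>.1 ((mul_eq_zero.1 this).resolve_right hq)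
  have hp0 : p = 0 := by
    rw [hs0] at t1
    exact pow_eq_zero_iff (n := 2) (by norm_num) |>.1 (by linear_combination -t1)
  have hp'0 : p' = 0 := by
    rw [hs0] at t2
    exact pow_eq_zero_iff (n := 2) (by norm_num) |>.1 (by linear_combination -t2)
  have hn2 : n₂ = 0 := by
    have : n₂ * (q ^ 2 - 4 * A * B) = 0 := by linear_combination q * hp0 - 2 * A * hp'0 - q * hp +
        2 * A * hp'
    exact (mul_eq_zero.1 this).resolve_right hq
  have hn1 : n₁ = 0 := by
    have : n₁ * A = 0 := by rw [hn2] at hp; linear_combination (hp0 - hp) / 2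
    exact (mul_eq_zero.1 this).resolve_right hA
  -- With `n₁ = n₂ = 0`, a nonzero `n₃` makes `ab` act on `u` as the scalar `q / 2`, which forces
  -- `AB = q² / 4`.
  have hn3 : n₃ = 0 := by
    by_contra hne
    have hn0 : n₀ = -(n₃ * q / 2) := by linear_combination (hs0 - hs) / 2
    have k7 : u * a * b = (q / 2) • u := by
      refine smul_right_injective R hne ?_
      dsimp only
      rw [hn0, hn1, hn2] at h
      rw [← sub_eq_zero, ← h]
      module
    have k8 : A • (u * b) = (q / 2) • (u * a) := by
      rw [← e10, k7, mul_smul_comm, ha]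
    have k9 : (A * B) • u = (q / 2 * (q / 2)) • u := by
      have := congrArg (· * b) k8
      simpa only [smul_mul_assoc, e2, k7, smul_smul] using this
    have := z _ (sub_eq_zero.2 k9 |> (sub_smul _ _ _).trans)
    exact hq (by linear_combination -4 * this)
  refine ⟨?_, hn1, hn2, hn3⟩
  rw [hn3] at hs
  linear_combination (hs0 - hs) / 2

/-- The polynomial whose non-vanishing implies the independence of the covariants. -/
def disc (y : Fin 4 → ℂ) : ℂ :=
  (y 3 * y 2 * y 0 - y 3 ^ 2 - y 1 ^ 2 * y 2 ^ 2) * (y 0 ^ 2 - 4 * y 1 ^ 2)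

namespace Rel

variable {a b w : R} {y : Fin 4 → ℂ} (hr : Rel a b w y) (hy : disc y ≠ 0)

include hr

theorem bab_mul_self : b * a * b * (b * a * b) =
    (4 * y 2 ^ 2) • ((-4 * y 0) • 1 - (2 * y 1) • w) := by
  calc b * a * b * (b * a * b) = b * (a * (b * b) * a) * b := by noncomm_ring
    _ = (2 * y 2) • (b * (a * a) * b) := by
      rw [hr.bb, mul_smul_comm, mul_one, smul_mul_assoc, mul_smul_comm, smul_mul_assoc]
    _ = (2 * y 2) • ((-4 * y 0) • (b * b) - (2 * y 1) • (w * (b * b))) := by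
      rw [hr.aa, mul_add, add_mul, mul_smul_comm, mul_smul_comm, mul_one, smul_mul_assoc,
        smul_mul_assoc, ← neg_eq_iff_eq_neg.2 hr.wb, neg_mul (w * b), mul_assoc, smul_neg,
            sub_eq_add_neg]
    _ = _ := by
      rw [hr.bb, mul_smul_comm, mul_one]
      module

theorem wbab : b * a * b * w = w * (b * a * b) := by
  have h1 : b * w = -(w * b) := by rw [hr.wb, neg_neg]
  rw [mul_assoc, h1, mul_neg, ← mul_assoc, mul_assoc b, ← hr.wa, ← mul_assoc, h1]
  noncomm_ring

include hy

theorem ne_zero [Nontrivial R] : b ≠ 0 := by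
  intro h
  have h1 := hr.bb
  have h2 := hr.abab
  simp only [h, mul_zero, zero_mul, add_zero] at h1 h2
  have h3 := (smul_eq_zero.1 h1.symm).resolve_right one_ne_zero
  have h4 := (smul_eq_zero.1 h2.symm).resolve_right one_ne_zero
  have h5 : y 2 = 0 := by linear_combination h3 / 2
  have h6 : y 3 = 0 := by rw [h5] at h4; linear_combination h4 / 32
  exact hy (by rw [disc, h5, h6]; ring)

/-- Multiplication by `4 + t w` with `t = ±1` replaces `w` by the scalar `4t`, since `w² = 16`. What
remains is a relation among `1, a, bab, abab`, to which `quaternion_independent` applies with `bab`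
as second generator. The first factor of `disc` is, up to a constant, the discriminant, and the
second makes the square of `a` nonzero for both signs. -/
theorem even_independent [Nontrivial R] {x z : Fin 4 → ℂ}
    (h : (x 0 • 1 + x 1 • a + x 2 • (b * a * b) + x 3 • (a * b * a * b)) +
      w * (z 0 • 1 + z 1 • a + z 2 • (b * a * b) + z 3 • (a * b * a * b)) = 0) :
    x = 0 ∧ z = 0 := by
  have key : ∀ t : ℂ, t * t = 1 → ∀ i, x i + 4 * t * z i = 0 := by
    intro t ht
    -- If `t w` were `-4`, then `w` could not anticommute with `b`, which is nonzero.
    have hu : (4 : ℂ) • (1 : R) + t • w ≠ 0 := by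
      intro h0
      have h1 := congrArg (· * b) h0
      have h2 := congrArg (b * ·) h0
      simp only [add_mul, mul_add, smul_mul_assoc, mul_smul_comm, one_mul, mul_one, mul_zero,
        zero_mul, hr.wb] at h1 h2
      have h3 : (8 : ℂ) • b = 0 := by
        rw [← add_zero (0 : R)]
        nth_rewrite 1 [← h1]
        rw [← h2]
        module
      exact hr.ne_zero hy ((smul_eq_zero.1 h3).resolve_left (by norm_num))
    have huw : ((4 : ℂ) • (1 : R) + t • w) * w = (4 * t) • ((4 : ℂ) • (1 : R) + t • w) := by
      rw [add_mul, smul_mul_assoc, smul_mul_assoc, hr.ww, one_mul, smul_add, smul_smul, smul_smul,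
        smul_smul, mul_assoc 4 t t, ht, mul_one]
      module
    have hy1 : y 0 ^ 2 - 4 * y 1 ^ 2 ≠ 0 := right_ne_zero_of_mul hy
    have hy2 := left_ne_zero_of_mul hy
    have h1 := congrArg (((4 : ℂ) • (1 : R) + t • w) * ·) h
    rw [mul_add, ← mul_assoc _ w, huw, mul_zero] at h1
    have hua : a * ((4 : ℂ) • (1 : R) + t • w) = ((4 : ℂ) • (1 : R) + t • w) * a := by
      simp only [mul_add, add_mul, mul_smul_comm, smul_mul_assoc, one_mul, mul_one, hr.wa]
    have hub : b * a * b * ((4 : ℂ) • (1 : R) + t • w) =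
        ((4 : ℂ) • (1 : R) + t • w) * (b * a * b) := by
      simp only [mul_add, add_mul, mul_smul_comm, smul_mul_assoc, one_mul, mul_one, hr.wbab]
    generalize (4 : ℂ) • (1 : R) + t • w = u at *
    have h2 := quaternion_independent (n₀ := x 0 + 4 * t * z 0) (n₁ := x 1 + 4 * t * z 1)
      (n₂ := x 2 + 4 * t * z 2) (n₃ := x 3 + 4 * t * z 3) (A := -4 * y 0 + 8 * t * y 1)
      (B := 4 * y 2 ^ 2 * (-4 * y 0 - 8 * t * y 1)) (q := 32 * y 3 - 16 * y 0 * y 2) hu hua hub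
      (by rw [hr.aa, mul_add, mul_smul_comm, mul_smul_comm, huw, mul_one]; module)
      (by rw [hr.bab_mul_self, mul_smul_comm, mul_sub, mul_smul_comm, mul_smul_comm, huw, mul_one]
          module)
      (by
        have h3 : a * (b * a * b) + b * a * b * a = a * b * a * b + b * a * b * a := by
          simp only [mul_assoc]
        rw [h3, hr.abab, mul_smul_comm, mul_one])
      (by
        intro h0
        exact hy1 (by linear_combination (y 0 + 2 * t * y 1) * (-1 / 4) * h0 + 4 * y 1 ^ 2 * ht))
      (by
        intro h0
        exact hy2 (by linear_combination (-1 / 1024) * h0 + y 1 ^ 2 * y 2 ^ 2 * ht))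
      (by
        rw [← h1]
        simp only [mul_add, mul_smul_comm, smul_mul_assoc, mul_assoc, mul_one]
        module)
    intro i
    fin_cases i
    exacts [h2.1, h2.2.1, h2.2.2.1, h2.2.2.2]
  have k1 := key 1 (by norm_num)
  have k2 := key (-1) (by norm_num)
  constructor <;> funext i
  · simp only [Pi.zero_apply]
    linear_combination (k1 i + k2 i) / 2
  · simp only [Pi.zero_apply]
    linear_combination (k1 i - k2 i) / 8

/-- Right multiplication by an odd element reduces to the even case. If `y 2 ≠ 0`, that element is
`b`, whose square is a nonzero scalar. If `y 2 = 0`, then `b² = 0` and the commutator `ab - ba`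
replaces it; `disc ≠ 0` then gives `y 3 ≠ 0`. This degenerate case is needed to divide by `y 2`
later. -/
theorem odd_independent [Nontrivial R] {x z : Fin 4 → ℂ}
    (h : (x 0 • b + x 1 • (a * b) + x 2 • (b * a) + x 3 • (a * b * a)) +
      w * (z 0 • b + z 1 • (a * b) + z 2 • (b * a) + z 3 • (a * b * a)) = 0) :
    x = 0 ∧ z = 0 := by
  by_cases hd : y 2 = 0
  · have hr0 : y 3 ≠ 0 := by
      intro h0
      exact hy (by rw [disc, hd, h0]; ring)
    have hbb : b * b = 0 := by rw [hr.bb, hd, mul_zero, zero_smul]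
    have hbaba : b * a * b * a = (32 * y 3) • 1 - a * b * a * b := by
      have := hr.abab
      rw [hd] at this
      rw [eq_sub_iff_add_eq', this]
      congr 1
      ring
    have s0 : b * (a * b - b * a) = b * a * b := by
      rw [mul_sub, ← mul_assoc b b, hbb]; noncomm_ring
    have s1 : a * b * (a * b - b * a) = a * b * a * b := by
      rw [mul_assoc, s0]; noncomm_ring
    have hbaab : b * a * (a * b) = 0 := by
      calc b * a * (a * b) = b * (a * a) * b := by noncomm_ring
        _ = 0 := by
          rw [hr.aa, mul_add, add_mul, mul_smul_comm, mul_smul_comm, mul_one, smul_mul_assoc,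
            smul_mul_assoc, mul_assoc, hr.wb, mul_neg, ← mul_assoc, hbb]
          simp
    have s2 : b * a * (a * b - b * a) = a * b * a * b - (32 * y 3) • 1 := by
      rw [mul_sub, hbaab, ← mul_assoc, hbaba]; noncomm_ring
    have s3 : a * b * a * (a * b - b * a) = (-4 * y 0) • (b * a * b) +
        w * ((2 * y 1) • (b * a * b)) - (32 * y 3) • a := by
      rw [mul_assoc a, mul_assoc a, s2, mul_sub, mul_smul_comm, mul_one]
      congr 1
      calc a * (a * b * a * b) = a * a * (b * a * b) := by noncomm_ring
        _ = _ := by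
          rw [hr.aa, add_mul, smul_mul_assoc, smul_mul_assoc, one_mul, mul_smul_comm]
    have h1 := congrArg (· * (a * b - b * a)) h
    rw [add_mul, mul_assoc w] at h1
    simp only [add_mul, smul_mul_assoc, s0, s1, s2, s3, zero_mul] at h1
    have h2 := hr.even_independent hy
      -- Coefficients of the products `s0` to `s3`. The `w` term of `s3` mixes `x` and `z`, and `32
      -- = 2 · 16` comes from `w² = 16`.
      (x := ![-32 * y 3 * x 2, -32 * y 3 * x 3, x 0 - 4 * y 0 * x 3 + 32 * y 1 * z 3, x 1 + x 2])
      (z := ![-32 * y 3 * z 2, -32 * y 3 * z 3, z 0 - 4 * y 0 * z 3 + 2 * y 1 * x 3, z 1 + z 2]) (by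
        rw [← h1]
        simp only [Matrix.cons_val, mul_add, mul_sub, mul_smul_comm, ← mul_assoc w w, hr.ww,
            mul_one,
          smul_mul_assoc, one_mul]
        module)
    have q0 := congrFun h2.1
    have q1 := congrFun h2.2
    have hr1 : -32 * y 3 ≠ 0 := mul_ne_zero (by norm_num) hr0
    have x2 := (mul_eq_zero.1 (q0 0)).resolve_left hr1
    have x3 := (mul_eq_zero.1 (q0 1)).resolve_left hr1
    have z2 := (mul_eq_zero.1 (q1 0)).resolve_left hr1
    have z3 := (mul_eq_zero.1 (q1 1)).resolve_left hr1
    have x0 := q0 2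
    have z0 := q1 2
    have x1 := q0 3
    have z1 := q1 3
    simp only [Matrix.cons_val, Pi.zero_apply, x2, x3, z2, z3, mul_zero, sub_zero, add_zero]
        at x0 x1 z0 z1
    constructor <;> funext i <;> fin_cases i <;> assumption
  · have h1 := congrArg (· * b) h
    rw [add_mul, mul_assoc w] at h1
    have s1 : a * b * b = (2 * y 2) • a := by rw [mul_assoc, hr.bb, mul_smul_comm, mul_one]
    simp only [add_mul, smul_mul_assoc, hr.bb, s1, zero_mul] at h1
    have h2 := hr.even_independent hy
      (x := ![2 * y 2 * x 0, 2 * y 2 * x 1, x 2, x 3])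
      (z := ![2 * y 2 * z 0, 2 * y 2 * z 1, z 2, z 3]) (by
        rw [← h1]
        simp only [Matrix.cons_val, mul_add, mul_smul_comm]
        module)
    have q0 := congrFun h2.1
    have q1 := congrFun h2.2
    have hd1 : 2 * y 2 ≠ 0 := mul_ne_zero (by norm_num) hd
    have x0 := (mul_eq_zero.1 (q0 0)).resolve_left hd1
    have x1 := (mul_eq_zero.1 (q0 1)).resolve_left hd1
    have z0 := (mul_eq_zero.1 (q1 0)).resolve_left hd1
    have z1 := (mul_eq_zero.1 (q1 1)).resolve_left hd1
    have x2 := q0 2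
    have x3 := q0 3
    have z2 := q1 2
    have z3 := q1 3
    constructor <;> funext i <;> fin_cases i <;> assumption

/-- Since `w` commutes with `a`, anticommutes with `b` and is invertible, it separates the words
with an even number of factors `b` from those with an odd number. -/
theorem linearIndependent [Nontrivial R] : LinearIndependent ℂ (bgens w a b) := by
  rw [Fintype.linearIndependent_iff]
  intro n hn
  simp only [Fintype.sum_prod_type, Fin.sum_univ_two, Fin.sum_univ_eight, bgens, bwords,
    Fin.val_zero, Fin.val_one, pow_zero, pow_one, one_mul, Matrix.cons_val, mul_one] at hn
  set X := (n (0, 0) • 1 + n (0, 5) • a + n (0, 6) • (b * a * b) + n (0, 7) • (a * b * a * b)) +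
      w * (n (1, 0) • 1 + n (1, 5) • a + n (1, 6) • (b * a * b) + n (1, 7) •
          (a * b * a * b)) with hX
  set Y := (n (0, 1) • b + n (0, 2) • (a * b) + n (0, 3) • (b * a) + n (0, 4) • (a * b * a)) +
      w * (n (1, 1) • b + n (1, 2) • (a * b) + n (1, 3) • (b * a) + n (1, 4) • (a * b * a)) with hY
  have hXY : X + Y = 0 := by
    rw [← hn, hX, hY]
    simp only [mul_add, mul_smul_comm, mul_one]
    module
  have hb : ∀ z : R, w * (b * z) = -(b * (w * z)) := by
    intro z; rw [← mul_assoc, hr.wb, neg_mul, mul_assoc]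
  have ha : ∀ z : R, w * (a * z) = a * (w * z) := by
    intro z; rw [← mul_assoc, hr.wa, mul_assoc]
  have hXw : w * X = X * w := by
    simp only [hX, mul_add, add_mul, mul_smul_comm, smul_mul_assoc, mul_assoc, hr.wb, hr.wa, ha, hb,
      mul_neg, neg_neg, mul_one, one_mul]
  have hYw : w * Y = -(Y * w) := by
    simp only [hY, mul_add, add_mul, mul_smul_comm, smul_mul_assoc, mul_assoc, hr.wb, hr.wa, ha, hb,
      mul_neg, neg_neg, neg_add, smul_neg, neg_mul]
  clear_value X Y
  have hX0 : X = 0 := by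
    have h1 : w * (X + Y) + (X + Y) * w = 0 := by rw [hXY]; simp
    have h2 : (2 : ℂ) • (w * X) = 0 := by
      rw [← h1, mul_add, add_mul, hYw, ← hXw]
      module
    have h3 := congrArg (w * ·) ((smul_eq_zero.1 h2).resolve_left (by norm_num))
    rw [← mul_assoc, hr.ww, smul_mul_assoc, one_mul, mul_zero] at h3
    exact (smul_eq_zero.1 h3).resolve_left (by norm_num)
  have hY0 : Y = 0 := by rw [hX0, zero_add] at hXY; exact hXY
  have kx := hr.even_independent hy (x := fun i => n (0, ![0, 5, 6, 7] i))
    (z := fun i => n (1, ![0, 5, 6, 7] i)) (hX.symm.trans hX0)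
  have ky := hr.odd_independent hy (x := fun i => n (0, ![1, 2, 3, 4] i))
    (z := fun i => n (1, ![1, 2, 3, 4] i)) (hY.symm.trans hY0)
  rintro ⟨δ, t⟩
  fin_cases δ <;> fin_cases t
  exacts [congrFun kx.1 0, congrFun ky.1 0, congrFun ky.1 1, congrFun ky.1 2, congrFun ky.1 3,
    congrFun kx.1 1, congrFun kx.1 2, congrFun kx.1 3, congrFun kx.2 0, congrFun ky.2 0,
    congrFun ky.2 1, congrFun ky.2 2, congrFun ky.2 3, congrFun kx.2 1, congrFun kx.2 2,
    congrFun kx.2 3]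

end Rel

end Independence

end SO41

/-! ### Linear forms as pairs of a vector and a skew matrix, and the slice. -/

namespace SO41

attribute [local instance 100] LieRing.ofAssociativeRing

open PBW

theorem bsym_eq (l : Module.Dual ℂ g) : bsym l = clVec cl (vv l) := rfl

theorem asym_eq (l : Module.Dual ℂ g) : asym l = clMat cl (AA l) := by
  have hc := isCliff_cl
  have h0 : ∀ i, AA l i i = 0 := fun i => self_eq_neg.1 (AA_skew l i i)
  simp only [asym, clMat, Fin.sum_univ_four, h0, AA_skew l 0 1, AA_skew l 0 2, AA_skew l 0 3,
    AA_skew l 1 2, AA_skew l 1 3, AA_skew l 2 3, hc.anti 1 0 (by decide), hc.anti 2 0 (by decide),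
    hc.anti 3 0 (by decide), hc.anti 2 1 (by decide), hc.anti 3 1 (by decide),
    hc.anti 3 2 (by decide)]
  module

theorem inv_eq (l : Module.Dual ℂ g) : inv l =
    ![AA l 0 1 ^ 2 + AA l 0 2 ^ 2 + AA l 0 3 ^ 2 + AA l 1 2 ^ 2 + AA l 1 3 ^ 2 + AA l 2 3 ^ 2,
      AA l 0 1 * AA l 2 3 - AA l 0 2 * AA l 1 3 + AA l 0 3 * AA l 1 2,
      ∑ i, vv l i * vv l i,
      ∑ i, (∑ j, AA l i j * vv l j) * (∑ j, AA l i j * vv l j)] := by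
  have h0 : ∀ i, AA l i i = 0 := fun i => self_eq_neg.1 (AA_skew l i i)
  have h1 := sum_perm4 fun i j m n => AA l i j * AA l m n
  simp only [Units.smul_def, ← Int.cast_smul_eq_zsmul ℂ, smul_eq_mul] at h1
  rw [inv, h1]
  congr 1
  · simp only [Fin.sum_univ_four, h0, AA_skew l 0 1, AA_skew l 0 2, AA_skew l 0 3,
      AA_skew l 1 2, AA_skew l 1 3, AA_skew l 2 3]
    ring
  · congr 1
    simp only [AA_skew l 0 1, AA_skew l 0 2, AA_skew l 0 3, AA_skew l 1 2, AA_skew l 1 3,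
      AA_skew l 2 3]
    ring

/-- The symbols of the generators of the algebra of covariants. -/
noncomputable def gen (t : Fin 2 × Fin 8) (l : Module.Dual ℂ g) : C :=
  bgens omega (asym l) (bsym l) t

theorem rel_sym (l : Module.Dual ℂ g) : Rel (asym l) (bsym l) omega (inv l) := by
  rw [asym_eq, bsym_eq, inv_eq]
  exact rel_cl isCliff_cl (AA_skew l) (vv l)

theorem nontrivial_C : Nontrivial C :=
  ⟨⟨cbasis (0, 0, 0, 0), 0, cbasis.ne_zero _⟩⟩

theorem linearIndependent_gen {l : Module.Dual ℂ g} (h : disc (inv l) ≠ 0) :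
    LinearIndependent ℂ fun t => gen t l :=
  have := nontrivial_C
  (rel_sym l).linearIndependent h

/-- Inherited from the `K`-invariance in `U(𝔤)`, as `inv` consists of symbols. -/
theorem inv_coad (k : K) (l : Module.Dual ℂ g) : inv (coad k l) = inv l := by
  funext t
  rw [← (hasSymU_invU t).eq, ← (hasSymU_invU t).eq, ← sym_actU k l (hasSymU_invU t).mem,
    (mem_UK _).1 (invU_mem t)]

theorem inv_smul (c : ℂ) (l : Module.Dual ℂ g) (t : Fin 4) :
    inv (c • l) t = c ^ ideg t * inv l t := by
  rw [← (hasSymU_invU t).eq, ← (hasSymU_invU t).eq, sym_smul c l (hasSymU_invU t).mem]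

theorem inv_mem_Pol (t : Fin 4) : (fun l => inv l t) ∈ Pol := by
  simp only [← (hasSymU_invU t).eq]
  exact sym_mem_Pol (hasSymU_invU t).mem

theorem eval_inv_mem_Pol (P : MvPolynomial (Fin 4) ℂ) :
    (fun l => MvPolynomial.eval (inv l) P) ∈ Pol := by
  induction P using MvPolynomial.induction_on with
  | C a =>
    simp only [MvPolynomial.eval_C]
    exact Pol.algebraMap_mem a
  | add p q hp hq =>
    simp only [map_add]
    exact add_mem hp hq
  | mul_X p t hp =>
    simp only [map_mul, MvPolynomial.eval_X]
    exact mul_mem hp (inv_mem_Pol t)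

theorem gen_coad (t : Fin 2 × Fin 8) (k : K) (l : Module.Dual ℂ g) :
    actC k (gen t (coad k l)) = gen t l := by
  have h := hasSym_bgens t
  have h1 := symC_actUC k l h.mem
  rw [(mem_UCK _).1 (bgens_mem t) k, h.eq, h.eq] at h1
  exact h1.symm

theorem gen_smul (t : Fin 2 × Fin 8) (c : ℂ) (l : Module.Dual ℂ g) :
    gen t (c • l) = c ^ bdeg t.2 • gen t l := by
  have h := hasSym_bgens t
  have h1 := symC_smul c l h.mem
  rw [h.eq, h.eq] at h1
  exact h1

theorem gen_mem_Pol (t : Fin 2 × Fin 8) (φ : C →ₗ[ℂ] ℂ) : (fun l => φ (gen t l)) ∈ Pol := by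
  have h := hasSym_bgens t
  have h1 := symC_mem_Pol h.mem φ
  simp only [h.eq] at h1
  exact h1

/-- The linear form with given coordinates on `𝔭` and `𝔨`. -/
noncomputable def form (v : Fin 4 → ℂ) (A : Fin 4 → Fin 4 → ℂ) : Module.Dual ℂ g :=
  ofCoords ![v 0, v 1, v 2, v 3, A 0 1, A 0 2, A 0 3, A 1 2, A 1 3, A 2 3]

theorem vv_form (v : Fin 4 → ℂ) (A : Fin 4 → Fin 4 → ℂ) : vv (form v A) = v := by
  have h := ofCoords_gbasis ![v 0, v 1, v 2, v 3, A 0 1, A 0 2, A 0 3, A 1 2, A 1 3, A 2 3]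
  simp only [gbasis_apply] at h
  funext i
  fin_cases i
  exacts [h 0, h 1, h 2, h 3]

theorem AA_form (v : Fin 4 → ℂ) {A : Fin 4 → Fin 4 → ℂ} (hA : ∀ i j, A j i = -A i j) :
    AA (form v A) = A := by
  have h := ofCoords_gbasis ![v 0, v 1, v 2, v 3, A 0 1, A 0 2, A 0 3, A 1 2, A 1 3, A 2 3]
  simp only [gbasis_apply] at h
  have h0 : ∀ {A : Fin 4 → Fin 4 → ℂ}, (∀ i j, A j i = -A i j) → ∀ i, A i i = 0 :=
    fun hA i => self_eq_neg.1 (hA i i)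
  have hA' := AA_skew (form v A)
  have h1 : AA (form v A) 0 1 = A 0 1 := h 4
  have h2 : AA (form v A) 0 2 = A 0 2 := h 5
  have h3 : AA (form v A) 0 3 = A 0 3 := h 6
  have h4 : AA (form v A) 1 2 = A 1 2 := h 7
  have h5 : AA (form v A) 1 3 = A 1 3 := h 8
  have h6 : AA (form v A) 2 3 = A 2 3 := h 9
  have h7 : ∀ i j, AA (form v A) i j = A i j → AA (form v A) j i = A j i := fun i j h => by
    rw [hA' i j, hA i j, h]
  funext i j
  fin_cases i <;> fin_cases j
  exacts [(h0 hA' 0).trans (h0 hA 0).symm, h1, h2, h3,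
    h7 _ _ h1, (h0 hA' 1).trans (h0 hA 1).symm, h4, h5,
    h7 _ _ h2, h7 _ _ h4, (h0 hA' 2).trans (h0 hA 2).symm, h6,
    h7 _ _ h3, h7 _ _ h5, h7 _ _ h6,
    (h0 hA' 3).trans (h0 hA 3).symm]

theorem form_ext {l l' : Module.Dual ℂ g} (hv : vv l = vv l') (hA : AA l = AA l') : l = l' := by
  refine gbasis.ext fun t => ?_
  rw [gbasis_apply]
  fin_cases t
  exacts [congrFun hv 0, congrFun hv 1, congrFun hv 2, congrFun hv 3,
    congrFun (congrFun hA 0) 1, congrFun (congrFun hA 0) 2, congrFun (congrFun hA 0) 3,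
    congrFun (congrFun hA 1) 2, congrFun (congrFun hA 1) 3, congrFun (congrFun hA 2) 3]

theorem vv_coad (k : K) (l : Module.Dual ℂ g) (i : Fin 4) :
    vv (coad k l) i = ∑ a, kmat k a i * vv l a := by
  rw [vv, coad_apply, Ad_e, map_sum]
  simp only [map_smul, smul_eq_mul, vv]

theorem AA_coad (k : K) (l : Module.Dual ℂ g) (i j : Fin 4) :
    AA (coad k l) i j = ∑ a, kmat k a i * ∑ b, kmat k b j * AA l a b := by
  rw [AA, coad_apply, LieHom.map_lie, Ad_e, Ad_e, sum_lie, map_sum]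
  refine Finset.sum_congr rfl fun a _ => ?_
  rw [smul_lie, map_smul, lie_sum, map_sum, smul_eq_mul]
  congr 1
  refine Finset.sum_congr rfl fun b _ => ?_
  rw [lie_smul, map_smul]
  rfl

/-- The skew matrix with given entries next to the diagonal. -/
def tri (x y z : ℂ) : Fin 4 → Fin 4 → ℂ :=
  ![![0, x, 0, 0], ![-x, 0, y, 0], ![0, -y, 0, z], ![0, 0, -z, 0]]

theorem tri_skew (x y z : ℂ) (i j : Fin 4) : tri x y z j i = -tri x y z i j := by
  fin_cases i <;> fin_cases j <;> simp [tri]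

/-- The linear forms on a slice for the action of `K`. -/
noncomputable def slice (σ : Fin 4 → ℂ) : Module.Dual ℂ g :=
  form ![σ 0, 0, 0, 0] (tri (σ 1) (σ 2) (σ 3))

/-- Where `σ 0` and `σ 1` are nonzero, the squares of the `σ i` and the quotient `σ 3 / σ 1` are
rational in the invariants. What remains undetermined is the signs, which the diagonal elements of
`K` account for. -/
theorem inv_slice (σ : Fin 4 → ℂ) : inv (slice σ) =
    ![σ 1 ^ 2 + σ 2 ^ 2 + σ 3 ^ 2, σ 1 * σ 3, σ 0 ^ 2, σ 0 ^ 2 * σ 1 ^ 2] := by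
  rw [inv_eq, slice, vv_form, AA_form _ (tri_skew _ _ _)]
  simp [tri, Fin.sum_univ_four]
  ring_nf
  simp

theorem asym_slice (σ : Fin 4 → ℂ) : asym (slice σ) =
    σ 1 • (cl 0 * cl 1) + σ 2 • (cl 1 * cl 2) + σ 3 • (cl 2 * cl 3) := by
  rw [asym_eq, slice, AA_form _ (tri_skew _ _ _)]
  simp [tri, clMat]

theorem bsym_slice (σ : Fin 4 → ℂ) : bsym (slice σ) = σ 0 • cl 0 := by
  rw [bsym_eq, slice, vv_form]
  simp [clVec, Fin.sum_univ_four]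

end SO41

/-! ### Localized invariants and covariants on the slice. -/

namespace SO41

attribute [local instance 100] LieRing.ofAssociativeRing

section SliceIdentities

set_option linter.unusedSimpArgs false

variable {R : Type*} [Ring R] [Algebra ℂ R] {c : Fin 4 → R}

/-- On the slice, these combinations of the generators isolate single Clifford words, up to words
that were isolated before. -/
theorem slice_identities (hc : IsCliff c) (s x y z : ℂ) {a b : R}
    (ha : a = x • (c 0 * c 1) + y • (c 1 * c 2) + z • (c 2 * c 3)) (hb : b = s • c 0) :
    b * a - a * b = (4 * s * x) • c 1 ∧
    (2 * s ^ 2) • a - b * a * b = (4 * s ^ 2 * x) • (c 0 * c 1) ∧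
    clVol c * (a * b + b * a) = (16 * s) • (y • c 3 + z • c 1) ∧
    a * b * a * b = (8 * s ^ 2 * x * y) • (c 0 * c 2) -
      (8 * s ^ 2 * (y ^ 2 + z ^ 2 - x ^ 2)) • 1 ∧
    a * b * a = -((8 * s * x * y) • c 2 + (4 * s * (y ^ 2 + z ^ 2 - x ^ 2)) • c 0) := by
  subst ha hb
  refine ⟨?_, ?_, ?_, ?_, ?_⟩
  all_goals
    simp only [clVol, neg_mul, mul_add, add_mul, smul_mul_assoc, mul_smul_comm, smul_smul,
        mul_assoc,
      mul_neg, smul_neg, neg_neg, mul_one,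
      hc.sq_smul, hc.sq_assoc_smul, hc.anti 1 0 (by decide), hc.anti 2 0 (by decide),
      hc.anti 3 0 (by decide),
      hc.anti 2 1 (by decide), hc.anti 3 1 (by decide), hc.anti 3 2 (by decide),
      hc.anti_assoc 1 0 (by decide), hc.anti_assoc 2 0 (by decide), hc.anti_assoc 3 0 (by decide),
      hc.anti_assoc 2 1 (by decide), hc.anti_assoc 3 1 (by decide), hc.anti_assoc 3 2 (by decide)]
    module

/-- The volume element exchanges complementary words, so only half of the sixteen words have to be
isolated directly. -/
theorem vol_identities (hc : IsCliff c) :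
    clVol c * c 0 = (-2 : ℂ) • (c 1 * (c 2 * c 3)) ∧
    clVol c * c 1 = (2 : ℂ) • (c 0 * (c 2 * c 3)) ∧
    clVol c * c 2 = (-2 : ℂ) • (c 0 * (c 1 * c 3)) ∧
    clVol c * c 3 = (2 : ℂ) • (c 0 * (c 1 * c 2)) ∧
    clVol c * (c 0 * c 1) = (-4 : ℂ) • (c 2 * c 3) ∧
    clVol c * (c 0 * c 2) = (4 : ℂ) • (c 1 * c 3) ∧
    clVol c * (c 1 * c 2) = (-4 : ℂ) • (c 0 * c 3) := by
  refine ⟨?_, ?_, ?_, ?_, ?_, ?_, ?_⟩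
  all_goals
    simp only [clVol, neg_mul, mul_add, add_mul, smul_mul_assoc, mul_smul_comm, smul_smul,
        mul_assoc,
      mul_neg, smul_neg, neg_neg, mul_one,
      hc.sq_smul, hc.sq_assoc_smul, hc.anti 1 0 (by decide), hc.anti 2 0 (by decide),
      hc.anti 3 0 (by decide),
      hc.anti 2 1 (by decide), hc.anti 3 1 (by decide), hc.anti 3 2 (by decide),
      hc.anti_assoc 1 0 (by decide), hc.anti_assoc 2 0 (by decide), hc.anti_assoc 3 0 (by decide),
      hc.anti_assoc 2 1 (by decide), hc.anti_assoc 3 1 (by decide), hc.anti_assoc 3 2 (by decide)]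
    try module

end SliceIdentities

/-- The points of the slice with non-vanishing first two coordinates. -/
abbrev Sl : Type := {σ : Fin 4 → ℂ // σ 0 ≠ 0 ∧ σ 1 ≠ 0}

/-- The product of the third and the fourth invariant. -/
noncomputable def dr (l : Module.Dual ℂ g) : ℂ := inv l 2 * inv l 3

theorem dr_slice (σ : Fin 4 → ℂ) : dr (slice σ) = σ 0 ^ 4 * σ 1 ^ 2 := by
  rw [dr, inv_slice]
  simp only [Matrix.cons_val]
  ring

/-- The functions on the slice that become polynomials in the invariants when multiplied by a
power of `dr`. -/
def InL (h : Sl → ℂ) : Prop := ∃ (N : ℕ) (P : MvPolynomial (Fin 4) ℂ),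
  ∀ x : Sl, dr (slice x) ^ N * h x = MvPolynomial.eval (inv (slice x)) P

/-- The functions on the slice that become combinations of the covariants when multiplied by a
power of `dr`. -/
def InM (G : Sl → C) : Prop := ∃ (N : ℕ) (P : Fin 2 × Fin 8 → MvPolynomial (Fin 4) ℂ),
  ∀ x : Sl, dr (slice x) ^ N • G x = ∑ t, MvPolynomial.eval (inv (slice x)) (P t) • gen t (slice x)

theorem eval_dr (l : Module.Dual ℂ g) :
    MvPolynomial.eval (inv l) (MvPolynomial.X 2 * MvPolynomial.X 3) = dr l := by
  simp [dr]

namespace InL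

variable {f h : Sl → ℂ}

theorem mul (hf : InL f) (hh : InL h) : InL fun x => f x * h x := by
  obtain ⟨N, P, hP⟩ := hf
  obtain ⟨N', P', hP'⟩ := hh
  refine ⟨N + N', P * P', fun x => ?_⟩
  rw [map_mul, ← hP, ← hP']
  ring

theorem const (r : ℂ) : InL fun _ => r := ⟨0, MvPolynomial.C r, fun x => by simp⟩

theorem pow (hf : InL f) (n : ℕ) : InL fun x => f x ^ n := by
  induction n with
  | zero => simpa only [pow_zero] using const 1
  | succ n ih => simpa only [pow_succ] using ih.mul hf

theorem add (hf : InL f) (hh : InL h) : InL fun x => f x + h x := by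
  obtain ⟨N, P, hP⟩ := hf
  obtain ⟨N', P', hP'⟩ := hh
  refine ⟨N + N', (MvPolynomial.X 2 * MvPolynomial.X 3) ^ N' * P +
    (MvPolynomial.X 2 * MvPolynomial.X 3) ^ N * P', fun x => ?_⟩
  rw [map_add, map_mul, map_mul, map_pow, map_pow, eval_dr, ← hP, ← hP']
  ring

theorem sq_zero : InL fun x => x.1 0 ^ 2 :=
  ⟨0, MvPolynomial.X 2, fun x => by simp [inv_slice]⟩

/-- On the slice `dr` is `σ₀⁴ σ₁²`, so that `1 / σ₀²` is `y₃ / dr`. Likewise, below, `σ₁²` is `y₃² /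
dr` and `σ₃ / σ₁` is `y₁ y₂² / dr`. -/
theorem inv_sq_zero : InL fun x => (x.1 0 ^ 2)⁻¹ :=
  ⟨1, MvPolynomial.X 3, fun x => by
    have h := x.2.1
    simp only [MvPolynomial.eval_X, inv_slice, dr_slice, Matrix.cons_val]
    field_simp⟩

theorem sq_one : InL fun x => x.1 1 ^ 2 :=
  ⟨1, MvPolynomial.X 3 ^ 2, fun x => by
    simp only [MvPolynomial.eval_X, map_pow, inv_slice, dr_slice, Matrix.cons_val]
    ring⟩

theorem div : InL fun x => x.1 3 / x.1 1 :=
  ⟨1, MvPolynomial.X 1 * MvPolynomial.X 2 ^ 2, fun x => by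
    have h := x.2.2
    simp only [MvPolynomial.eval_X, map_pow, map_mul, inv_slice, dr_slice, Matrix.cons_val]
    field_simp⟩

theorem inv_zero : InL fun x => x.1 1 ^ 2 + x.1 2 ^ 2 + x.1 3 ^ 2 :=
  ⟨0, MvPolynomial.X 0, fun x => by simp [inv_slice]⟩

theorem sq_three : InL fun x => x.1 3 ^ 2 := by
  have h : (fun x : Sl => x.1 3 ^ 2) = fun x => (x.1 3 / x.1 1) ^ 2 * x.1 1 ^ 2 := by
    funext x
    have := x.2.2
    field_simp
  rw [h]
  exact (div.pow 2).mul sq_one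

theorem sq_two : InL fun x => x.1 2 ^ 2 := by
  have h : (fun x : Sl => x.1 2 ^ 2) = fun x => (x.1 1 ^ 2 + x.1 2 ^ 2 + x.1 3 ^ 2) +
      -1 * (x.1 1 ^ 2 + x.1 3 ^ 2) := by
    funext x
    ring
  rw [h]
  exact inv_zero.add ((const _).mul (sq_one.add sq_three))

end InL

namespace InM

variable {G H : Sl → C} {h : Sl → ℂ}

theorem zero : InM 0 := ⟨0, 0, fun x => by simp⟩

theorem add (hG : InM G) (hH : InM H) : InM fun x => G x + H x := by
  obtain ⟨N, P, hP⟩ := hG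
  obtain ⟨N', P', hP'⟩ := hH
  refine ⟨N + N', fun t => (MvPolynomial.X 2 * MvPolynomial.X 3) ^ N' * P t +
    (MvPolynomial.X 2 * MvPolynomial.X 3) ^ N * P' t, fun x => ?_⟩
  simp only [map_add, map_mul _ (_ ^ _), map_pow, eval_dr, add_smul, mul_smul,
    Finset.sum_add_distrib, ← Finset.smul_sum, ← hP, ← hP']
  module

theorem smul (hh : InL h) (hG : InM G) : InM fun x => h x • G x := by
  obtain ⟨N, P, hP⟩ := hh
  obtain ⟨N', P', hP'⟩ := hG
  refine ⟨N + N', fun t => P * P' t, fun x => ?_⟩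
  simp only [map_mul, mul_smul, ← Finset.smul_sum, ← hP, ← hP']
  module

theorem gen (t : Fin 2 × Fin 8) : InM fun x => SO41.gen t (slice x) :=
  ⟨0, Pi.single t 1, fun x => by
    rw [Finset.sum_eq_single t (fun u _ hu => by simp [Pi.single_eq_of_ne hu]) (by simp)]
    simp⟩

/-- Multiplication by `omega` exchanges the two halves of the generators, with a factor `16` from
`omega² = 16` in one direction. -/
theorem omega_mul (hG : InM G) : InM fun x => omega * G x := by
  obtain ⟨N, P, hP⟩ := hG
  refine ⟨N, fun t => if t.1 = 0 then MvPolynomial.C 16 * P (1, t.2) else P (0, t.2), fun x => ?_⟩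
  have h := (rel_sym (slice x)).ww
  rw [← mul_smul_comm, hP]
  simp only [Fintype.sum_prod_type, Fin.sum_univ_two, mul_add, Finset.mul_sum, mul_smul_comm]
  rw [add_comm]
  congr 1
  · refine Finset.sum_congr rfl fun t _ => ?_
    simp only [SO41.gen, bgens, Fin.val_zero, Fin.val_one, pow_zero, pow_one, one_mul, if_true,
      map_mul, MvPolynomial.eval_C]
    rw [← mul_assoc, h, smul_mul_assoc, one_mul, smul_smul, mul_comm]
  · refine Finset.sum_congr rfl fun t _ => ?_
    simp [SO41.gen, bgens]

theorem congr (hG : InM G) (h : ∀ x, H x = G x) : InM H := by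
  rwa [funext h]

end InM

end SO41

/-! ### Clifford words with monomial coefficients of the right parity. -/

namespace SO41

attribute [local instance 100] LieRing.ofAssociativeRing

/-- The monomial that a coefficient of a covariant is divisible by. -/
def mono (I : Ix) (σ : Fin 4 → ℂ) : ℂ :=
  σ 0 ^ (((I.1 : ℕ) + I.2.1 + I.2.2.1 + I.2.2.2) % 2) * σ 1 ^ (((I.2.1 : ℕ) + I.2.2.1) % 2) *
    σ 2 ^ (((I.2.2.1 : ℕ) + I.2.2.2) % 2)

/-- The slice identities are solved triangularly: first `cl 0`, `cl 1` and `cl 0 * cl 1`, then the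
other words of degree at most two that involve `cl 2` or `cl 3` once the former are subtracted, and
finally the complementary words by `omega`. -/
theorem inM_mono (I : Ix) : InM fun x => mono I x.1 • word cl I := by
  have hid := fun x : Sl => slice_identities isCliff_cl (x.1 0) (x.1 1) (x.1 2) (x.1 3)
    (asym_slice x.1) (bsym_slice x.1)
  obtain ⟨v0, v1, v2, v3, v01, v02, v12⟩ := vol_identities isCliff_cl
  have hv : clVol cl = omega := rfl
  rw [hv] at v0 v1 v2 v3 v01 v02 v12
  have g0 : InM fun x => 1 := (InM.gen (0, 0)).congr fun x => by simp [gen, bgens, bwords]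
  have gb : InM fun x => bsym (slice x) :=
    (InM.gen (0, 1)).congr fun x => by simp [gen, bgens, bwords]
  have gab : InM fun x => asym (slice x) * bsym (slice x) :=
    (InM.gen (0, 2)).congr fun x => by simp [gen, bgens, bwords]
  have gba : InM fun x => bsym (slice x) * asym (slice x) :=
    (InM.gen (0, 3)).congr fun x => by simp [gen, bgens, bwords]
  have gaba : InM fun x => asym (slice x) * bsym (slice x) * asym (slice x) :=
    (InM.gen (0, 4)).congr fun x => by simp [gen, bgens, bwords]
  have ga : InM fun x => asym (slice x) :=
    (InM.gen (0, 5)).congr fun x => by simp [gen, bgens, bwords]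
  have gbab : InM fun x => bsym (slice x) * asym (slice x) * bsym (slice x) :=
    (InM.gen (0, 6)).congr fun x => by simp [gen, bgens, bwords]
  have gabab : InM fun x => asym (slice x) * bsym (slice x) * asym (slice x) * bsym (slice x) :=
    (InM.gen (0, 7)).congr fun x => by simp [gen, bgens, bwords]
  have hL : InL fun x => x.1 2 ^ 2 + x.1 3 ^ 2 + -1 * x.1 1 ^ 2 :=
    (InL.sq_two.add InL.sq_three).add ((InL.const _).mul InL.sq_one)
  have p0 : InM fun x => x.1 0 • cl 0 := gb.congr fun x => (bsym_slice x.1).symm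
  have p1 : InM fun x => (x.1 0 * x.1 1) • cl 1 :=
    (InM.smul (InL.const (1 / 4)) (gba.add (InM.smul (InL.const (-1)) gab))).congr fun x => by
      have h := (hid x).1
      rw [neg_one_smul, ← sub_eq_add_neg, h]
      module
  have p01 : InM fun x => x.1 1 • (cl 0 * cl 1) :=
    (InM.smul ((InL.const (1 / 4)).mul InL.inv_sq_zero)
      ((InM.smul ((InL.const 2).mul InL.sq_zero) ga).add
        (InM.smul (InL.const (-1)) gbab))).congr fun x => by
      have h := (hid x).2.1
      have h0 := x.2.1
      rw [neg_one_smul, ← sub_eq_add_neg, h, smul_smul]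
      congr 1
      field_simp
  have p3 : InM fun x => (x.1 0 * x.1 2) • cl 3 :=
    ((InM.smul (InL.const (1 / 16)) (gab.add gba).omega_mul).add
      (InM.smul ((InL.const (-1)).mul InL.div) p1)).congr fun x => by
      have h := (hid x).2.2.1
      rw [hv] at h
      have h0 : -1 * (x.1 3 / x.1 1) * (x.1 0 * x.1 1) = -(x.1 0 * x.1 3) := by
        have := x.2.2
        field_simp
      rw [h, smul_smul _ _ (cl 1), h0]
      module
  have p02 : InM fun x => (x.1 1 * x.1 2) • (cl 0 * cl 2) :=
    ((InM.smul ((InL.const (1 / 8)).mul InL.inv_sq_zero) gabab).add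
      (InM.smul hL g0)).congr fun x => by
      have h := (hid x).2.2.2.1
      have h0 := x.2.1
      have h1 : ∀ t, 1 / 8 * (x.1 0 ^ 2)⁻¹ * (8 * x.1 0 ^ 2 * t) = t := by
        intro t
        field_simp
      rw [h, smul_sub, smul_smul, smul_smul, mul_assoc _ (x.1 1), h1, h1]
      module
  have p2 : InM fun x => (x.1 0 * x.1 1 * x.1 2) • cl 2 :=
    ((InM.smul (InL.const (-1 / 8)) gaba).add
      (InM.smul ((InL.const (-1 / 2)).mul hL) p0)).congr fun x => by
      have h := (hid x).2.2.2.2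
      rw [h]
      module
  have p12 : InM fun x => x.1 2 • (cl 1 * cl 2) :=
    ((ga.add (InM.smul (InL.const (-1)) p01)).add
      (InM.smul ((InL.const (1 / 4)).mul InL.div) p01.omega_mul)).congr fun x => by
      have h0 : 1 / 4 * (x.1 3 / x.1 1) * x.1 1 = 1 / 4 * x.1 3 := by
        have := x.2.2
        field_simp
      rw [asym_slice, mul_smul_comm, v01, smul_smul (1 / 4 * _) (x.1 1), h0]
      module
  have q0 : InM fun x => x.1 0 • (cl 1 * (cl 2 * cl 3)) :=
    (InM.smul (InL.const (-1 / 2)) p0.omega_mul).congr fun x => by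
      rw [mul_smul_comm, v0]
      module
  have q1 : InM fun x => (x.1 0 * x.1 1) • (cl 0 * (cl 2 * cl 3)) :=
    (InM.smul (InL.const (1 / 2)) p1.omega_mul).congr fun x => by
      rw [mul_smul_comm, v1]
      module
  have q2 : InM fun x => (x.1 0 * x.1 1 * x.1 2) • (cl 0 * (cl 1 * cl 3)) :=
    (InM.smul (InL.const (-1 / 2)) p2.omega_mul).congr fun x => by
      rw [mul_smul_comm, v2]
      module
  have q3 : InM fun x => (x.1 0 * x.1 2) • (cl 0 * (cl 1 * cl 2)) :=
    (InM.smul (InL.const (1 / 2)) p3.omega_mul).congr fun x => by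
      rw [mul_smul_comm, v3]
      module
  have q01 : InM fun x => x.1 1 • (cl 2 * cl 3) :=
    (InM.smul (InL.const (-1 / 4)) p01.omega_mul).congr fun x => by
      rw [mul_smul_comm, v01]
      module
  have q02 : InM fun x => (x.1 1 * x.1 2) • (cl 1 * cl 3) :=
    (InM.smul (InL.const (1 / 4)) p02.omega_mul).congr fun x => by
      rw [mul_smul_comm, v02]
      module
  have q12 : InM fun x => x.1 2 • (cl 0 * cl 3) :=
    (InM.smul (InL.const (-1 / 4)) p12.omega_mul).congr fun x => by
      rw [mul_smul_comm, v12]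
      module
  have q : InM fun x => omega := g0.omega_mul.congr fun x => (mul_one _).symm
  obtain ⟨i, j, k, m⟩ := I
  fin_cases i <;> fin_cases j <;> fin_cases k <;> fin_cases m
  exacts [g0.congr fun x => by simp [mono, word], p3.congr fun x => by simp [mono, word],
    p2.congr fun x => by simp [mono, word], q01.congr fun x => by simp [mono, word],
    p1.congr fun x => by simp [mono, word], q02.congr fun x => by simp [mono, word],
    p12.congr fun x => by simp [mono, word], q0.congr fun x => by simp [mono, word],
    p0.congr fun x => by simp [mono, word], q12.congr fun x => by simp [mono, word],
    p02.congr fun x => by simp [mono, word], q1.congr fun x => by simp [mono, word],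
    p01.congr fun x => by simp [mono, word], q2.congr fun x => by simp [mono, word],
    q3.congr fun x => by simp [mono, word], q.congr fun x => by simp [mono, word, omega]]

/-- Writing `σ₃` as `σ₁ (σ₃ / σ₁)` and removing squares leaves exactly `mono I`; the three
congruences are what makes the exponents match. -/
theorem inM_monomial (m : Fin 4 → ℕ) (I : Ix)
    (h0 : m 0 % 2 = ((I.1 : ℕ) + I.2.1 + I.2.2.1 + I.2.2.2) % 2)
    (h1 : (m 1 + m 3) % 2 = ((I.2.1 : ℕ) + I.2.2.1) % 2)
    (h2 : m 2 % 2 = ((I.2.2.1 : ℕ) + I.2.2.2) % 2) :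
    InM fun x => (∏ i, x.1 i ^ m i) • word cl I := by
  refine (InM.smul ((((InL.sq_zero.pow (m 0 / 2)).mul (InL.sq_one.pow ((m 1 + m 3) / 2))).mul
    (InL.sq_two.pow (m 2 / 2))).mul (InL.div.pow (m 3))) (inM_mono I)).congr fun x => ?_
  rw [smul_smul]
  congr 1
  have hx := x.2.2
  have e : x.1 1 ^ m 1 * x.1 3 ^ m 3 = x.1 1 ^ (m 1 + m 3) * (x.1 3 / x.1 1) ^ m 3 := by
    rw [div_pow, pow_add]
    field_simp
  rw [Fin.prod_univ_four, mono, ← h0, ← h1, ← h2]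
  have k : ∀ (z : ℂ) (n : ℕ), z ^ n = (z ^ 2) ^ (n / 2) * z ^ (n % 2) := by
    intro z n
    rw [← pow_mul, ← pow_add, Nat.div_add_mod]
  rw [k _ (m 1 + m 3)] at e
  rw [k _ (m 0), k _ (m 2)]
  linear_combination (x.1 0 ^ 2) ^ (m 0 / 2) * x.1 0 ^ (m 0 % 2) *
    ((x.1 2 ^ 2) ^ (m 2 / 2) * x.1 2 ^ (m 2 % 2)) * e

end SO41

/-! ### Covariants restricted to the slice: the sign changes. -/

namespace SO41

attribute [local instance 100] LieRing.ofAssociativeRing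

/-- The polynomial maps to `C(𝔭)` that commute with the actions of `K`. -/
structure IsCov (F : Module.Dual ℂ g → C) : Prop where
  pol : ∀ φ : C →ₗ[ℂ] ℂ, (fun l => φ (F l)) ∈ Pol
  equivariant : ∀ (k : K) (l : Module.Dual ℂ g), actC k (F (coad k l)) = F l

/-- The element of `K` that changes the signs of coordinates. -/
def flipK (κ : Fin 4 → ℝ) (hκ : ∀ i, κ i * κ i = 1) (h : κ 0 * κ 1 * κ 2 * κ 3 = 1) : K :=
  ⟨Matrix.diagonal κ, by
    rw [Matrix.mem_specialOrthogonalGroup_iff, Matrix.mem_orthogonalGroup_iff, Matrix.det_diagonal,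
      Matrix.diagonal_transpose, Matrix.diagonal_mul_diagonal,
      Fin.prod_univ_four]
    refine ⟨?_, h⟩
    rw [← Matrix.diagonal_one]
    exact congrArg _ (funext fun i => by simpa using hκ i)⟩

section Flip

variable (κ : Fin 4 → ℝ) (hκ : ∀ i, κ i * κ i = 1) (h : κ 0 * κ 1 * κ 2 * κ 3 = 1)

theorem kmat_flipK (i j : Fin 4) :
    kmat (flipK κ hκ h) i j = if i = j then (κ i : ℂ) else 0 := by
  change ((Matrix.diagonal κ i j : ℝ) : ℂ) = _
  rw [Matrix.diagonal_apply]
  split_ifs <;> simp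

/-- The action of the sign changes on the slice. -/
def flipS (σ : Fin 4 → ℂ) : Fin 4 → ℂ :=
  ![κ 0 * σ 0, κ 0 * κ 1 * σ 1, κ 1 * κ 2 * σ 2, κ 2 * κ 3 * σ 3]

theorem coad_flipK (σ : Fin 4 → ℂ) : coad (flipK κ hκ h) (slice σ) = slice (flipS κ σ) := by
  have e1 : ∀ i, vv (coad (flipK κ hκ h) (slice σ)) i = κ i * vv (slice σ) i := by
    intro i
    rw [vv_coad]
    simp [kmat_flipK]
  have e2 : ∀ i j, AA (coad (flipK κ hκ h) (slice σ)) i j = κ i * (κ j * AA (slice σ) i j) := by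
    intro i j
    rw [AA_coad]
    simp [kmat_flipK]
  refine form_ext (funext fun i => ?_) (funext fun i => funext fun j => ?_)
  · rw [e1, slice, slice, vv_form, vv_form]
    fin_cases i <;> simp [flipS]
  · rw [e2, slice, slice, AA_form _ (tri_skew _ _ _), AA_form _ (tri_skew _ _ _)]
    fin_cases i <;> fin_cases j <;> simp [tri, flipS] <;> ring

theorem actC_flipK_word (I : Ix) :
    actC (flipK κ hκ h) (word cl I) = sgn (fun i => (κ i : ℂ)) I • word cl I := by
  refine map_word _ _ _ _ (fun i => ?_) I
  rw [isVec_cl]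
  simp [kmat_flipK]

/-- The average over a sign change. -/
noncomputable def avg : ((Fin 4 → ℂ) → C) →ₗ[ℂ] ((Fin 4 → ℂ) → C) where
  toFun G σ := (1 / 2 : ℂ) • (G σ + actC (flipK κ hκ h) (G (flipS κ σ)))
  map_add' G H := by
    funext σ
    simp only [Pi.add_apply, map_add]
    module
  map_smul' r G := by
    funext σ
    simp only [Pi.smul_apply, map_smul, RingHom.id_apply]
    module

/-- The product of a monomial and an ordered product of generators. -/
noncomputable def mword (m : (Fin 4 → ℕ) × Ix) (σ : Fin 4 → ℂ) : C :=
  (∏ i, σ i ^ m.1 i) • word cl m.2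

/-- A sign change multiplies a monomial times a word by `±1`, so the average keeps it or kills it.
-/
theorem avg_mword (m : (Fin 4 → ℕ) × Ix) : avg κ hκ h (mword m) =
    ((1 + (∏ i, flipS κ 1 i ^ m.1 i) * sgn (fun i => (κ i : ℂ)) m.2) / 2) • mword m := by
  funext σ
  have e : ∏ i, flipS κ σ i ^ m.1 i = (∏ i, flipS κ 1 i ^ m.1 i) * ∏ i, σ i ^ m.1 i := by
    rw [← Finset.prod_mul_distrib]
    refine Finset.prod_congr rfl fun i _ => ?_
    rw [← mul_pow]
    congr 1
    fin_cases i <;> simp [flipS]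
  change (1 / 2 : ℂ) • (mword m σ + actC _ (mword m (flipS κ σ))) = (_ : ℂ) • mword m σ
  simp only [mword, map_smul, actC_flipK_word, e]
  module

theorem IsCov.avg_eq {F : Module.Dual ℂ g → C} (hF : IsCov F) :
    avg κ hκ h (fun σ => F (slice σ)) = fun σ => F (slice σ) := by
  funext σ
  change (1 / 2 : ℂ) • (F (slice σ) + actC _ (F (slice (flipS κ σ)))) = _
  rw [← coad_flipK κ hκ h, hF.equivariant]
  module

end Flip

theorem IsCov.mem_span_mword {F : Module.Dual ℂ g → C} (hF : IsCov F) :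
    (fun σ => F (slice σ)) ∈ Submodule.span ℂ (Set.range mword) := by
  have h1 : (fun σ => F (slice σ)) =
      ∑ I, fun σ => (cbasis.coord I (F (slice σ))) • word cl I := by
    funext σ
    rw [Finset.sum_apply]
    conv_lhs => rw [← cbasis.sum_repr (F (slice σ))]
    simp only [cbasis_apply, Module.Basis.coord_apply]
  rw [h1]
  refine Submodule.sum_mem _ fun I _ => ?_
  obtain ⟨q, hq⟩ := mem_Pol.1 (hF.pol (cbasis.coord I))
  have h2 : ∀ σ : Fin 4 → ℂ, cbasis.coord I (F (slice σ)) = MvPolynomial.eval σ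
      (MvPolynomial.bind₁ ![MvPolynomial.X 0, 0, 0, 0, MvPolynomial.X 1, 0, 0, MvPolynomial.X 2, 0,
        MvPolynomial.X 3] q) := by
    intro σ
    rw [hq, ← MvPolynomial.coe_aeval_eq_eval, ← MvPolynomial.coe_aeval_eq_eval]
    change _ = MvPolynomial.aeval σ (MvPolynomial.bind₁ _ q)
    rw [MvPolynomial.aeval_bind₁]
    change MvPolynomial.aeval _ q = _
    congr 2
    funext t
    rw [slice, form, ofCoords_gbasis]
    fin_cases t <;> simp [tri]
  simp only [h2]
  generalize MvPolynomial.bind₁ _ q = q'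
  have h3 : (fun σ => MvPolynomial.eval σ q' • word cl I) =
      ∑ d ∈ q'.support, q'.coeff d • mword (d, I) := by
    funext σ
    rw [Finset.sum_apply, MvPolynomial.eval_eq', Finset.sum_smul]
    exact Finset.sum_congr rfl fun d _ => mul_smul _ _ _
  rw [h3]
  exact Submodule.sum_mem _ fun d _ => Submodule.smul_mem _ _ (Submodule.subset_span ⟨_, rfl⟩)

theorem pow_neg_one_cases (n : ℕ) : ((-1 : ℂ) ^ n = 1 ∧ n % 2 = 0) ∨ ((-1 : ℂ) ^ n = -1 ∧ n % 2 =
    1) := by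
  rcases Nat.even_or_odd n with h | h
  · exact Or.inl ⟨h.neg_one_pow, Nat.even_iff.1 h⟩
  · exact Or.inr ⟨h.neg_one_pow, Nat.odd_iff.1 h⟩

/-- The functions on the slice that are combinations of the covariants. -/
def submoduleM : Submodule ℂ ((Fin 4 → ℂ) → C) where
  carrier := {G | InM fun x => G x.1}
  zero_mem' := InM.zero
  add_mem' hG hH := InM.add hG hH
  smul_mem' r _ hG := InM.smul (InL.const r) hG

/-- Averaging over sign changes fixes a covariant and discards every monomial of the wrong parity;
the remaining ones are covered by `inM_monomial`. -/
theorem IsCov.inM {F : Module.Dual ℂ g → C} (hF : IsCov F) : InM fun x => F (slice x.1) := by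
  -- These three elements generate the diagonal sign matrices of determinant one. On the slice they
  -- change the signs of `σ₀`, of `σ₂`, and of `σ₁` and `σ₃` together, and so impose the three
  -- congruences of `inM_monomial`.
  let a₁ := avg ![-1, -1, -1, -1] (by intro i; fin_cases i <;> simp) (by simp)
  let a₂ := avg ![1, 1, -1, -1] (by intro i; fin_cases i <;> simp) (by simp)
  let a₃ := avg ![1, -1, -1, 1] (by intro i; fin_cases i <;> simp) (by simp)
  have h1 : a₁ (a₂ (a₃ fun σ => F (slice σ))) = fun σ => F (slice σ) := by
    simp only [a₁, a₂, a₃, hF.avg_eq]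
  have h2 : Submodule.span ℂ (Set.range mword) ≤ submoduleM.comap (a₁ ∘ₗ a₂ ∘ₗ a₃) := by
    rw [Submodule.span_le]
    rintro _ ⟨⟨m, I⟩, rfl⟩
    change a₁ (a₂ (a₃ (mword (m, I)))) ∈ submoduleM
    simp only [a₁, a₂, a₃, avg_mword, map_smul, smul_smul]
    obtain ⟨i, j, k, n⟩ := I
    by_cases hp : m 0 % 2 = ((i : ℕ) + j + k + n) % 2 ∧ (m 1 + m 3) % 2 = ((j : ℕ) + k) % 2 ∧
        m 2 % 2 = ((k : ℕ) + n) % 2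
    · exact Submodule.smul_mem _ _ (inM_monomial m (i, j, k, n) hp.1 hp.2.1 hp.2.2)
    · convert submoduleM.zero_mem
      convert zero_smul ℂ _
      simp only [flipS, sgn, Fin.prod_univ_four, Matrix.cons_val]
      simp only [Pi.one_apply, Complex.ofReal_neg, Complex.ofReal_one, mul_one, one_pow, one_mul,
        mul_neg, neg_neg]
      simp only [← pow_add]
      by_cases e0 : m 0 % 2 = ((i : ℕ) + j + k + n) % 2
      · by_cases e1 : (m 1 + m 3) % 2 = ((j : ℕ) + k) % 2
        · have e2 : m 2 % 2 ≠ ((k : ℕ) + n) % 2 := fun h => hp ⟨e0, e1, h⟩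
          rw [((pow_neg_one_cases (m 2 + (k + n))).resolve_left fun h => e2 (by omega)).1]
          simp
        · rw [((pow_neg_one_cases (m 1 + m 3 + (j + k))).resolve_left fun h => e1 (by omega)).1]
          simp
      · rw [((pow_neg_one_cases (m 0 + (i + (j + (k + n))))).resolve_left
          fun h => e0 (by omega)).1]
        simp
  have h3 := h2 hF.mem_span_mword
  change a₁ (a₂ (a₃ fun σ => F (slice σ))) ∈ submoduleM at h3
  rw [h1] at h3
  exact h3

end SO41

/-! ### Moving real forms into the slice. -/

namespace SO41

attribute [local instance 100] LieRing.ofAssociativeRing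

/-- The columns of `k` are a Gram-Schmidt basis of the `f i`, up to one sign. -/
theorem exists_triangular (f : Fin 4 → Fin 4 → ℝ) : ∃ k : K, ∀ i j, i < j →
    ∑ a, (k : Matrix (Fin 4) (Fin 4) ℝ) a j * f i a = 0 := by
  have hfin : Module.finrank ℝ (EuclideanSpace ℝ (Fin 4)) = Fintype.card (Fin 4) := by simp
  set b := InnerProductSpace.gramSchmidtOrthonormalBasis hfin fun i => WithLp.toLp 2 (f i) with hb
  set M : Matrix (Fin 4) (Fin 4) ℝ := Matrix.of fun a i => b i a with hM
  have hMM : M.transpose * M = 1 := by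
    ext i j
    have h := orthonormal_iff_ite.1 b.orthonormal i j
    rw [PiLp.inner_apply] at h
    rw [Matrix.mul_apply, Matrix.one_apply, ← h]
    exact Finset.sum_congr rfl fun a _ => mul_comm _ _
  have hdet : M.det * M.det = 1 := by
    have := congrArg Matrix.det hMM
    rwa [Matrix.det_mul, Matrix.det_transpose, Matrix.det_one] at this
  -- Changing the sign of the last column corrects the determinant and keeps all orthogonality
  -- relations.
  set δ : Fin 4 → ℝ := ![1, 1, 1, M.det] with hδ
  have hδδ : ∀ i, δ i * δ i = 1 := by
    intro i
    fin_cases i <;> simp [hδ, hdet]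
  refine ⟨⟨M * Matrix.diagonal δ, ?_⟩, fun i j hij => ?_⟩
  · rw [Matrix.mem_specialOrthogonalGroup_iff, Matrix.mem_orthogonalGroup_iff']
    constructor
    · rw [Matrix.transpose_mul, Matrix.diagonal_transpose, Matrix.mul_assoc,
        ← Matrix.mul_assoc _ M, hMM, Matrix.one_mul, Matrix.diagonal_mul_diagonal,
        ← Matrix.diagonal_one]
      exact congrArg _ (funext hδδ)
    · rw [Matrix.det_mul, Matrix.det_diagonal, Fin.prod_univ_four]
      simp [hδ, hdet]
  · have h := InnerProductSpace.gramSchmidtOrthonormalBasis_inv_triangular hfin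
      (fun i => WithLp.toLp 2 (f i)) hij
    rw [← hb, PiLp.inner_apply] at h
    have h2 : ∑ a, (M * Matrix.diagonal δ) a j * f i a = δ j * ∑ a, b j a * f i a := by
      rw [Finset.mul_sum]
      refine Finset.sum_congr rfl fun a _ => ?_
      rw [Matrix.mul_diagonal, hM, Matrix.of_apply]
      ring
    have h3 : ∑ a, b j a * f i a = 0 := by
      rw [← h]
      exact Finset.sum_congr rfl fun a _ => mul_comm _ _
    change ∑ a, (M * Matrix.diagonal δ) a j * f i a = 0
    rw [h2, h3, mul_zero]

theorem exists_real {l : Module.Dual ℂ g} (hl : IsRealForm l) :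
    ∃ (v : Fin 4 → ℝ) (A : Fin 4 → Fin 4 → ℝ), (∀ i, vv l i = v i) ∧ ∀ i j, AA l i j = A i j := by
  obtain ⟨x, hx⟩ := hl
  simp only [gbasis_apply] at hx
  have h0 : ∀ i, AA l i i = (0 : ℝ) := fun i => by
    rw [Complex.ofReal_zero]
    exact self_eq_neg.1 (AA_skew l i i)
  have h7 : ∀ i j (y : ℝ), AA l i j = y → AA l j i = (-y : ℝ) := fun i j y h => by
    rw [AA_skew l i j, h, Complex.ofReal_neg]
  refine ⟨![x 0, x 1, x 2, x 3], ![![0, x 4, x 5, x 6], ![-x 4, 0, x 7, x 8],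
    ![-x 5, -x 7, 0, x 9], ![-x 6, -x 8, -x 9, 0]], fun i => ?_, fun i j => ?_⟩
  · fin_cases i
    exacts [hx 0, hx 1, hx 2, hx 3]
  · fin_cases i <;> fin_cases j
    exacts [h0 0, hx 4, hx 5, hx 6, h7 0 1 _ (hx 4), h0 1, hx 7, hx 8, h7 0 2 _ (hx 5),
      h7 1 2 _ (hx 7), h0 2, hx 9, h7 0 3 _ (hx 6), h7 1 3 _ (hx 8), h7 2 3 _ (hx 9), h0 3]

/-- In a basis adapted to the flag of `v, Av, A²v`, the vector `v` lies on the first axis and a skew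
`A` is tridiagonal. The entries that have to be cancelled to see this are nonzero because `v · v`
and `Av · Av` are. -/
theorem exists_coad_eq_slice {l : Module.Dual ℂ g} (hl : IsRealForm l) (h : dr l ≠ 0) :
    ∃ (k : K) (x : Sl), coad k l = slice x := by
  obtain ⟨v, A, hv, hA⟩ := exists_real hl
  -- The fourth vector imposes no condition, so it is set to `0`.
  obtain ⟨k, hk⟩ := exists_triangular ![v, fun i => ∑ j, A i j * v j,
    fun i => ∑ j, A i j * ∑ m, A j m * v m, 0]
  have hkv : Matrix.vecMul (vv l) (kmat k) = vv (coad k l) := by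
    funext i
    rw [vv_coad]
    change ∑ a, vv l a * kmat k a i = _
    exact Finset.sum_congr rfl fun a _ => mul_comm _ _
  have hkA : (kmat k).transpose * Matrix.of (AA l) * kmat k = Matrix.of (AA (coad k l)) := by
    ext i j
    rw [Matrix.of_apply, AA_coad, Matrix.mul_assoc, Matrix.mul_apply]
    refine Finset.sum_congr rfl fun a _ => ?_
    rw [Matrix.mul_apply]
    exact congrArg _ (Finset.sum_congr rfl fun b _ => mul_comm _ _)
  have hstep : ∀ w : Fin 4 → ℂ,
      Matrix.mulVec (Matrix.of (AA (coad k l))) (Matrix.vecMul w (kmat k)) =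
      Matrix.vecMul (Matrix.mulVec (Matrix.of (AA l)) w) (kmat k) := by
    intro w
    rw [← hkA, ← Matrix.mulVec_transpose, ← Matrix.mulVec_transpose, Matrix.mulVec_mulVec,
      Matrix.mulVec_mulVec, Matrix.mul_assoc _ (kmat k), kmat_mul_transpose, Matrix.mul_one]
  have hz : ∀ (w : Fin 4 → ℝ) (j : Fin 4), ∑ a, (k : Matrix (Fin 4) (Fin 4) ℝ) a j * w a = 0 →
      Matrix.vecMul (fun a => (w a : ℂ)) (kmat k) j = 0 := by
    intro w j h
    have := congrArg Complex.ofReal h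
    rw [Complex.ofReal_sum] at this
    rw [Complex.ofReal_zero] at this
    rw [← this]
    change ∑ a, (w a : ℂ) * kmat k a j = _
    refine Finset.sum_congr rfl fun a _ => ?_
    rw [Complex.ofReal_mul, mul_comm]
    rfl
  have e0 : vv l = fun a => (v a : ℂ) := funext hv
  have e1 : Matrix.mulVec (Matrix.of (AA l)) (vv l) = fun i => ((∑ j, A i j * v j : ℝ) : ℂ) := by
    funext i
    simp [Matrix.mulVec, dotProduct, hv, hA]
  have e2 : Matrix.mulVec (Matrix.of (AA l)) (Matrix.mulVec (Matrix.of (AA l)) (vv l)) =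
      fun i => ((∑ j, A i j * ∑ m, A j m * v m : ℝ) : ℂ) := by
    rw [e1]
    funext i
    simp [Matrix.mulVec, dotProduct, hA]
  set l' := coad k l with hl'
  have hinv : inv l' = inv l := inv_coad k l
  have z0 : ∀ j, 0 < j → vv l' j = 0 := by
    intro j hj
    rw [← hkv, e0]
    exact hz _ _ (hk 0 j hj)
  have hAv : ∀ i, ∑ j, AA l' i j * vv l' j = AA l' i 0 * vv l' 0 := by
    intro i
    rw [Fin.sum_univ_four, z0 1 (by decide), z0 2 (by decide), z0 3 (by decide)]
    ring
  have hd : vv l' 0 ≠ 0 := by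
    intro h0
    apply h
    have : inv l' 2 = 0 := by
      change ∑ i, vv l' i * vv l' i = 0
      rw [Fin.sum_univ_four, z0 1 (by decide), z0 2 (by decide), z0 3 (by decide), h0]
      ring
    rw [dr, ← hinv, this, zero_mul]
  have z1 : ∀ j, 1 < j → AA l' j 0 = 0 := by
    intro j hj
    have h1 : AA l' j 0 * vv l' 0 = 0 := by
      rw [← hAv]
      change Matrix.mulVec (Matrix.of (AA l')) (vv l') j = 0
      rw [← hkv, hstep, e1]
      exact hz _ _ (hk 1 j hj)
    exact (mul_eq_zero.1 h1).resolve_right hd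
  have d0 : ∀ i, AA l' i i = 0 := fun i => self_eq_neg.1 (AA_skew l' i i)
  have hr : AA l' 1 0 ≠ 0 := by
    intro h0
    apply h
    have : inv l' 3 = 0 := by
      change ∑ i, (∑ j, AA l' i j * vv l' j) * (∑ j, AA l' i j * vv l' j) = 0
      simp only [hAv]
      rw [Fin.sum_univ_four, z1 2 (by decide), z1 3 (by decide), h0, d0]
      ring
    rw [dr, ← hinv, this, mul_zero]
  have z2 : AA l' 3 1 = 0 := by
    have h1 : AA l' 3 1 * (AA l' 1 0 * vv l' 0) = 0 := by
      have h2 : Matrix.mulVec (Matrix.of (AA l')) (Matrix.mulVec (Matrix.of (AA l')) (vv l')) 3 =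
          0 := by
        rw [← hkv, hstep, hstep, e2]
        exact hz _ _ (hk 2 3 (by decide))
      rw [← h2]
      change _ = ∑ j, AA l' 3 j * ∑ m, AA l' j m * vv l' m
      simp only [hAv]
      rw [Fin.sum_univ_four, z1 2 (by decide), z1 3 (by decide), d0, d0]
      ring
    exact (mul_eq_zero.1 h1).resolve_right (mul_ne_zero hr hd)
  refine ⟨k, ⟨![vv l' 0, AA l' 0 1, AA l' 1 2, AA l' 2 3], hd, ?_⟩, ?_⟩
  · change AA l' 0 1 ≠ 0
    rw [AA_skew l' 1 0]
    exact neg_ne_zero.2 hr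
  · rw [← hl']
    have s1 := AA_skew l'
    refine form_ext ?_ ?_
    · rw [slice, vv_form]
      funext i
      fin_cases i
      exacts [rfl, z0 1 (by decide), z0 2 (by decide), z0 3 (by decide)]
    · rw [slice, AA_form _ (tri_skew _ _ _)]
      have k1 : AA l' 0 2 = 0 := by rw [s1 2 0, z1 2 (by decide), neg_zero]
      have k2 : AA l' 0 3 = 0 := by rw [s1 3 0, z1 3 (by decide), neg_zero]
      have k3 : AA l' 1 3 = 0 := by rw [s1 3 1, z2, neg_zero]
      funext i j
      fin_cases i <;> fin_cases j
      exacts [d0 0, rfl, k1, k2, s1 0 1, d0 1, rfl, k3, z1 2 (by decide), s1 1 2, d0 2, rfl,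
        z1 3 (by decide), z2, s1 2 3, d0 3]

/-- Every covariant is a combination of the generators after multiplication by a power of `dr`. -/
theorem IsCov.exists_pow_smul {F : Module.Dual ℂ g → C} (hF : IsCov F) :
    ∃ (N : ℕ) (P : Fin 2 × Fin 8 → MvPolynomial (Fin 4) ℂ),
      ∀ l, dr l ^ N • F l = ∑ t, MvPolynomial.eval (inv l) (P t) • gen t l := by
  obtain ⟨N, P, hP⟩ := hF.inM
  dsimp only at hP
  refine ⟨N, P, fun l => ?_⟩
  have hdr : dr ∈ Pol := mul_mem (inv_mem_Pol 2) (inv_mem_Pol 3)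
  have hd : ∃ l, dr l ≠ 0 := ⟨slice 1, by rw [dr_slice]; simp⟩
  refine cbasis.ext_elem fun I => ?_
  rw [← sub_eq_zero, ← Finsupp.sub_apply, ← map_sub]
  refine eq_zero_of_mul_eq_zero (f := fun l => cbasis.coord I (dr l ^ N • F l -
    ∑ t, MvPolynomial.eval (inv l) (P t) • gen t l)) ?_ hdr hd (fun l hl h => ?_) l
  · simp only [map_sub, map_smul, map_sum, smul_eq_mul]
    refine sub_mem (mul_mem (pow_mem hdr N) (hF.pol _)) ?_
    have : (fun l => ∑ t, MvPolynomial.eval (inv l) (P t) * cbasis.coord I (gen t l)) =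
        ∑ t, fun l => MvPolynomial.eval (inv l) (P t) * cbasis.coord I (gen t l) := by
      funext l
      rw [Finset.sum_apply]
    rw [this]
    exact Subalgebra.sum_mem _ fun t _ => mul_mem (eval_inv_mem_Pol _) (gen_mem_Pol t _)
  -- Equivariance of both sides carries the identity from the slice to every real form with `dr l ≠
  -- 0`.
  · obtain ⟨k, x, hk⟩ := exists_coad_eq_slice hl h
    have h1 := congrArg (actC k) (hP x)
    rw [← hk] at h1
    have hdk : dr (coad k l) = dr l := by rw [dr, inv_coad, dr]
    simp only [map_smul, map_sum, gen_coad, hF.equivariant, hdk, inv_coad] at h1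
    rw [h1, sub_self, map_zero]

end SO41

/-! ### Removing the denominators. -/

namespace SO41

attribute [local instance 100] LieRing.ofAssociativeRing

open MvPolynomial in
theorem X_dvd_of_eval {q : MvPolynomial (Fin 4) ℂ} {t : Fin 4}
    (h : ∀ y : Fin 4 → ℂ, y t = 0 → eval y q = 0) : X t ∣ q := by
  have h0 : aeval (Function.update X t 0 : Fin 4 → MvPolynomial (Fin 4) ℂ) q = 0 := by
    refine MvPolynomial.funext fun y => ?_
    rw [map_zero, ← h (Function.update y t 0) (by simp), ← coe_aeval_eq_eval, ← coe_aeval_eq_eval]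
    change (aeval y) (aeval _ q) = _
    rw [← AlgHom.comp_apply, comp_aeval]
    change aeval _ q = aeval _ q
    congr 2
    funext i
    rcases eq_or_ne i t with rfl | hi
    · simp
    · simp [hi]
  have h1 : ∀ q : MvPolynomial (Fin 4) ℂ,
      X t ∣ q - aeval (Function.update X t 0 : Fin 4 → MvPolynomial (Fin 4) ℂ) q := by
    intro q
    induction q using MvPolynomial.induction_on with
    | C a => simp
    | add p q hp hq =>
      rw [map_add, add_sub_add_comm]
      exact dvd_add hp hq
    | mul_X p i hp =>
      rw [map_mul, aeval_X]
      rcases eq_or_ne i t with rfl | hi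
      · rw [Function.update_self, mul_zero, sub_zero]
        exact dvd_mul_left _ _
      · rw [Function.update_of_ne hi, ← sub_mul]
        exact hp.mul_right _
  have h2 := h1 q
  rwa [h0, sub_zero] at h2

/-- The skew matrix with given entries above the diagonal. -/
def skew (a b c d e f : ℂ) : Fin 4 → Fin 4 → ℂ :=
  ![![0, a, b, c], ![-a, 0, d, e], ![-b, -d, 0, f], ![-c, -e, -f, 0]]

theorem skew_skew (a b c d e f : ℂ) (i j : Fin 4) :
    skew a b c d e f j i = -skew a b c d e f i j := by
  fin_cases i <;> fin_cases j <;> simp [skew]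

/-- The hyperplanes `y₂ = 0` and `y₃ = 0` are contained in the image of `inv`, so vanishing at
linear forms gives vanishing on the whole hyperplane. -/
theorem exists_inv_eq {t : Fin 4} (ht : t = 2 ∨ t = 3) {y : Fin 4 → ℂ} (hy : y t = 0) :
    ∃ l, inv l = y := by
  rcases ht with rfl | rfl
  · obtain ⟨p, hp⟩ := IsAlgClosed.exists_eq_mul_self (y 0 - y 3 + 2 * y 1)
    obtain ⟨q, hq⟩ := IsAlgClosed.exists_eq_mul_self (y 0 - y 3 - 2 * y 1)
    obtain ⟨r, hr⟩ := IsAlgClosed.exists_eq_mul_self (y 3)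
    -- The vector is isotropic, which gives `y₂ = 0`. The entry `r` contributes `r² = y₃` to both
    -- `y₀` and `y₃`, and `p`, `q` are chosen so that the other two entries have the required sum of
    -- squares and product.
    refine ⟨form ![1, Complex.I, 0, 0] (skew ((p + q) / 2) r 0 0 0 ((p - q) / 2)), ?_⟩
    rw [inv_eq, vv_form, AA_form _ (skew_skew _ _ _ _ _ _)]
    have hI := Complex.I_mul_I
    funext i
    fin_cases i
    all_goals
      simp only [skew, Fin.sum_univ_four, Matrix.cons_val, Fin.zero_eta, Fin.mk_one,
          Fin.reduceFinMk]
    · linear_combination (-1 / 2) * hp - (1 / 2) * hq - hr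
    · linear_combination (-1 / 4) * hp + (1 / 4) * hq
    · rw [hy]; linear_combination hI
    · linear_combination -hr + ((p + q) / 2) ^ 2 * hI
  · obtain ⟨s, hs⟩ := IsAlgClosed.exists_eq_mul_self (y 2)
    obtain ⟨p, hp⟩ := IsAlgClosed.exists_eq_mul_self (y 0 - y 1 ^ 2)
    -- The first column of the skew matrix is isotropic but nonzero: `Av · Av` vanishes while the
    -- Pfaffian is still free.
    refine ⟨form ![s, 0, 0, 0] (skew 1 Complex.I 0 p 0 (y 1)), ?_⟩
    rw [inv_eq, vv_form, AA_form _ (skew_skew _ _ _ _ _ _)]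
    have hI := Complex.I_mul_I
    funext i
    fin_cases i
    all_goals
      simp only [skew, Fin.sum_univ_four, Matrix.cons_val, Fin.zero_eta, Fin.mk_one,
          Fin.reduceFinMk]
    · linear_combination hI - hp
    · ring
    · linear_combination -hs
    · rw [hy]; linear_combination s ^ 2 * hI

open MvPolynomial in
/-- The polynomial with values `disc`. -/
noncomputable def discPoly : MvPolynomial (Fin 4) ℂ :=
  (X 3 * X 2 * X 0 - X 3 ^ 2 - X 1 ^ 2 * X 2 ^ 2) * (X 0 ^ 2 - MvPolynomial.C 4 * X 1 ^ 2)

theorem eval_discPoly (y : Fin 4 → ℂ) : MvPolynomial.eval y discPoly = disc y := by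
  simp [discPoly, disc]

theorem not_X_dvd_discPoly {t : Fin 4} (ht : t = 2 ∨ t = 3) : ¬ MvPolynomial.X t ∣ discPoly := by
  rintro ⟨q, hq⟩
  have h : ∀ y : Fin 4 → ℂ, y t = 0 → disc y = 0 := by
    intro y hy
    rw [← eval_discPoly, hq, map_mul, MvPolynomial.eval_X, hy, zero_mul]
  rcases ht with rfl | rfl
  · have := h ![1, 0, 0, 1] (by simp)
    simp only [disc, Matrix.cons_val] at this
    norm_num at this
  · have := h ![3, 1, 1, 0] (by simp)
    simp only [disc, Matrix.cons_val] at this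
    norm_num at this

theorem eq_of_mul_eq {F G : Module.Dual ℂ g → C} (hF : ∀ φ : C →ₗ[ℂ] ℂ, (fun l => φ (F l)) ∈ Pol)
    (hG : ∀ φ : C →ₗ[ℂ] ℂ, (fun l => φ (G l)) ∈ Pol) {h : Module.Dual ℂ g → ℂ} (hh : h ∈ Pol)
    (h0 : ∃ l, h l ≠ 0) (hFG : ∀ l, IsRealForm l → h l ≠ 0 → F l = G l) (l : Module.Dual ℂ g) :
    F l = G l := by
  refine cbasis.ext_elem fun I => ?_
  rw [← sub_eq_zero]
  refine eq_zero_of_mul_eq_zero (f := fun l => cbasis.coord I (F l) - cbasis.coord I (G l))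
    (sub_mem (hF _) (hG _)) hh h0 (fun l hl h => ?_) l
  rw [hFG l hl h, sub_self]

theorem sum_gen_mem_Pol (P : Fin 2 × Fin 8 → MvPolynomial (Fin 4) ℂ) (φ : C →ₗ[ℂ] ℂ) :
    (fun l => φ (∑ t, MvPolynomial.eval (inv l) (P t) • gen t l)) ∈ Pol := by
  have : (fun l => φ (∑ t, MvPolynomial.eval (inv l) (P t) • gen t l)) =
      ∑ t, fun l => MvPolynomial.eval (inv l) (P t) * φ (gen t l) := by
    funext l
    rw [Finset.sum_apply, map_sum]
    simp only [map_smul, smul_eq_mul]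
  rw [this]
  exact Subalgebra.sum_mem _ fun t _ => mul_mem (eval_inv_mem_Pol _) (gen_mem_Pol t _)

/-- Where `y_t = 0` and `disc ≠ 0` the sum vanishes, so pointwise independence kills each
coefficient. Hence `X t` divides `P s * discPoly`, and therefore `P s`. -/
theorem exists_of_inv_smul {t : Fin 4} (ht : t = 2 ∨ t = 3) {F : Module.Dual ℂ g → C}
    (hF : ∀ φ : C →ₗ[ℂ] ℂ, (fun l => φ (F l)) ∈ Pol)
    (h : ∃ P : Fin 2 × Fin 8 → MvPolynomial (Fin 4) ℂ,
      ∀ l, inv l t • F l = ∑ s, MvPolynomial.eval (inv l) (P s) • gen s l) :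
    ∃ P : Fin 2 × Fin 8 → MvPolynomial (Fin 4) ℂ,
      ∀ l, F l = ∑ s, MvPolynomial.eval (inv l) (P s) • gen s l := by
  obtain ⟨P, hP⟩ := h
  have h1 : ∀ s, MvPolynomial.X t ∣ P s := by
    intro s
    have h2 : MvPolynomial.X t ∣ P s * discPoly := by
      refine X_dvd_of_eval fun y hy => ?_
      rw [map_mul, eval_discPoly]
      by_cases hd : disc y = 0
      · rw [hd, mul_zero]
      · obtain ⟨l, rfl⟩ := exists_inv_eq ht hy
        have h3 := hP l
        rw [hy, zero_smul] at h3
        rw [Fintype.linearIndependent_iff.1 (linearIndependent_gen hd) _ h3.symm s, zero_mul]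
    exact (MvPolynomial.X_prime.dvd_or_dvd h2).resolve_right (not_X_dvd_discPoly ht)
  choose P' hP' using h1
  refine ⟨P', eq_of_mul_eq hF (sum_gen_mem_Pol P') (inv_mem_Pol t) ?_ fun l _ hl => ?_⟩
  · refine ⟨slice 1, ?_⟩
    rw [inv_slice]
    rcases ht with rfl | rfl <;> simp
  · refine smul_right_injective C hl ?_
    dsimp only
    rw [hP, Finset.smul_sum]
    refine Finset.sum_congr rfl fun s _ => ?_
    rw [hP' s, map_mul, MvPolynomial.eval_X, mul_smul]

/-- Every covariant is a combination of the generators. -/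
theorem IsCov.exists_eq_sum {F : Module.Dual ℂ g → C} (hF : IsCov F) :
    ∃ P : Fin 2 × Fin 8 → MvPolynomial (Fin 4) ℂ,
      ∀ l, F l = ∑ t, MvPolynomial.eval (inv l) (P t) • gen t l := by
  obtain ⟨N, h⟩ := hF.exists_pow_smul
  induction N with
  | zero => simpa only [pow_zero, one_smul] using h
  | succ N ih =>
    have hp : ∀ (M : ℕ) (f : Module.Dual ℂ g → ℂ), f ∈ Pol → ∀ φ : C →ₗ[ℂ] ℂ,
        (fun l => φ ((f l * dr l ^ M) • F l)) ∈ Pol := by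
      intro M f hf φ
      simp only [map_smul, smul_eq_mul]
      exact mul_mem (mul_mem hf (pow_mem (mul_mem (inv_mem_Pol 2) (inv_mem_Pol 3)) M)) (hF.pol φ)
    refine ih ?_
    obtain ⟨P, hP⟩ := h
    -- One factor `dr = y₂ y₃` is removed in two divisions, first by `y₂` and then by `y₃`.
    have h1 := exists_of_inv_smul (Or.inl rfl) (hp N _ (inv_mem_Pol 3)) ⟨P, fun l => by
      rw [← hP, smul_smul]
      congr 1
      rw [pow_succ, dr]
      ring⟩
    refine exists_of_inv_smul (Or.inr rfl) (fun φ => ?_) (h1.imp fun P hP l => ?_)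
    · simpa only [Pi.one_apply, one_mul] using hp N 1 (one_mem _) φ
    · rw [← hP, smul_smul]

end SO41

/-! ### From covariants to the filtered algebra. -/

namespace SO41

attribute [local instance 100] LieRing.ofAssociativeRing

open PBW

/-- The weighted degree of a monomial in the invariants. -/
def wdeg (d : Fin 4 →₀ ℕ) : ℕ := d 0 * ideg 0 + (d 1 * ideg 1 + (d 2 * ideg 2 + d 3 * ideg 3))

/-- The monomials in the invariants. -/
noncomputable def monU (d : Fin 4 →₀ ℕ) : U :=
  invU 0 ^ d 0 * (invU 1 ^ d 1 * (invU 2 ^ d 2 * invU 3 ^ d 3))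

theorem monU_mem (d : Fin 4 →₀ ℕ) : monU d ∈ UK :=
  mul_mem (pow_mem (invU_mem 0) _) (mul_mem (pow_mem (invU_mem 1) _)
    (mul_mem (pow_mem (invU_mem 2) _) (pow_mem (invU_mem 3) _)))

theorem hasSymU_monU (d : Fin 4 →₀ ℕ) :
    HasSymU (wdeg d) (monU d) fun l => ∏ i, inv l i ^ d i := by
  have h := ((hasSymU_invU 0).pow (d 0)).mul (((hasSymU_invU 1).pow (d 1)).mul
    (((hasSymU_invU 2).pow (d 2)).mul ((hasSymU_invU 3).pow (d 3))))
  refine ⟨h.mem, fun l => (h.eq l).trans ?_⟩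
  rw [Fin.prod_univ_four]
  ring

theorem prod_inv_smul (d : Fin 4 →₀ ℕ) (c : ℂ) (l : Module.Dual ℂ g) :
    ∏ i, inv (c • l) i ^ d i = c ^ wdeg d * ∏ i, inv l i ^ d i := by
  simp only [inv_smul, Fin.prod_univ_four, wdeg, mul_pow, pow_add, pow_mul']
  ring

/-- Evaluate at `c • l` and compare the coefficients of `c ^ n`: terms of any other weighted degree
cancel and may be dropped. Only then does each term lift to filtration degree `n`. -/
theorem IsCov.exists_homogeneous {F : Module.Dual ℂ g → C} (hF : IsCov F) {n : ℕ}
    (hn : ∀ (c : ℂ) l, F (c • l) = c ^ n • F l) :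
    ∃ P : Fin 2 × Fin 8 → MvPolynomial (Fin 4) ℂ, ∀ l, F l =
      ∑ t, ∑ d ∈ (P t).support with wdeg d + bdeg t.2 = n,
        ((P t).coeff d * ∏ i, inv l i ^ d i) • gen t l := by
  obtain ⟨P, hP⟩ := hF.exists_eq_sum
  refine ⟨P, fun l => cbasis.ext_elem fun I => ?_⟩
  have h1 : ∑ t, ∑ d ∈ (P t).support, Polynomial.monomial (wdeg d + bdeg t.2)
      ((P t).coeff d * (∏ i, inv l i ^ d i) * cbasis.coord I (gen t l)) =
      Polynomial.monomial n (cbasis.coord I (F l)) := by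
    refine Polynomial.funext fun c => ?_
    have h2 := congrArg (cbasis.coord I) ((hn c l).symm.trans (hP (c • l)))
    rw [map_smul, smul_eq_mul, mul_comm, map_sum] at h2
    rw [Polynomial.eval_monomial, h2, Polynomial.eval_finsetSum]
    refine Finset.sum_congr rfl fun t _ => ?_
    rw [gen_smul, MvPolynomial.eval_eq', map_smul, map_smul, smul_eq_mul, smul_eq_mul,
      Finset.sum_mul, Polynomial.eval_finsetSum]
    refine Finset.sum_congr rfl fun d _ => ?_
    rw [Polynomial.eval_monomial, prod_inv_smul]
    ring
  have h3 := congrArg (fun p => Polynomial.coeff p n) h1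
  simp only [Polynomial.finsetSum_coeff, Polynomial.coeff_monomial, if_true] at h3
  change cbasis.coord I (F l) = cbasis.coord I _
  rw [← h3, map_sum]
  refine Finset.sum_congr rfl fun t _ => ?_
  rw [map_sum, Finset.sum_filter]
  refine Finset.sum_congr rfl fun d _ => ?_
  rw [map_smul, smul_eq_mul]

/-- The basis of the algebra of invariants over `UK`. -/
noncomputable def bvec (t : Fin 2 × Fin 8) : UCK :=
  ⟨bgens ((1 : U) ⊗ₜ[ℂ] omega) spin dirac t, bgens_mem t⟩

theorem hasSym_smul_bvec {m n : ℕ} {u : UK} {f : Module.Dual ℂ g → ℂ} (t : Fin 2 × Fin 8)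
    (hu : HasSymU m (u : U) f) (hn : m + bdeg t.2 = n) :
    HasSym n ((u • bvec t : UCK) : U ⊗[ℂ] C) fun l => f l • gen t l := by
  subst hn
  have h := (HasSym.tmul hu 1).mul (hasSym_bgens t)
  refine ⟨h.mem, fun l => (h.eq l).trans ?_⟩
  rw [smul_mul_assoc, one_mul]
  rfl

/-- The covariants that are symbols of elements of the span of the basis. -/
def Lifts (n : ℕ) (F : Module.Dual ℂ g → C) : Prop :=
  ∃ w ∈ Submodule.span UK (Set.range bvec), HasSym n (w : U ⊗[ℂ] C) F

theorem HasSym.of_eq_zero {n : ℕ} {z : U ⊗[ℂ] C} {F : Module.Dual ℂ g → C} (hz : z = 0)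
    (hF : ∀ l, F l = 0) : HasSym n z F := by
  subst hz
  exact ⟨zero_mem (tens (filt ℂ g n)), fun l => (LinearMap.map_zero (symC n l)).trans (hF l).symm⟩

theorem Lifts.sum {n : ℕ} {ι : Type*} (s : Finset ι) {F : ι → Module.Dual ℂ g → C}
    (h : ∀ i ∈ s, Lifts n (F i)) : Lifts n fun l => ∑ i ∈ s, F i l := by
  classical
  induction s using Finset.induction_on with
  | empty =>
    exact ⟨0, zero_mem _, HasSym.of_eq_zero (ZeroMemClass.coe_zero UCK) fun l => Finset.sum_empty⟩
  | insert a s ha ih =>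
    obtain ⟨w, hw, hw'⟩ := h a (Finset.mem_insert_self _ _)
    obtain ⟨w', hs, hs'⟩ := ih fun i hi => h i (Finset.mem_insert_of_mem hi)
    refine ⟨w + w', add_mem hw hs, add_mem hw'.mem hs'.mem, fun l => ?_⟩
    rw [Finset.sum_insert ha, ← hw'.eq, ← hs'.eq]
    exact map_add (symC n l) _ _

theorem isCov_symC {n : ℕ} (z : UCK) (hz : (z : U ⊗[ℂ] C) ∈ tens (filt ℂ g n)) :
    IsCov fun l => symC n l (z : U ⊗[ℂ] C) where
  pol φ := symC_mem_Pol hz φ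
  equivariant k l := by
    rw [← symC_actUC k l hz, (mem_UCK _).1 z.2 k]

/-- Each monomial in the invariants is the symbol of the same monomial in `invU`, in a fixed order,
and this lies in `U(𝔤)^K`. -/
theorem lifts_symC {n : ℕ} (z : UCK) (hz : (z : U ⊗[ℂ] C) ∈ tens (filt ℂ g n)) :
    Lifts n fun l => symC n l (z : U ⊗[ℂ] C) := by
  obtain ⟨P, hP⟩ := (isCov_symC z hz).exists_homogeneous fun c l => symC_smul c l hz
  simp only [hP]
  refine Lifts.sum _ fun t _ => Lifts.sum _ fun d hd => ?_
  have h := (hasSymU_monU d).smul ((P t).coeff d)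
  exact ⟨(⟨_, UK.smul_mem (monU_mem d) ((P t).coeff d)⟩ : UK) • bvec t,
    Submodule.smul_mem _ _ (Submodule.subset_span ⟨t, rfl⟩),
    hasSym_smul_bvec t h (Finset.mem_filter.1 hd).2⟩

/-- Subtracting a lift of the top symbol leaves an invariant of lower filtration. -/
theorem mem_span_bvec (n : ℕ) : ∀ z : UCK, (z : U ⊗[ℂ] C) ∈ tens (filtLT ℂ g n) →
    z ∈ Submodule.span UK (Set.range bvec) := by
  induction n with
  | zero =>
    intro z hz
    have h0 : (z : U ⊗[ℂ] C) = 0 := by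
      refine tens_induction (P := fun z => z = 0) rfl ?_ ?_ hz
      · intro u hu c
        rw [(Submodule.mem_bot ℂ).1 hu, TensorProduct.zero_tmul]
      · intro x y hx hy
        rw [hx, hy, add_zero]
    have h1 : z = 0 := Subtype.ext h0
    rw [h1]
    exact zero_mem _
  | succ n ih =>
    intro z hz
    obtain ⟨w, hw, hw'⟩ := lifts_symC (n := n) z hz
    have h1 : ((z - w : UCK) : U ⊗[ℂ] C) ∈ tens (filtLT ℂ g n) := by
      refine mem_tens_filtLT_of_symC (sub_mem hz hw'.mem) fun l => ?_
      exact (map_sub (symC n l) _ _).trans (sub_eq_zero.2 (hw'.eq l).symm)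
    have h2 := add_mem (ih _ h1) hw
    rwa [sub_add_cancel] at h2

theorem span_bvec : ⊤ ≤ Submodule.span UK (Set.range bvec) := by
  intro z _
  obtain ⟨m, hm⟩ := exists_mem_tens (z : U ⊗[ℂ] C)
  exact mem_span_bvec (m + 1) z hm

theorem disc_mem_Pol : (fun l => disc (inv l)) ∈ Pol := by
  simp only [← eval_discPoly]
  exact eval_inv_mem_Pol _

theorem exists_disc_ne_zero : ∃ l, disc (inv l) ≠ 0 := by
  refine ⟨slice ![1, 1, 1, 0], ?_⟩
  rw [inv_slice]
  simp only [disc, Matrix.cons_val]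
  norm_num

theorem hasSym_smul_bvec_sym {N : ℕ} {u : UK} (t : Fin 2 × Fin 8)
    (h1 : bdeg t.2 ≤ N → (u : U) ∈ filt ℂ g (N - bdeg t.2)) (h2 : ¬ bdeg t.2 ≤ N → (u : U) = 0) :
    HasSym N ((u • bvec t : UCK) : U ⊗[ℂ] C) fun l =>
      (if bdeg t.2 ≤ N then sym (N - bdeg t.2) l u else 0) • gen t l := by
  by_cases ht : bdeg t.2 ≤ N
  · simp only [if_pos ht]
    exact hasSym_smul_bvec t ⟨h1 ht, fun l => rfl⟩ (Nat.sub_add_cancel ht)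
  · have h4 : u = 0 := Subtype.ext (h2 ht)
    have h5 : u • bvec t = 0 := (congrArg (· • bvec t) h4).trans (zero_smul UK (bvec t))
    refine HasSym.of_eq_zero (congrArg Subtype.val h5) fun l => ?_
    rw [if_neg ht]
    exact zero_smul ℂ (gen t l)

/-- In a relation, the top symbols of the coefficients give a linear relation among the `gen t l` at
each `l`. Where `disc ≠ 0` they vanish, hence everywhere by density, and the coefficients drop in
the filtration. -/
theorem linearIndependent_bvec : LinearIndependent UK bvec := by
  rw [Fintype.linearIndependent_iff]
  intro u hu
  have hu' : ∑ t, ((u t • bvec t : UCK) : U ⊗[ℂ] C) = 0 := by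
    rw [← AddSubmonoidClass.coe_finsetSum, hu]
    rfl
  -- `N` bounds the total degree of the terms. The truncated subtraction is harmless since `filtLT`
  -- at `0` is `⊥`: a coefficient with `bdeg t.2 ≥ N` is already zero.
  have key : ∀ N : ℕ, (∀ t, (u t : U) ∈ filtLT ℂ g (N - bdeg t.2)) → ∀ t, (u t : U) = 0 := by
    intro N
    induction N with
    | zero =>
      intro h t
      have := h t
      rw [Nat.zero_sub] at this
      exact (Submodule.mem_bot ℂ).1 this
    | succ N ih =>
      intro h
      refine ih fun t => ?_
      have h1 : ∀ t, bdeg t.2 ≤ N → (u t : U) ∈ filt ℂ g (N - bdeg t.2) := by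
        intro t ht
        have := h t
        rwa [Nat.succ_sub ht] at this
      have h2 : ∀ t, ¬ bdeg t.2 ≤ N → (u t : U) = 0 := by
        intro t ht
        have := h t
        rw [Nat.sub_eq_zero_of_le (by omega)] at this
        exact (Submodule.mem_bot ℂ).1 this
      have h3 := fun t => hasSym_smul_bvec_sym (u := u t) t (h1 t) (h2 t)
      have h6 : ∀ l, ∑ t, (if bdeg t.2 ≤ N then sym (N - bdeg t.2) l (u t) else 0) • gen t l =
          0 := by
        intro l
        rw [← (HasSym.sum Finset.univ fun t _ => h3 t).eq l]
        exact (congrArg (symC N l) hu').trans (LinearMap.map_zero (symC N l))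
      by_cases ht : bdeg t.2 ≤ N
      · refine mem_filtLT_of_sym (h1 t ht) ?_
        refine eq_zero_of_mul_eq_zero (sym_mem_Pol (h1 t ht)) disc_mem_Pol exists_disc_ne_zero
          fun l _ hl => ?_
        have := Fintype.linearIndependent_iff.1 (linearIndependent_gen hl) _ (h6 l) t
        rwa [if_pos ht] at this
      · rw [h2 t ht]
        exact zero_mem _
  choose m hm using fun t => exists_mem_filt (k := ℂ) (L := g) (u t : U)
  intro t
  -- The generators have degree at most `4`, and one more is needed because `filtLT` is the
  -- preceding step.
  refine Subtype.ext (key (Finset.univ.sup m + 5) (fun t => ?_) t)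
  have hb : bdeg t.2 ≤ 4 := by
    generalize t.2 = s
    fin_cases s <;> decide
  obtain ⟨k, hk⟩ : ∃ k, Finset.univ.sup m + 5 - bdeg t.2 = k + 1 :=
    ⟨Finset.univ.sup m + 4 - bdeg t.2, by omega⟩
  have hle := Finset.le_sup (f := m) (Finset.mem_univ t)
  rw [hk]
  exact filt_mono (by omega) (hm t)

end SO41

theorem mainTheorem4 : Nonempty (Module.Basis (Fin 16) SO41.UK SO41.UCK) :=
  ⟨(Module.Basis.mk SO41.linearIndependent_bvec SO41.span_bvec).reindex finProdFinEquiv⟩
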